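/- **Setting.** Let $\mathbf A=(\mathbf{RP}^1\times\mathbf{RP}^1)\setminus\Delta$ be the split annulus, with the two foliations given by the fibres of the projections. Write $a,b$ for the angular coordinates (period $\pi$) on the two factors. Metrics on $\mathbf A$ are smooth Lorentz metrics $g$ compatible with the split structure, i.e. both foliations are $g$-isotropic and $g(\partial_a,\partial_b)>0$. The area form is $\mathrm da_g=g(\partial_a,\partial_b)\,\mathrm da\wedge \mathrm db$, and $K(g)$ is the sectional curvature of the Levi-Civita connection. Let $(W,\langle\cdot,\cdot\rangle)$ be $\mathbb R^4$ with a form of signature $(2,2)$ and its volume form $\det$. An *isotropic surface* with first fundamental form at infinity $g$ is a smooth map $\sigma:\mathbf A\to W$ such that $\langle\sigma,\sigma\rangle=0$, the vectors $\sigma,\partial_a\sigma,\partial_b\sigma$ are linearly independent, and $\langle \mathrm D_X\sigma,\mathrm D_Y\sigma\rangle=g(X,Y)$. Its dual $\eta$ is determined by $\langle\eta,\eta\rangle=0$, $\langle\eta,\sigma\rangle=1$, $\langle\eta,\mathrm D_X\sigma\rangle=0$. The immersion $[\sigma]$ into the Einstein torus (the quadric of isotropic lines of $W$) is required to respect orientations: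 $\det(\sigma,\eta,\partial_a\sigma,\partial_b\sigma)>0$. The associated *Epstein surface* is $$(x,n)=\tfrac{\sqrt2}{2}(\sigma-\eta,\ \sigma+\eta):\mathbf A\to \mathsf U=\{(x,n)\in W^2 : \langle x,x\rangle=-1,\ \langle n,n\rangle=1,\ \langle x,n\rangle=0\}.$$ On $\mathsf U$ consider the forms $\omega(u,v,w)=\det(x,u_1,v_1,w_1)$ and $\alpha(u,v)=\frac14\big(\det(x,n,u_2,v_1)+\det(x,n,u_1,v_2)\big)$. For metrics $g,h$ equal outside a compact set, a *lens cobordism* from $g$ to $h$ is a smooth map $\varphi:\mathbf A\times[0,1]\to\mathsf U$, independent of $t\in[0,1]$ outside a compact subset of $\mathbf A$, whose restrictions to $t=0$ and $t=1$ are Epstein surfaces of $g$ and $h$ over the same immersion $[\sigma]$. The *Liouville action* $\mathcal S(g,h)$ is the $\mathcal W$-volume $$\mathcal S(g,h)=\int_{\mathbf A\times[0,1]}\varphi^*\omega-\int_{\partial(\mathbf A\times[0,1])}\varphi^*\alpha$$ of any such lens cobordism, over any such immersion. The boundary term is $\int_{\mathbf A}(\varphi_1^*\alpha-\varphi_0^*\alpha)$,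 where $\varphi_t=\varphi(\cdot,t)$. An *area preserving deformation* of $g$ is a family $(g_t)_{t\in\mathbb R}$ of compatible metrics, smooth in $t$ and in the point of $\mathbf A$ jointly, with $g_0=g$, such that for some compact $K\subset\mathbf A$ all $g_t$ equal $g$ outside $K$ and $\frac{\mathrm d}{\mathrm dt}\big|_{t=0}\int_K \mathrm da_{g_t}=0$. **Theorem.** Let $g$ be a smooth Lorentz metric on $\mathbf A$ compatible with the split structure. 1. $g$ has constant curvature if and only if, for every smooth compactly supported function $u$ on $\mathbf A$ with $\int_{\mathbf A}u\,\mathrm da_g=0$, $$\frac{\mathrm d}{\mathrm dt}\Big|_{t=0}\mathcal S(g,e^{2tu}g)=0 .$$ 2. $g$ has constant curvature if and only if, for every area preserving deformation $(g_t)_{t\in\mathbb R}$ of $g$, $$\frac{\mathrm d}{\mathrm dt}\Big|_{t=0}\mathcal S(g_t,g)=0 .$$ In both statements, the vanishing of the derivative includes its existence. -/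

import Mathlib

open MeasureTheory
open scoped ContDiff

noncomputable section

namespace SplitLiouville

/-! ### The split annulus and calculus on it -/

instance factPiPos : Fact (0 < Real.pi) := ⟨Real.pi_pos⟩

/-- The real projective line, parametrized by angle: the class of `θ` modulo `π` is the line of
`ℝ²` spanned by `(cos θ, sin θ)`. -/
abbrev RP1 : Type := AddCircle Real.pi

/-- The split annulus `𝐀 = (ℝP¹ × ℝP¹) ∖ Δ`. The vector fields `∂₀`, `∂₁` of the two angular
coordinates are a global frame, tangent to the two foliations of the split structure, and
`(∂₀, ∂₁)` is positively oriented. -/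
abbrev Annulus : Type := {p : RP1 × RP1 // p.1 ≠ p.2}

open Classical in
/-- Extension of a map on `𝐀` by `0` to the torus `ℝP¹ × ℝP¹`. -/
def extendZero {E : Type} [Zero E] (f : Annulus → E) (p : RP1 × RP1) : E :=
  if h : p.1 ≠ p.2 then f ⟨p, h⟩ else 0

/-- A map on `𝐀` read in the angular coordinates `(a, b) ∈ ℝ²`; it is meaningful on `angleDomain`. -/
def lift {E : Type} [Zero E] (f : Annulus → E) (q : ℝ × ℝ) : E :=
  extendZero f ((q.1 : RP1), (q.2 : RP1))

/-- The open set of pairs of angles which represent a point of `𝐀`. The projection from it to `𝐀`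
is a covering, whose local inverses are charts of `𝐀`. -/
def angleDomain : Set (ℝ × ℝ) := {q | (q.1 : RP1) ≠ (q.2 : RP1)}

/-- `C^∞` maps on `𝐀`. -/
def IsSmooth {E : Type} [NormedAddCommGroup E] [NormedSpace ℝ E] (f : Annulus → E) : Prop :=
  ContDiffOn ℝ ∞ (lift f) angleDomain

/-- The partial derivative `∂ᵢ f` in the angular coordinates. -/
def pd {E : Type} [NormedAddCommGroup E] [NormedSpace ℝ E] (i : Fin 2) (f : Annulus → E) :
    Annulus → E := fun p =>
  deriv (fun s : ℝ => extendZero f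
    (p.1.1 + (((if i = 0 then s else 0 : ℝ)) : RP1), p.1.2 + (((if i = 1 then s else 0 : ℝ)) : RP1)))
    0

/-- The measure `da db` of the angular coordinates on `𝐀`. -/
def angularMeasure : Measure Annulus := Measure.comap Subtype.val volume

/-! ### Metrics compatible with the split structure, and their curvature -/

/-- A smooth Lorentz metric on `𝐀` compatible with the split structure, given by its components
`gᵢⱼ = g(∂ᵢ, ∂ⱼ)`: the leaves of both foliations are isotropic, and `g` is positive on
oriented split bases. -/
structure SplitMetric where
  coeff : Fin 2 → Fin 2 → Annulus → ℝ
  smooth : ∀ i j, IsSmooth (coeff i j)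
  symm : ∀ i j p, coeff i j p = coeff j i p
  isotropic : ∀ i p, coeff i i p = 0
  pos : ∀ p, 0 < coeff 0 1 p

namespace SplitMetric

/-- The density of the area form, `ω_g(∂₀, ∂₁) = g(∂₀, I ∂₁) = g₀₁`, where `I ∂₁ = ∂₁` for the
canonical involution `I`. -/
def areaDensity (g : SplitMetric) (p : Annulus) : ℝ := g.coeff 0 1 p

/-- `∫_s f da_g`. -/
def areaIntegralOn (g : SplitMetric) (s : Set Annulus) (f : Annulus → ℝ) : ℝ :=
  ∫ p in s, f p * g.areaDensity p ∂angularMeasure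

/-- The inverse metric `gⁱʲ`. -/
def inv (g : SplitMetric) (i j : Fin 2) (p : Annulus) : ℝ :=
  (Matrix.of fun k l => g.coeff k l p)⁻¹ i j

/-- Christoffel symbols of the Levi-Civita connection: `∇_{∂ᵢ} ∂ⱼ = ∑ₖ Γᵏᵢⱼ ∂ₖ`. -/
def christoffel (g : SplitMetric) (k i j : Fin 2) (p : Annulus) : ℝ :=
  ∑ l, (1 / 2) * g.inv k l p *
    (pd i (g.coeff j l) p + pd j (g.coeff i l) p - pd l (g.coeff i j) p)

/-- The curvature tensor: `R(∂ᵢ, ∂ⱼ) ∂ₖ = ∑ₗ Rˡₖᵢⱼ ∂ₗ`, with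
`R(X, Y) = ∇_X ∇_Y - ∇_Y ∇_X - ∇_[X,Y]`. -/
def riemann (g : SplitMetric) (l k i j : Fin 2) (p : Annulus) : ℝ :=
  pd i (g.christoffel l j k) p - pd j (g.christoffel l i k) p +
    ∑ m, (g.christoffel l i m p * g.christoffel m j k p -
      g.christoffel l j m p * g.christoffel m i k p)

/-- The sectional curvature
`K(g) = g(R(∂₀, ∂₁) ∂₁, ∂₀) / (g(∂₀, ∂₀) g(∂₁, ∂₁) - g(∂₀, ∂₁)²)`. -/
def curvature (g : SplitMetric) (p : Annulus) : ℝ :=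
  (∑ l, g.riemann l 1 0 1 p * g.coeff l 0 p) /
    (g.coeff 0 0 p * g.coeff 1 1 p - g.coeff 0 1 p ^ 2)

/-- `g` has constant curvature. -/
def HasConstantCurvature (g : SplitMetric) : Prop := ∃ c : ℝ, ∀ p, g.curvature p = c

end SplitMetric

theorem IsSmooth.const_mul {u : Annulus → ℝ} (hu : IsSmooth u) (t : ℝ) :
    IsSmooth fun p => t * u p := by
  have h : lift (fun p => t * u p) = fun q => t * lift u q := by
    funext q
    by_cases hq : ((q.1 : RP1) ≠ (q.2 : RP1)) <;> simp [lift, extendZero, hq]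
  unfold IsSmooth
  rw [h]
  exact contDiffOn_const.mul hu

theorem IsSmooth.exp_mul {u f : Annulus → ℝ} (hu : IsSmooth u) (hf : IsSmooth f) :
    IsSmooth fun p => Real.exp (2 * u p) * f p := by
  have h : lift (fun p => Real.exp (2 * u p) * f p) =
      fun q => Real.exp (2 * lift u q) * lift f q := by
    funext q
    by_cases hq : ((q.1 : RP1) ≠ (q.2 : RP1)) <;> simp [lift, extendZero, hq]
  unfold IsSmooth
  rw [h]
  exact (contDiffOn_const.mul hu).exp.mul hf

/-- The conformal metric `e^{2u} g`. -/
def SplitMetric.conformal (g : SplitMetric) (u : Annulus → ℝ) (hu : IsSmooth u) : SplitMetric where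
  coeff i j p := Real.exp (2 * u p) * g.coeff i j p
  smooth i j := hu.exp_mul (g.smooth i j)
  symm i j p := by rw [g.symm i j p]
  isotropic i p := by rw [g.isotropic i p, mul_zero]
  pos p := mul_pos (Real.exp_pos _) (g.pos p)

/-- The Weyl scaling `e^{2tu} g`. -/
def SplitMetric.weyl (g : SplitMetric) (u : Annulus → ℝ) (hu : IsSmooth u) (t : ℝ) : SplitMetric :=
  g.conformal (fun p => t * u p) (hu.const_mul t)

/-! ### The quadratic space of signature `(2,2)` and Epstein surfaces -/

/-- The underlying space of the quadratic space `W`. -/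
abbrev W : Type := Fin 4 → ℝ

/-- The polar form `⟨·,·⟩` of the quadratic form of signature `(2,2)`. -/
def ip (v w : W) : ℝ := -(v 0 * w 0) - v 1 * w 1 + v 2 * w 2 + v 3 * w 3

/-- The volume form of `W`; the standard basis is orthonormal and positively oriented. -/
def det4 (v₀ v₁ v₂ v₃ : W) : ℝ := Matrix.det (Matrix.of ![v₀, v₁, v₂, v₃])

/-- A smooth isotropic surface `σ : 𝐀 → W` whose first fundamental form at infinity
`⟨D_X σ, D_Y σ⟩` is `g`, together with its dual isotropic surface `η`. The class `[σ]` is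
an immersion of `𝐀` in the Einstein torus (the quadric of isotropic lines of `W`), conformal for
`g`. The condition `oriented` says that this immersion respects the orientations and hence the
split structures, that is, the order of the two foliations by isotropic lines. -/
structure IsotropicSurface (g : SplitMetric) where
  σ : Annulus → W
  η : Annulus → W
  smooth : IsSmooth σ
  null : ∀ p, ip (σ p) (σ p) = 0
  transverse : ∀ p, LinearIndependent ℝ ![σ p, pd 0 σ p, pd 1 σ p]
  metric : ∀ i j p, ip (pd i σ p) (pd j σ p) = g.coeff i j p
  dual_null : ∀ p, ip (η p) (η p) = 0
  dual_pair : ∀ p, ip (η p) (σ p) = 1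
  dual_orth : ∀ i p, ip (η p) (pd i σ p) = 0
  oriented : ∀ p, 0 < det4 (σ p) (η p) (pd 0 σ p) (pd 1 σ p)

namespace IsotropicSurface

variable {g : SplitMetric}

/-- Base point of the Epstein surface: `x = (√2 / 2) (σ - η)`, a point of the anti-de Sitter space
`{x | ⟨x, x⟩ = -1}`. -/
def base (S : IsotropicSurface g) (p : Annulus) : W := (Real.sqrt 2 / 2) • (S.σ p - S.η p)

/-- Unit vector of the Epstein surface: `n = (√2 / 2) (σ + η)`. -/
def normal (S : IsotropicSurface g) (p : Annulus) : W := (Real.sqrt 2 / 2) • (S.σ p + S.η p)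

end IsotropicSurface

/-! ### Cobordisms, the `𝒲`-volume and the Liouville action -/

/-- The component on `(∂₀, ∂₁)` of the pull-back by `(x, n)` of the `2`-form
`α(u, v) = (1/4) (det(x, n, u₂, v₁) + det(x, n, u₁, v₂))` of the unit tangent bundle. -/
def alphaDensity (x n : Annulus → W) (p : Annulus) : ℝ :=
  (1 / 4) * (det4 (x p) (n p) (pd 0 n p) (pd 1 x p) + det4 (x p) (n p) (pd 0 x p) (pd 1 n p))

/-- A lens cobordism between the Epstein surfaces of `g` and `h` over one and the same immersion
of `𝐀` in the Einstein torus: a smooth map `(x, n)` from `𝐀 × [0,1]` to the spacelike unit tangent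
bundle of the anti-de Sitter space, which restricts to these surfaces at times `0` and `1`
and does not depend on time outside a compact set. -/
structure LensCobordism (g h : SplitMetric) where
  surf₀ : IsotropicSurface g
  surf₁ : IsotropicSurface h
  same_immersion : ∀ p, ∃ c : ℝ, surf₁.σ p = c • surf₀.σ p
  x : ℝ → Annulus → W
  n : ℝ → Annulus → W
  smooth_x : ContDiffOn ℝ ∞ (fun z : ℝ × (ℝ × ℝ) => lift (x z.1) z.2)
    (Set.Icc 0 1 ×ˢ angleDomain)
  smooth_n : ContDiffOn ℝ ∞ (fun z : ℝ × (ℝ × ℝ) => lift (n z.1) z.2)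
    (Set.Icc 0 1 ×ˢ angleDomain)
  mem_unitTangent : ∀ t ∈ Set.Icc (0 : ℝ) 1, ∀ p,
    ip (x t p) (x t p) = -1 ∧ ip (n t p) (n t p) = 1 ∧ ip (x t p) (n t p) = 0
  start_eq : x 0 = surf₀.base ∧ n 0 = surf₀.normal
  end_eq : x 1 = surf₁.base ∧ n 1 = surf₁.normal
  constant_at_infinity : ∃ K : Set Annulus, IsCompact K ∧
    ∀ t ∈ Set.Icc (0 : ℝ) 1, ∀ p ∉ K, x t p = x 0 p ∧ n t p = n 0 p

/-- The `𝒲`-volume `∫_{𝐀 × [0,1]} φ^* ω - ∫_{∂(𝐀 × [0,1])} φ^* α` of a lens cobordism `φ = (x, n)`,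
where `ω(u, v, w) = det(x, u₁, v₁, w₁)` is the pull-back of the volume form of the anti-de Sitter
space. The two ends of `𝐀 × [0,1]` contribute with opposite signs to the boundary integral, and
their difference is compactly supported. -/
def LensCobordism.wVolume {g h : SplitMetric} (C : LensCobordism g h) : ℝ :=
  (∫ t in (0 : ℝ)..1, ∫ p, det4 (C.x t p) (pd 0 (C.x t) p) (pd 1 (C.x t) p)
      (deriv (fun s => C.x s p) t) ∂angularMeasure) -
    ∫ p, (alphaDensity (C.x 1) (C.n 1) p - alphaDensity (C.x 0) (C.n 0) p) ∂angularMeasure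

open Classical in
/-- The Liouville action `𝒮(g, h)` of two metrics which are equal outside a compact set: the
`𝒲`-volume of any lens cobordism between their Epstein surfaces over any immersion
of `𝐀` in the Einstein torus. (If there is no such cobordism, the value is `0` by convention.) -/
def liouvilleAction (g h : SplitMetric) : ℝ :=
  if H : Nonempty (LensCobordism g h) then (Classical.choice H).wVolume else 0

/-- `γ` is an area preserving deformation of `g`: a smooth one-parameter family of compatible
metrics starting at `g`, all equal outside one compact set `K`, such that the derivative at `t = 0`
of the area of `K` vanishes. -/
structure IsAreaPreservingDeformation (g : SplitMetric) (γ : ℝ → SplitMetric) : Prop where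
  start : γ 0 = g
  smooth : ∀ i j, ContDiffOn ℝ ∞ (fun z : ℝ × (ℝ × ℝ) => lift ((γ z.1).coeff i j) z.2)
    (Set.univ ×ˢ angleDomain)
  area : ∃ K : Set Annulus, IsCompact K ∧
    (∀ t i j, ∀ p ∉ K, (γ t).coeff i j p = g.coeff i j p) ∧
    HasDerivAt (fun t => (γ t).areaIntegralOn K fun _ => 1) 0 0

end SplitLiouville

end

/-!
The Liouville action is computed in closed form; everything is then a statement about one function.
Write `F = g(∂₀, ∂₁)`, so that the curvature is given by `∂₀ ∂₁ log F = -K F`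
(`SplitMetric.pd_pd_logCoeff_eq_curvature`). For `h = e^{2u} g` with `u` compactly supported,

  `𝒮(g, h) = ∫ u (1/2) ∂₀ ∂₁ log F da db + (1/2) ∫ u ∂₀ ∂₁ u da db`   (`liouvilleAction_eq`).

Three facts lead to this formula.

* *Independence of the cobordism.* On the anti-de Sitter space, the volume form has the global
  primitive `volPrimitive`, which is half the wedge product of `x₂ dx₃ - x₃ dx₂` with the angular
  form of the plane `(x₀, x₁)`, regular because `x₀² + x₁² ≥ 1` there. By Stokes' theorem on
  `𝐀 × [0, 1]` (`integral_volume_density`), the `𝒲`-volume depends only on the two ends of the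
  cobordism. These are determined by the initial surface `σ` and by `u`: over the same immersion,
  the final surface must be `± e^u σ`, and the sign is `+` since it is `+` at infinity and `𝐀` is
  connected and not compact (`LensCobordism.σ₁_eq`).
* *One cobordism.* The surfaces `e^{tu} σ`, `t ∈ [0, 1]`, form a lens cobordism. With the structure
  equations of `σ` (Weingarten, Gauss, Codazzi) its `𝒲`-volume has density `u ⟨η, ∂₀ ∂₁ σ⟩` up to a
  divergence (`IsotropicSurface.weyl_variation`), and the Gauss equation
  `2 ⟨η, ∂₀ ∂₁ σ⟩ = ∂₀ ∂₁ log F` together with the conformal change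
  `⟨η, ∂₀ ∂₁ σ⟩ ↦ ⟨η, ∂₀ ∂₁ σ⟩ + t ∂₀ ∂₁ u` gives the formula.
* *Existence.* An explicit isotropic surface over a flat metric, rescaled, provides one over every
  compatible metric (`exists_isotropicSurface`), so that the action does not take its default value.

The first variation of `𝒮` at `g` is therefore `-(1/2) ∫ K u da_g` along `e^{2tu} g`, and
`(1/4) ∫ K Ḟ da db` in the first argument along a family with velocity `Ḟ` of `F`. Both vanish for
all mean zero `u`, respectively for all `Ḟ` with `∫ Ḟ da db = 0`, if and only if `K` is constant, by
the fundamental lemma of the calculus of variations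
(`SplitMetric.hasConstantCurvature_of_forall_integral`); for the second statement the deformations
`e^{2tu} g` suffice.
-/


noncomputable section

namespace SplitLiouville

open Set Filter Topology

/-! ### Angular coordinates -/

section Calculus

variable {E F : Type} [NormedAddCommGroup E] [NormedSpace ℝ E] [NormedAddCommGroup F]
  [NormedSpace ℝ F]
  {i : Fin 2} {p : Annulus}

/-- The covering `ℝ² → ℝP¹ × ℝP¹` given by the angular coordinates. -/
def proj (q : ℝ × ℝ) : RP1 × RP1 := ((q.1 : RP1), (q.2 : RP1))

/-- The point of `𝐀` with angular coordinates `q`. -/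
def mk (q : ℝ × ℝ) (hq : q ∈ angleDomain) : Annulus := ⟨proj q, hq⟩

theorem isOpenQuotientMap_proj : IsOpenQuotientMap proj :=
  IsOpenQuotientMap.prodMap QuotientAddGroup.isOpenQuotientMap_mk
    QuotientAddGroup.isOpenQuotientMap_mk

theorem isOpen_annulus : IsOpen {p : RP1 × RP1 | p.1 ≠ p.2} :=
  isOpen_ne_fun continuous_fst continuous_snd

theorem isOpen_angleDomain : IsOpen angleDomain :=
  isOpen_annulus.preimage isOpenQuotientMap_proj.continuous

theorem exists_mk (p : Annulus) : ∃ q, ∃ hq : q ∈ angleDomain, mk q hq = p := by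
  obtain ⟨q, hq⟩ := isOpenQuotientMap_proj.surjective p.1
  have h : q ∈ angleDomain := by
    have := p.2
    rw [← hq] at this
    exact this
  exact ⟨q, h, Subtype.ext hq⟩

@[simp] theorem extendZero_coe {X : Type} [Zero X] (f : Annulus → X) (p : Annulus) :
    extendZero f p.1 = f p := by
  simp [extendZero, p.2]

theorem lift_of_mem {X : Type} [Zero X] (f : Annulus → X) {q : ℝ × ℝ} (hq : q ∈ angleDomain) :
    lift f q = f (mk q hq) :=
  extendZero_coe f (mk q hq)

theorem extendZero_of_ne {X : Type} [Zero X] (f : Annulus → X) {y : RP1 × RP1} (h : y.1 ≠ y.2) :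
    extendZero f y = f ⟨y, h⟩ := extendZero_coe f ⟨y, h⟩

/-- The displacement in `ℝ²` of length `s` along the `i`-th coordinate. -/
def step (i : Fin 2) (s : ℝ) : ℝ × ℝ := (if i = 0 then s else 0, if i = 1 then s else 0)

/-- The point of the torus obtained from `p` by moving the `i`-th angle by `s`. -/
def shift (i : Fin 2) (s : ℝ) (p : Annulus) : RP1 × RP1 :=
  (p.1.1 + (((if i = 0 then s else 0 : ℝ)) : RP1), p.1.2 + (((if i = 1 then s else 0 : ℝ)) : RP1))

theorem shift_mk (i : Fin 2) (s : ℝ) {q : ℝ × ℝ} (hq : q ∈ angleDomain) :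
    shift i s (mk q hq) = proj (q + step i s) := by
  simp [shift, mk, proj, step]

@[simp] theorem shift_zero (i : Fin 2) (p : Annulus) : shift i 0 p = p.1 := by
  simp [shift]

theorem continuous_shift (i : Fin 2) (p : Annulus) : Continuous fun s => shift i s p := by
  unfold shift
  have hc : Continuous ((↑) : ℝ → RP1) := AddCircle.continuous_mk' _
  refine (continuous_const.add (hc.comp ?_)).prodMk (continuous_const.add (hc.comp ?_)) <;>
  · split_ifs <;> fun_prop

theorem eventually_shift (i : Fin 2) (p : Annulus) :
    ∀ᶠ s in 𝓝 (0 : ℝ), (shift i s p).1 ≠ (shift i s p).2 := by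
  refine (continuous_shift i p).continuousAt.eventually (isOpen_annulus.mem_nhds ?_)
  simp

/-! ### Partial derivatives -/

/-- `f` has partial derivative `f'` along the `i`-th angle at `p`. -/
def HasPd (i : Fin 2) (f : Annulus → E) (f' : E) (p : Annulus) : Prop :=
  HasDerivAt (fun s : ℝ => extendZero f (shift i s p)) f' 0

theorem HasPd.pd_eq {f : Annulus → E} {f' : E} (h : HasPd i f f' p) : pd i f p = f' :=
  HasDerivAt.deriv h

/-- Near `0` the curve `s ↦ shift i s p` stays in `𝐀`, so that the extension by zero to the torus is
irrelevant to partial derivatives. -/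
theorem HasPd.of_hasDerivAt {f : Annulus → E} {f' : E} {c : ℝ → E} (hc : HasDerivAt c f' 0)
    (h : ∀ s (hs : (shift i s p).1 ≠ (shift i s p).2), c s = f ⟨shift i s p, hs⟩) :
    HasPd i f f' p := by
  refine hc.congr_of_eventuallyEq ?_
  filter_upwards [eventually_shift i p] with s hs
  rw [h s hs, extendZero_of_ne f hs]

theorem hasPd_const (c : E) : HasPd i (fun _ => c) 0 p :=
  .of_hasDerivAt (hasDerivAt_const 0 c) fun _ _ => rfl

section HasPd

variable {f g : Annulus → E} {f' g' : E} {a b : Annulus → ℝ} {a' b' : ℝ}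

protected theorem HasPd.add (hf : HasPd i f f' p) (hg : HasPd i g g' p) :
    HasPd i (fun p => f p + g p) (f' + g') p :=
  .of_hasDerivAt (HasDerivAt.add hf hg) fun s hs => by simp [extendZero_of_ne _ hs]

protected theorem HasPd.sub (hf : HasPd i f f' p) (hg : HasPd i g g' p) :
    HasPd i (fun p => f p - g p) (f' - g') p :=
  .of_hasDerivAt (HasDerivAt.sub hf hg) fun s hs => by simp [extendZero_of_ne _ hs]

protected theorem HasPd.neg (hf : HasPd i f f' p) : HasPd i (fun p => -f p) (-f') p :=
  .of_hasDerivAt (HasDerivAt.neg hf) fun s hs => by simp [extendZero_of_ne _ hs]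

protected theorem HasPd.mul (ha : HasPd i a a' p) (hb : HasPd i b b' p) :
    HasPd i (fun p => a p * b p) (a' * b p + a p * b') p := by
  have := HasDerivAt.mul ha hb
  simp only [shift_zero, extendZero_coe] at this
  exact .of_hasDerivAt this fun s hs => by simp [extendZero_of_ne _ hs]

protected theorem HasPd.smul (ha : HasPd i a a' p) (hf : HasPd i f f' p) :
    HasPd i (fun p => a p • f p) (a p • f' + a' • f p) p := by
  have := HasDerivAt.smul ha hf
  simp only [shift_zero, extendZero_coe] at this
  exact .of_hasDerivAt this fun s hs => by simp [extendZero_of_ne _ hs]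

theorem HasPd.const_mul (c : ℝ) (ha : HasPd i a a' p) : HasPd i (fun p => c * a p) (c * a') p :=
  .of_hasDerivAt (HasDerivAt.const_mul c ha) fun s hs => by simp [extendZero_of_ne _ hs]

theorem HasPd.const_smul (c : ℝ) (hf : HasPd i f f' p) : HasPd i (fun p => c • f p) (c • f') p :=
  .of_hasDerivAt (HasDerivAt.const_smul c hf) fun s hs => by simp [extendZero_of_ne _ hs]

protected theorem HasPd.div (ha : HasPd i a a' p) (hb : HasPd i b b' p) (h : b p ≠ 0) :
    HasPd i (fun p => a p / b p) ((a' * b p - a p * b') / b p ^ 2) p := by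
  have := HasDerivAt.div ha hb (by simpa using h)
  simp only [shift_zero, extendZero_coe] at this
  exact .of_hasDerivAt this fun s hs => by simp [extendZero_of_ne _ hs]

protected theorem HasPd.exp (ha : HasPd i a a' p) :
    HasPd i (fun p => Real.exp (a p)) (Real.exp (a p) * a') p := by
  have := HasDerivAt.exp ha
  simp only [shift_zero, extendZero_coe] at this
  exact .of_hasDerivAt this fun s hs => by simp [extendZero_of_ne _ hs]

protected theorem HasPd.log (ha : HasPd i a a' p) (h : a p ≠ 0) :
    HasPd i (fun p => Real.log (a p)) (a' / a p) p := by
  have := HasDerivAt.log ha (by simpa using h)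
  simp only [shift_zero, extendZero_coe] at this
  exact .of_hasDerivAt this fun s hs => by simp [extendZero_of_ne _ hs]

theorem HasPd.apply {v : Annulus → W} {v' : W} (hv : HasPd i v v' p) (j : Fin 4) :
    HasPd i (fun p => v p j) (v' j) p :=
  .of_hasDerivAt (hasDerivAt_pi.1 hv j) fun s hs => by simp [extendZero_of_ne _ hs]

protected theorem HasPd.ip {v w : Annulus → W} {v' w' : W} (hv : HasPd i v v' p)
    (hw : HasPd i w w' p) :
    HasPd i (fun p => ip (v p) (w p)) (ip v' (w p) + ip (v p) w') p := by
  have h := fun j => (hv.apply j).mul (hw.apply j)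
  have := (((h 0).neg.sub (h 1)).add (h 2)).add (h 3)
  refine this.congr_deriv ?_
  simp only [ip]
  ring

end HasPd

theorem pd_congr {f g : Annulus → E} (h : f =ᶠ[𝓝 p] g) : pd i f p = pd i g p := by
  refine Filter.EventuallyEq.deriv_eq ?_
  have h' : ∀ᶠ y in 𝓝 p.1, extendZero f y = extendZero g y := by
    rw [← (isOpen_annulus.isOpenEmbedding_subtypeVal).map_nhds_eq p, eventually_map]
    filter_upwards [h] with y hy
    simp [hy]
  have := (continuous_shift i p).continuousAt (x := 0)
  rw [ContinuousAt, shift_zero] at this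
  exact this.eventually h'

/-! ### Smooth families of maps -/

/-- A family `f t` of maps on `𝐀`, read in the coordinates `(t, (a, b))`. -/
def liftFam (f : ℝ → Annulus → E) (z : ℝ × (ℝ × ℝ)) : E := lift (f z.1) z.2

/-- A family `f t`, `t ∈ I`, of maps on `𝐀` which is smooth in `t` and the point jointly. -/
def JSmooth (I : Set ℝ) (f : ℝ → Annulus → E) : Prop :=
  ContDiffOn ℝ ∞ (liftFam f) (I ×ˢ angleDomain)

/-- The time derivative, one-sided at the end points of `I`. -/
def dt (I : Set ℝ) (f : ℝ → Annulus → E) (t : ℝ) (p : Annulus) : E :=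
  derivWithin (fun s => f s p) I t

variable {I : Set ℝ}

theorem IsSmooth.family {f : Annulus → E} (hf : IsSmooth f) : JSmooth I fun _ => f :=
  ContDiffOn.comp hf contDiffOn_snd fun _ hz => hz.2

theorem JSmooth.slice {f : ℝ → Annulus → E} (hf : JSmooth I f) {t : ℝ} (ht : t ∈ I) :
    IsSmooth (f t) :=
  ContDiffOn.comp (g := liftFam f) (f := fun q => (t, q)) hf (by fun_prop) fun _ hq => ⟨ht, hq⟩

theorem JSmooth.comp {f : ℝ → Annulus → E} (hf : JSmooth I f) {φ : E → F} {s : Set E}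
    (hφ : ContDiffOn ℝ ∞ φ s) (h : ∀ t ∈ I, ∀ p, f t p ∈ s) : JSmooth I fun t p => φ (f t p) := by
  refine (ContDiffOn.comp hφ hf fun z hz => ?_).congr fun z hz => ?_
  · rw [liftFam, lift_of_mem _ hz.2]
    exact h _ hz.1 _
  · simp only [liftFam, lift_of_mem _ hz.2, Function.comp]

theorem JSmooth.comp_contDiff {f : ℝ → Annulus → E} (hf : JSmooth I f) {φ : E → F}
    (hφ : ContDiff ℝ ∞ φ) : JSmooth I fun t p => φ (f t p) :=
  hf.comp hφ.contDiffOn fun _ _ _ => mem_univ _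

theorem JSmooth.prodMk {f : ℝ → Annulus → E} {g : ℝ → Annulus → F} (hf : JSmooth I f)
    (hg : JSmooth I g) : JSmooth I fun t p => (f t p, g t p) := by
  refine (ContDiffOn.prodMk hf hg).congr fun z hz => ?_
  simp only [liftFam, lift_of_mem _ hz.2]

theorem jsmooth_time : JSmooth I fun t _ => t := by
  refine (contDiffOn_fst (n := ∞) (𝕜 := ℝ) (s := I ×ˢ angleDomain)).congr fun z hz => ?_
  simp only [liftFam, lift_of_mem _ hz.2]

theorem isSmooth_const (c : E) : IsSmooth fun _ => c :=
  (contDiffOn_const (c := c)).congr fun q hq => by rw [lift_of_mem _ hq]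

section Algebra

variable {f g : ℝ → Annulus → E} {a b : ℝ → Annulus → ℝ}

protected theorem JSmooth.add (hf : JSmooth I f) (hg : JSmooth I g) :
    JSmooth I fun t p => f t p + g t p :=
  (hf.prodMk hg).comp_contDiff (φ := fun z => z.1 + z.2) (by fun_prop)

protected theorem JSmooth.sub (hf : JSmooth I f) (hg : JSmooth I g) :
    JSmooth I fun t p => f t p - g t p :=
  (hf.prodMk hg).comp_contDiff (φ := fun z => z.1 - z.2) (by fun_prop)

protected theorem JSmooth.smul (ha : JSmooth I a) (hf : JSmooth I f) :
    JSmooth I fun t p => a t p • f t p :=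
  (ha.prodMk hf).comp_contDiff (φ := fun z => z.1 • z.2) (by fun_prop)

protected theorem JSmooth.mul (ha : JSmooth I a) (hb : JSmooth I b) :
    JSmooth I fun t p => a t p * b t p :=
  ha.smul hb

theorem JSmooth.const_mul (c : ℝ) (ha : JSmooth I a) : JSmooth I fun t p => c * a t p :=
  (isSmooth_const c).family.mul ha

theorem JSmooth.const_smul (c : ℝ) (hf : JSmooth I f) : JSmooth I fun t p => c • f t p :=
  (isSmooth_const c).family.smul hf

protected theorem JSmooth.exp (ha : JSmooth I a) : JSmooth I fun t p => Real.exp (a t p) :=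
  ha.comp_contDiff Real.contDiff_exp

protected theorem JSmooth.div (ha : JSmooth I a) (hb : JSmooth I b) (h : ∀ t ∈ I, ∀ p, b t p ≠ 0) :
    JSmooth I fun t p => a t p / b t p :=
  (ha.prodMk hb).comp (φ := fun z => z.1 / z.2) (s := {z | z.2 ≠ 0})
    (contDiffOn_fst.div contDiffOn_snd fun _ hz => hz) h

protected theorem JSmooth.log (ha : JSmooth I a) (h : ∀ t ∈ I, ∀ p, a t p ≠ 0) :
    JSmooth I fun t p => Real.log (a t p) :=
  ha.comp (contDiffOn_id.log fun _ hz => hz) h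

theorem JSmooth.apply {v : ℝ → Annulus → W} (hv : JSmooth I v) (j : Fin 4) :
    JSmooth I fun t p => v t p j :=
  hv.comp_contDiff (φ := fun w : W => w j) (by fun_prop)

theorem det4_expand (u v w z : W) : det4 u v w z =
    u 0 * (v 1 * (w 2 * z 3 - w 3 * z 2) - v 2 * (w 1 * z 3 - w 3 * z 1)
      + v 3 * (w 1 * z 2 - w 2 * z 1))
    - u 1 * (v 0 * (w 2 * z 3 - w 3 * z 2) - v 2 * (w 0 * z 3 - w 3 * z 0)
      + v 3 * (w 0 * z 2 - w 2 * z 0))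
    + u 2 * (v 0 * (w 1 * z 3 - w 3 * z 1) - v 1 * (w 0 * z 3 - w 3 * z 0)
      + v 3 * (w 0 * z 1 - w 1 * z 0))
    - u 3 * (v 0 * (w 1 * z 2 - w 2 * z 1) - v 1 * (w 0 * z 2 - w 2 * z 0)
      + v 2 * (w 0 * z 1 - w 1 * z 0)) := by
  simp [det4, Matrix.det_succ_row_zero, Fin.sum_univ_succ, Fin.succAbove]
  ring

theorem contDiff_ip : ContDiff ℝ ∞ fun z : W × W => ip z.1 z.2 := by
  unfold ip
  fun_prop

protected theorem JSmooth.ip {v w : ℝ → Annulus → W} (hv : JSmooth I v) (hw : JSmooth I w) :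
    JSmooth I fun t p => ip (v t p) (w t p) :=
  (hv.prodMk hw).comp_contDiff contDiff_ip

protected theorem JSmooth.det4 {v₀ v₁ v₂ v₃ : ℝ → Annulus → W} (h₀ : JSmooth I v₀)
    (h₁ : JSmooth I v₁) (h₂ : JSmooth I v₂) (h₃ : JSmooth I v₃) :
    JSmooth I fun t p => det4 (v₀ t p) (v₁ t p) (v₂ t p) (v₃ t p) := by
  refine (h₀.prodMk (h₁.prodMk (h₂.prodMk h₃))).comp_contDiff
    (φ := fun z => det4 z.1 z.2.1 z.2.2.1 z.2.2.2) ?_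
  simp only [det4_expand]
  fun_prop

end Algebra

section SmoothAlgebra

variable {f g : Annulus → E} {a b : Annulus → ℝ}

protected theorem IsSmooth.sub (hf : IsSmooth f) (hg : IsSmooth g) : IsSmooth fun p => f p - g p :=
  (hf.family.sub hg.family).slice (mem_univ 0)

protected theorem IsSmooth.smul (ha : IsSmooth a) (hf : IsSmooth f) : IsSmooth fun p => a p • f p :=
  (ha.family.smul hf.family).slice (mem_univ 0)

protected theorem IsSmooth.mul (ha : IsSmooth a) (hb : IsSmooth b) : IsSmooth fun p => a p * b p :=
  ha.smul hb

theorem IsSmooth.const_smul (c : ℝ) (hf : IsSmooth f) : IsSmooth fun p => c • f p :=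
  (isSmooth_const c).smul hf

protected theorem IsSmooth.div (ha : IsSmooth a) (hb : IsSmooth b) (h : ∀ p, b p ≠ 0) :
    IsSmooth fun p => a p / b p :=
  (ha.family.div hb.family fun _ _ => h).slice (mem_univ 0)

protected theorem IsSmooth.log (ha : IsSmooth a) (h : ∀ p, a p ≠ 0) :
    IsSmooth fun p => Real.log (a p) :=
  (ha.family.log fun _ _ => h).slice (mem_univ 0)

protected theorem IsSmooth.ip {v w : Annulus → W} (hv : IsSmooth v) (hw : IsSmooth w) :
    IsSmooth fun p => ip (v p) (w p) :=
  (hv.family.ip hw.family).slice (mem_univ 0)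

theorem IsSmooth.comp_contDiff (hf : IsSmooth f) {φ : E → F} (hφ : ContDiff ℝ ∞ φ) :
    IsSmooth fun p => φ (f p) :=
  (hf.family.comp_contDiff hφ).slice (mem_univ 0)

end SmoothAlgebra

theorem step_eq_smul (i : Fin 2) (s : ℝ) : step i s = s • step i 1 := by
  ext <;> simp [step]

theorem continuous_step (i : Fin 2) : Continuous (step i) := by
  rw [funext (step_eq_smul i)]
  fun_prop

@[simp] theorem step_zero (i : Fin 2) : step i 0 = 0 := by
  rw [step_eq_smul, zero_smul]

/-- In the coordinates `(t, (a, b))`, partial derivatives are values of the derivative of the lifted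
family; `JSmooth.hasDerivWithinAt_mk` is the analogue for time derivatives. -/
theorem JSmooth.hasPd_mk {f : ℝ → Annulus → E} (hf : JSmooth I f) {t : ℝ} (ht : t ∈ I)
    {q : ℝ × ℝ} (hq : q ∈ angleDomain) :
    HasPd i (f t) (fderivWithin ℝ (liftFam f) (I ×ˢ angleDomain) (t, q) (0, step i 1))
      (mk q hq) := by
  have hz : (t, q) ∈ I ×ˢ angleDomain := ⟨ht, hq⟩
  have h1 : HasFDerivWithinAt (liftFam f) (fderivWithin ℝ (liftFam f) (I ×ˢ angleDomain) (t, q))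
      (I ×ˢ angleDomain) (t, q + (0 : ℝ) • step i 1) := by
    rw [zero_smul, add_zero]
    exact (hf.differentiableOn (by simp) (t, q) hz).hasFDerivWithinAt
  have h2 : HasDerivAt (fun s : ℝ => (t, q + s • step i 1)) (0, step i 1) 0 := by
    have := ((hasDerivAt_id (0 : ℝ)).smul_const (step i 1)).const_add q
    rw [one_smul] at this
    exact (hasDerivAt_const 0 t).prodMk this
  have h3 : ∀ᶠ s in 𝓝 (0 : ℝ), q + s • step i 1 ∈ angleDomain := by
    have hc : Continuous fun s : ℝ => q + s • step i 1 := by fun_prop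
    refine hc.continuousAt.eventually (isOpen_angleDomain.mem_nhds ?_)
    simpa using hq
  have h4 := h1.comp_hasDerivWithinAt (0 : ℝ) (s := {s | q + s • step i 1 ∈ angleDomain})
    h2.hasDerivWithinAt fun s hs => mk_mem_prod ht hs
  refine (h4.hasDerivAt h3).congr_of_eventuallyEq (Eventually.of_forall fun s => ?_)
  simp only [shift_mk, Function.comp, step_eq_smul i s]
  rfl

theorem JSmooth.hasDerivWithinAt_mk {f : ℝ → Annulus → E}
    (hf : JSmooth I f) {t : ℝ} (ht : t ∈ I) {q : ℝ × ℝ} (hq : q ∈ angleDomain) :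
    HasDerivWithinAt (fun s => f s (mk q hq))
      (fderivWithin ℝ (liftFam f) (I ×ˢ angleDomain) (t, q) (1, 0)) I t := by
  have hz : (t, q) ∈ I ×ˢ angleDomain := ⟨ht, hq⟩
  have h1 := (hf.differentiableOn (by simp) (t, q) hz).hasFDerivWithinAt
  have h2 : HasDerivWithinAt (fun s : ℝ => (s, q)) ((1 : ℝ), (0 : ℝ × ℝ)) I t :=
    ((hasDerivAt_id t).prodMk (hasDerivAt_const t q)).hasDerivWithinAt
  have h3 := h1.comp_hasDerivWithinAt t (s := I) h2 fun s hs => mk_mem_prod hs hq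
  refine h3.congr_of_mem (fun s _ => ?_) ht
  simp [liftFam, lift_of_mem _ hq]

theorem uniqueDiffOn_prod (hI : UniqueDiffOn ℝ I) : UniqueDiffOn ℝ (I ×ˢ angleDomain) :=
  hI.prod isOpen_angleDomain.uniqueDiffOn

theorem JSmooth.fderivWithin_clm (hI : UniqueDiffOn ℝ I) {f : ℝ → Annulus → E}
    (hf : JSmooth I f) (v : ℝ × (ℝ × ℝ)) :
    ContDiffOn ℝ ∞ (fun z => fderivWithin ℝ (liftFam f) (I ×ˢ angleDomain) z v)
      (I ×ˢ angleDomain) :=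
  (ContDiffOn.fderivWithin hf (uniqueDiffOn_prod hI) (by simp)).clm_apply contDiffOn_const

theorem JSmooth.liftFam_pd {f : ℝ → Annulus → E} (hf : JSmooth I f) {z : ℝ × (ℝ × ℝ)}
    (hz : z ∈ I ×ˢ angleDomain) : liftFam (fun t => pd i (f t)) z =
      fderivWithin ℝ (liftFam f) (I ×ˢ angleDomain) z (0, step i 1) := by
  rw [liftFam, lift_of_mem _ hz.2]
  exact (hf.hasPd_mk hz.1 hz.2).pd_eq

theorem JSmooth.liftFam_dt (hI : UniqueDiffOn ℝ I) {f : ℝ → Annulus → E} (hf : JSmooth I f)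
    {z : ℝ × (ℝ × ℝ)} (hz : z ∈ I ×ˢ angleDomain) : liftFam (dt I f) z =
      fderivWithin ℝ (liftFam f) (I ×ˢ angleDomain) z (1, 0) := by
  rw [liftFam, lift_of_mem _ hz.2]
  exact (hf.hasDerivWithinAt_mk hz.1 hz.2).derivWithin (hI _ hz.1)

protected theorem JSmooth.pd (hI : UniqueDiffOn ℝ I) {f : ℝ → Annulus → E}
    (hf : JSmooth I f) (i : Fin 2) : JSmooth I fun t => pd i (f t) :=
  (hf.fderivWithin_clm hI _).congr fun _ hz => hf.liftFam_pd hz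

protected theorem JSmooth.dt (hI : UniqueDiffOn ℝ I) {f : ℝ → Annulus → E} (hf : JSmooth I f) :
    JSmooth I (dt I f) :=
  (hf.fderivWithin_clm hI _).congr fun _ hz => hf.liftFam_dt hI hz

protected theorem IsSmooth.pd {f : Annulus → E} (hf : IsSmooth f) (i : Fin 2) : IsSmooth (pd i f) :=
  (hf.family.pd uniqueDiffOn_univ i).slice (mem_univ 0)

theorem IsSmooth.hasPd {f : Annulus → E} (hf : IsSmooth f) : HasPd i f (pd i f p) p := by
  obtain ⟨q, hq, rfl⟩ := exists_mk p
  have := hf.family.hasPd_mk (i := i) (mem_univ (0 : ℝ)) hq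
  rwa [← this.pd_eq] at this

theorem JSmooth.hasDerivWithinAt {f : ℝ → Annulus → E}
    (hf : JSmooth I f) {t : ℝ} (ht : t ∈ I) (p : Annulus) :
    HasDerivWithinAt (fun s => f s p) (dt I f t p) I t := by
  obtain ⟨q, hq, rfl⟩ := exists_mk p
  exact (hf.hasDerivWithinAt_mk ht hq).differentiableWithinAt.hasDerivWithinAt

theorem JSmooth.hasDerivAt {f : ℝ → Annulus → E}
    (hf : JSmooth I f) {t : ℝ} (ht : I ∈ 𝓝 t) (p : Annulus) :
    HasDerivAt (fun s => f s p) (dt I f t p) t :=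
  (hf.hasDerivWithinAt (mem_of_mem_nhds ht) p).hasDerivAt ht

theorem IsSmooth.pd_const_mul {u : Annulus → ℝ} (hu : IsSmooth u) (t : ℝ) (i : Fin 2) :
    pd i (fun p => t * u p) = fun p => t * pd i u p :=
  funext fun _ => (hu.hasPd.const_mul t).pd_eq

theorem fderiv_fderiv_comm {V : Type*} [NormedAddCommGroup V] [NormedSpace ℝ V] {f : V → E} {z : V}
    (hf : ContDiffAt ℝ ∞ f z) (v w : V) :
    fderiv ℝ (fun y => fderiv ℝ f y v) z w = fderiv ℝ (fun y => fderiv ℝ f y w) z v := by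
  have hd : DifferentiableAt ℝ (fderiv ℝ f) z :=
    (hf.fderiv_right (m := 1) (by norm_cast)).differentiableAt (by simp)
  have h : ∀ v w, fderiv ℝ (fun y => fderiv ℝ f y v) z w = fderiv ℝ (fderiv ℝ f) z w v := by
    intro v w
    rw [fderiv_clm_apply hd (differentiableAt_const v)]
    simp
  rw [h, h]
  exact (hf.isSymmSndFDerivAt (by simpa using WithTop.coe_le_coe.2 (le_top : (2 : ℕ∞) ≤ ⊤))) w v

theorem JSmooth.liftFam_pd_eventually {f : ℝ → Annulus → E} (hf : JSmooth I f)
    {z : ℝ × (ℝ × ℝ)} (hz : I ×ˢ angleDomain ∈ 𝓝 z) :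
    liftFam (fun t => pd i (f t)) =ᶠ[𝓝 z]
      fun y => fderiv ℝ (liftFam f) y (0, step i 1) := by
  filter_upwards [hz, eventually_mem_nhds_iff.2 hz] with y hy hy'
  rw [hf.liftFam_pd hy, fderivWithin_of_mem_nhds hy']

theorem JSmooth.liftFam_dt_eventually (hI : UniqueDiffOn ℝ I) {f : ℝ → Annulus → E}
    (hf : JSmooth I f) {z : ℝ × (ℝ × ℝ)} (hz : I ×ˢ angleDomain ∈ 𝓝 z) :
    liftFam (dt I f) =ᶠ[𝓝 z] fun y => fderiv ℝ (liftFam f) y (1, 0) := by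
  filter_upwards [hz, eventually_mem_nhds_iff.2 hz] with y hy hy'
  rw [hf.liftFam_dt hI hy, fderivWithin_of_mem_nhds hy']

/-- Time derivatives and partial derivatives commute. -/
theorem JSmooth.dt_pd (hI : UniqueDiffOn ℝ I) {f : ℝ → Annulus → E} (hf : JSmooth I f)
    {t : ℝ} (ht : I ∈ 𝓝 t) (i : Fin 2) (p : Annulus) :
    dt I (fun t => pd i (f t)) t p =
      pd i (dt I f t) p := by
  obtain ⟨q, hq, rfl⟩ := exists_mk p
  have hz : I ×ˢ angleDomain ∈ 𝓝 (t, q) := prod_mem_nhds ht (isOpen_angleDomain.mem_nhds hq)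
  have h1 := ((hf.pd hI i).liftFam_dt_eventually hI hz).eq_of_nhds
  have h2 := ((hf.dt hI).liftFam_pd_eventually (i := i) hz).eq_of_nhds
  rw [(hf.liftFam_pd_eventually hz).fderiv_eq] at h1
  rw [(hf.liftFam_dt_eventually hI hz).fderiv_eq] at h2
  rw [fderiv_fderiv_comm (ContDiffOn.contDiffAt hf hz), ← h2] at h1
  simpa only [liftFam, lift_of_mem _ hq] using h1

theorem IsSmooth.pd_comm {f : Annulus → E} (hf : IsSmooth f) (i j : Fin 2) (p : Annulus) :
    pd i (pd j f) p =
      pd j (pd i f) p := by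
  obtain ⟨q, hq, rfl⟩ := exists_mk p
  have hF : JSmooth univ fun _ : ℝ => f := hf.family
  have hz : univ ×ˢ angleDomain ∈ 𝓝 ((0 : ℝ), q) :=
    prod_mem_nhds univ_mem (isOpen_angleDomain.mem_nhds hq)
  have h1 := ((hF.pd uniqueDiffOn_univ j).liftFam_pd_eventually (i := i) hz).eq_of_nhds
  have h2 := ((hF.pd uniqueDiffOn_univ i).liftFam_pd_eventually (i := j) hz).eq_of_nhds
  rw [(hF.liftFam_pd_eventually hz).fderiv_eq] at h1 h2
  rw [fderiv_fderiv_comm (ContDiffOn.contDiffAt hF hz), ← h2] at h1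
  simpa only [liftFam, lift_of_mem _ hq] using h1

end Calculus

/-! ### Integration over the annulus -/

section Integration

variable {E : Type} [NormedAddCommGroup E] [NormedSpace ℝ E] {I : Set ℝ}

/-- Smoothness is defined in coordinates; continuity on `𝐀` itself follows because the covering by
coordinates is an open quotient map. -/
theorem JSmooth.continuousOn {f : ℝ → Annulus → E} (hf : JSmooth I f) :
    ContinuousOn (fun z : ℝ × Annulus => f z.1 z.2) (I ×ˢ univ) := by
  rintro ⟨t, p⟩ ⟨ht, -⟩
  obtain ⟨q, hq, rfl⟩ := exists_mk p
  have h1 : Tendsto (liftFam f) (𝓝[I] t ×ˢ 𝓝 q) (𝓝 (liftFam f (t, q))) := by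
    have := (ContDiffOn.continuousOn hf) (t, q) (mk_mem_prod ht hq)
    rwa [ContinuousWithinAt, nhdsWithin_prod_eq, isOpen_angleDomain.nhdsWithin_eq hq] at this
  have h2 : Tendsto (fun y : ℝ × (RP1 × RP1) => extendZero (f y.1) y.2) (𝓝[I] t ×ˢ 𝓝 (proj q))
      (𝓝 (liftFam f (t, q))) := by
    rw [← isOpenQuotientMap_proj.isOpenMap.map_nhds_eq
      isOpenQuotientMap_proj.continuous.continuousAt, ← Filter.map_id (f := 𝓝[I] t),
      Filter.prod_map_map_eq, tendsto_map'_iff]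
    exact h1
  have h3 : Tendsto (fun z : ℝ × Annulus => (z.1, z.2.1)) (𝓝[I] t ×ˢ 𝓝 (mk q hq))
      (𝓝[I] t ×ˢ 𝓝 (proj q)) :=
    tendsto_id.prodMap (continuous_subtype_val.tendsto (mk q hq))
  have h4 := h2.comp h3
  rw [liftFam, lift_of_mem _ hq] at h4
  rw [ContinuousWithinAt, nhdsWithin_prod_eq, nhdsWithin_univ]
  refine h4.congr fun z => ?_
  simp

theorem IsSmooth.continuous {f : Annulus → E} (hf : IsSmooth f) : Continuous f := by
  have h : JSmooth univ fun _ : ℝ => f := hf.family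
  have h' := h.continuousOn
  rw [univ_prod_univ, continuousOn_univ] at h'
  exact h'.comp (f := fun p => ((0 : ℝ), p)) (by fun_prop)

instance : IsFiniteMeasure angularMeasure := IsFiniteMeasure_comap _

instance : angularMeasure.IsOpenPosMeasure :=
  Measure.IsOpenPosMeasure.comap _ isOpen_annulus.isOpenEmbedding_subtypeVal

theorem integral_eq_extendZero (f : Annulus → ℝ) :
    ∫ p, f p ∂angularMeasure = ∫ y, extendZero f y := by
  have h1 : ∫ p, f p ∂angularMeasure = ∫ p : Annulus, extendZero f p.1 ∂angularMeasure := by simp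
  have h2 := integral_subtype_comap (μ := (volume : Measure (RP1 × RP1)))
    isOpen_annulus.measurableSet (extendZero f)
  rw [h1, angularMeasure]
  refine h2.trans (setIntegral_eq_integral_of_forall_compl_eq_zero fun y hy => ?_)
  exact dif_neg hy

/-- A compactly supported map on `𝐀` vanishes near the diagonal. -/
theorem extendZero_eventually_zero {E : Type} [Zero E] {f : Annulus → E}
    (hc : HasCompactSupport f) {y : RP1 × RP1} (hy : ¬ y.1 ≠ y.2) :
    extendZero f =ᶠ[𝓝 y] fun _ => 0 := by
  have hK : IsClosed (((↑) : Annulus → RP1 × RP1) '' tsupport f) :=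
    (hc.isCompact.image continuous_subtype_val).isClosed
  have hy' : y ∈ (((↑) : Annulus → RP1 × RP1) '' tsupport f)ᶜ := by
    rintro ⟨p, -, rfl⟩
    exact hy p.2
  filter_upwards [hK.isOpen_compl.mem_nhds hy'] with x hx
  by_cases h : x.1 ≠ x.2
  · rw [extendZero_of_ne _ h]
    by_contra h0
    exact hx ⟨⟨x, h⟩, subset_tsupport _ h0, rfl⟩
  · exact dif_neg h

theorem IsSmooth.contDiff_lift {f : Annulus → E} (hf : IsSmooth f) (hc : HasCompactSupport f) :
    ContDiff ℝ ∞ (lift f) := by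
  rw [contDiff_iff_contDiffAt]
  intro q
  by_cases hq : q ∈ angleDomain
  · exact ContDiffOn.contDiffAt hf (isOpen_angleDomain.mem_nhds hq)
  · have := isOpenQuotientMap_proj.continuous.continuousAt.eventually
      (extendZero_eventually_zero hc (y := proj q) hq)
    exact contDiffAt_const.congr_of_eventuallyEq this

theorem IsSmooth.continuous_extendZero {f : Annulus → E} (hf : IsSmooth f)
    (hc : HasCompactSupport f) : Continuous (extendZero f) := by
  rw [isOpenQuotientMap_proj.isQuotientMap.continuous_iff]
  exact (hf.contDiff_lift hc).continuous

theorem pd_eq_zero_of_forall_notMem {f : Annulus → E} {K : Set Annulus} (hK : IsClosed K)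
    (hf : ∀ p ∉ K, f p = 0) {p : Annulus} (hp : p ∉ K) (i : Fin 2) : pd i f p = 0 := by
  have : f =ᶠ[𝓝 p] fun _ => 0 := by
    filter_upwards [hK.isOpen_compl.mem_nhds hp] with x hx using hf x hx
  rw [pd_congr this, (hasPd_const (0 : E)).pd_eq]

theorem hasCompactSupport_pd {f : Annulus → E} (hc : HasCompactSupport f) (i : Fin 2) :
    HasCompactSupport (pd i f) :=
  .intro hc.isCompact fun _ hp => pd_eq_zero_of_forall_notMem (isClosed_tsupport f)
    (fun _ h => image_eq_zero_of_notMem_tsupport h) hp i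

theorem IsSmooth.hasDerivAt_lift {f : Annulus → E} (hf : IsSmooth f) (hc : HasCompactSupport f)
    (i : Fin 2) (q : ℝ × ℝ) (s : ℝ) :
    HasDerivAt (fun s => lift f (q + step i s)) (lift (pd i f) (q + step i s)) s := by
  have key : ∀ q, HasDerivAt (fun s => lift f (q + step i s)) (lift (pd i f) q) 0 := by
    intro q
    by_cases hq : q ∈ angleDomain
    · have := hf.hasPd (i := i) (p := mk q hq)
      rw [lift_of_mem _ hq]
      refine HasDerivAt.congr_of_eventuallyEq this (Eventually.of_forall fun s => ?_)
      simp only [shift_mk]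
      rfl
    · have h0 : lift (pd i f) q = 0 := dif_neg hq
      have hs : Continuous fun s => proj (q + step i s) :=
        isOpenQuotientMap_proj.continuous.comp
          (continuous_const.add (continuous_step i))
      have h := extendZero_eventually_zero hc (y := proj (q + step i 0))
        (by rwa [step_zero, add_zero])
      rw [h0]
      exact (hasDerivAt_const (0 : ℝ) (0 : E)).congr_of_eventuallyEq
        (hs.continuousAt.eventually h)
  have h := HasDerivAt.comp_sub_const (x := s) s (f := fun r => lift f (q + step i s + step i r))
    (by simpa using key (q + step i s))
  refine h.congr_of_eventuallyEq (Eventually.of_forall fun r => ?_)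
  simp only [add_assoc]
  congr 2
  ext <;> simp only [step, Prod.mk_add_mk] <;> split_ifs <;> ring

/-- A partial derivative integrates to zero over the circle in its own direction, by
`π`-periodicity. -/
theorem IsSmooth.integral_circle_eq_zero {f : Annulus → ℝ} (hf : IsSmooth f)
    (hc : HasCompactSupport f) (i : Fin 2) (q : ℝ × ℝ) :
    ∫ s in (0 : ℝ)..0 + Real.pi, lift (pd i f) (q + step i s) = 0 := by
  have hcont : Continuous fun s => lift (pd i f) (q + step i s) := by
    exact ((hf.pd i).contDiff_lift (hasCompactSupport_pd hc i)).continuous.comp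
      (continuous_const.add (continuous_step i))
  rw [intervalIntegral.integral_eq_sub_of_hasDerivAt
    (fun s _ => hf.hasDerivAt_lift hc i q s) (hcont.intervalIntegrable _ _)]
  have : proj (q + step i (0 + Real.pi)) = proj (q + step i 0) := by
    fin_cases i <;> simp [proj, step]
  change extendZero f (proj (q + step i (0 + Real.pi))) - extendZero f (proj (q + step i 0)) = 0
  rw [this, sub_self]

/-- The integral over `𝐀` of a divergence with compact support vanishes. -/
theorem IsSmooth.integral_pd_eq_zero {f : Annulus → ℝ} (hf : IsSmooth f)
    (hc : HasCompactSupport f) (i : Fin 2) : ∫ p, pd i f p ∂angularMeasure = 0 := by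
  have hcont := (hf.pd i).continuous_extendZero (hasCompactSupport_pd hc i)
  have hint : Integrable (extendZero (pd i f)) (volume : Measure (RP1 × RP1)) :=
    hcont.integrable_of_hasCompactSupport (HasCompactSupport.of_compactSpace _)
  rw [integral_eq_extendZero]
  rw [Measure.volume_eq_prod] at hint ⊢
  fin_cases i
  · rw [integral_prod_symm _ hint]
    refine integral_eq_zero_of_ae (Eventually.of_forall fun b => ?_)
    obtain ⟨b, rfl⟩ := QuotientAddGroup.mk_surjective b
    have h := hf.integral_circle_eq_zero hc 0 (0, b)
    have h' := AddCircle.intervalIntegral_preimage Real.pi 0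
      fun a => extendZero (pd 0 f) (a, (b : RP1))
    simp only [Pi.zero_apply]
    refine (h'.symm.trans ?_).trans h
    simp [lift, step]
  · rw [integral_prod _ hint]
    refine integral_eq_zero_of_ae (Eventually.of_forall fun a => ?_)
    obtain ⟨a, rfl⟩ := QuotientAddGroup.mk_surjective a
    have h := hf.integral_circle_eq_zero hc 1 (a, 0)
    have h' := AddCircle.intervalIntegral_preimage Real.pi 0
      fun b => extendZero (pd 1 f) ((a : RP1), b)
    simp only [Pi.zero_apply]
    refine (h'.symm.trans ?_).trans h
    simp [lift, step]

theorem IsSmooth.integrable {f : Annulus → ℝ} (hf : IsSmooth f) {K : Set Annulus}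
    (hK : IsCompact K) (h0 : ∀ p ∉ K, f p = 0) : Integrable f angularMeasure :=
  hf.continuous.integrable_of_hasCompactSupport (.intro hK h0)

/-! ### Differentiation under the integral -/

section Parametric

variable {f : ℝ → Annulus → ℝ} {K : Set Annulus}

theorem JSmooth.exists_bound (hf : JSmooth I f) (hK : IsCompact K)
    (h0 : ∀ t ∈ I, ∀ p ∉ K, f t p = 0) {J : Set ℝ} (hJ : IsCompact J) (hJI : J ⊆ I) :
    ∃ C, ∀ t ∈ J, ∀ p, ‖f t p‖ ≤ C := by
  obtain ⟨C, hC⟩ := (hJ.prod hK).exists_bound_of_continuousOn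
    (hf.continuousOn.mono (prod_mono hJI (subset_univ K)))
  refine ⟨max C 0, fun t ht p => ?_⟩
  by_cases hp : p ∈ K
  · exact (hC (t, p) ⟨ht, hp⟩).trans (le_max_left _ _)
  · rw [h0 t (hJI ht) p hp, norm_zero]
    exact le_max_right _ _

theorem JSmooth.continuousOn_integral (hI : IsClosed I) (hf : JSmooth I f) (hK : IsCompact K)
    (h0 : ∀ t ∈ I, ∀ p ∉ K, f t p = 0) :
    ContinuousOn (fun t => ∫ p, f t p ∂angularMeasure) I := by
  intro t ht
  obtain ⟨C, hC⟩ := hf.exists_bound hK h0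
    ((isCompact_closedBall t 1).inter_left hI) inter_subset_left
  refine continuousWithinAt_of_dominated (bound := fun _ => C) ?_ ?_ (integrable_const C) ?_
  · filter_upwards [self_mem_nhdsWithin] with s hs
    exact (hf.slice hs).continuous.aestronglyMeasurable
  · filter_upwards [self_mem_nhdsWithin,
      mem_nhdsWithin_of_mem_nhds (Metric.closedBall_mem_nhds t one_pos)] with s hs hs'
    exact Eventually.of_forall fun p => hC s ⟨hs, hs'⟩ p
  · exact Eventually.of_forall fun p => (hf.hasDerivWithinAt ht p).continuousWithinAt

theorem dt_eq_zero_of_const {f : ℝ → Annulus → E} {t : ℝ} {p : Annulus} (c : E) (ht : t ∈ I)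
    (h : ∀ s ∈ I, f s p = c) : dt I f t p = 0 := by
  rw [dt, derivWithin_congr (f := fun _ => c) (fun s hs => h s hs) (h t ht)]
  simp

theorem JSmooth.hasDerivAt_integral (hI : UniqueDiffOn ℝ I) (hf : JSmooth I f) (hK : IsCompact K)
    (h0 : ∀ t ∈ I, ∀ p ∉ K, f t p = 0) {t : ℝ} (ht : I ∈ 𝓝 t) :
    HasDerivAt (fun t => ∫ p, f t p ∂angularMeasure) (∫ p, dt I f t p ∂angularMeasure) t := by
  obtain ⟨ε, hε, hεI⟩ := Metric.nhds_basis_closedBall.mem_iff.1 ht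
  obtain ⟨C, hC⟩ := (hf.dt hI).exists_bound hK
    (fun s hs p hp => dt_eq_zero_of_const 0 hs fun r hr => h0 r hr p hp)
    (isCompact_closedBall t ε) hεI
  have htI := mem_of_mem_nhds ht
  refine (hasDerivAt_integral_of_dominated_loc_of_deriv_le (bound := fun _ => C)
    (Metric.ball_mem_nhds t hε) ?_ ((hf.slice htI).integrable hK (h0 t htI))
    ((hf.dt hI).slice htI).continuous.aestronglyMeasurable ?_ (integrable_const C) ?_).2
  · filter_upwards [ht] with s hs
    exact (hf.slice hs).continuous.aestronglyMeasurable
  · exact Eventually.of_forall fun p s hs => hC s (Metric.ball_subset_closedBall hs) p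
  · refine Eventually.of_forall fun p s hs => hf.hasDerivAt ?_ p
    exact mem_of_superset (Metric.isOpen_ball.mem_nhds hs)
      (Metric.ball_subset_closedBall.trans hεI)

/-- The fundamental theorem of calculus in the time variable, under the integral over `𝐀`. -/
theorem JSmooth.integral_sub_eq (hf : JSmooth (Icc 0 1) f) (hK : IsCompact K)
    (h0 : ∀ t ∈ Icc (0 : ℝ) 1, ∀ p ∉ K, f t p = f 0 p) :
    ∫ p, (f 1 p - f 0 p) ∂angularMeasure =
      ∫ t in (0 : ℝ)..1, ∫ p, dt (Icc 0 1) f t p ∂angularMeasure := by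
  have hI : UniqueDiffOn ℝ (Icc (0 : ℝ) 1) := uniqueDiffOn_Icc_zero_one
  have hg : JSmooth (Icc 0 1) fun t p => f t p - f 0 p := hf.sub (hf.slice (by simp)).family
  have hg0 : ∀ t ∈ Icc (0 : ℝ) 1, ∀ p ∉ K, f t p - f 0 p = 0 := fun t ht p hp => by
    rw [h0 t ht p hp, sub_self]
  have hd : dt (Icc 0 1) (fun t p => f t p - f 0 p) = dt (Icc 0 1) f := by
    funext t p
    simp [dt, derivWithin_sub_const]
  have hcont := (hg.dt hI).continuousOn_integral isClosed_Icc hK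
    fun s hs p hp => dt_eq_zero_of_const 0 hs fun r hr => hg0 r hr p hp
  rw [hd] at hcont
  rw [intervalIntegral.integral_eq_sub_of_hasDerivAt_of_le zero_le_one
    (hg.continuousOn_integral isClosed_Icc hK hg0) (fun t ht => ?_)
    (ContinuousOn.intervalIntegrable (by rwa [uIcc_of_le zero_le_one]))]
  · simp
  · rw [← hd]
    exact hg.hasDerivAt_integral hI hK hg0 (Icc_mem_nhds ht.1 ht.2)

end Parametric

end Integration

/-! ### A primitive of the volume form of the anti-de Sitter space -/

/-- The form `x₂ dx₃ - x₃ dx₂` on `W`. -/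
def angFormA (x u : W) : ℝ := x 2 * u 3 - x 3 * u 2

/-- The closed form `(x₀ dx₁ - x₁ dx₀) / (x₀² + x₁²)` on `{x₀² + x₁² ≠ 0} ⊆ W`. -/
def angFormB (x u : W) : ℝ := (x 0 * u 1 - x 1 * u 0) / (x 0 ^ 2 + x 1 ^ 2)

/-- The `2`-form `ν = (1/2) (x₂ dx₃ - x₃ dx₂) ∧ (x₀ dx₁ - x₁ dx₀) / (x₀² + x₁²)`. Its restriction to
the anti-de Sitter space is a primitive of the volume form. -/
def volPrimitive (x u v : W) : ℝ :=
  (1 / 2) * (angFormA x u * angFormB x v - angFormA x v * angFormB x u)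

/-- The derivative of `angFormB x u` when `x`, `u` have derivatives `x'`, `u'`. -/
def angFormBDeriv (x u x' u' : W) : ℝ :=
  ((x' 0 * u 1 + x 0 * u' 1 - (x' 1 * u 0 + x 1 * u' 0)) * (x 0 ^ 2 + x 1 ^ 2) -
    (x 0 * u 1 - x 1 * u 0) * (2 * x 0 * x' 0 + 2 * x 1 * x' 1)) / (x 0 ^ 2 + x 1 ^ 2) ^ 2

/-- The derivative of `volPrimitive x u v` when `x`, `u`, `v` have derivatives `x'`, `u'`, `v'`. -/
def volPrimitiveDeriv (x u v x' u' v' : W) : ℝ :=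
  (1 / 2) * ((angFormA x' u + angFormA x u') * angFormB x v +
      angFormA x u * angFormBDeriv x v x' v' -
    ((angFormA x' v + angFormA x v') * angFormB x u + angFormA x v * angFormBDeriv x u x' u'))

theorem hasDerivAt_volPrimitive {x u v : ℝ → W} {x' u' v' : W} {s : ℝ} (hx : HasDerivAt x x' s)
    (hu : HasDerivAt u u' s) (hv : HasDerivAt v v' s) (h : x s 0 ^ 2 + x s 1 ^ 2 ≠ 0) :
    HasDerivAt (fun s => volPrimitive (x s) (u s) (v s))
      (volPrimitiveDeriv (x s) (u s) (v s) x' u' v') s := by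
  have hx := hasDerivAt_pi.1 hx
  have hA : ∀ {w : ℝ → W} {w' : W}, HasDerivAt w w' s → HasDerivAt
      (fun s => angFormA (x s) (w s)) (angFormA x' (w s) + angFormA (x s) w') s := by
    intro w w' hw
    have hw := hasDerivAt_pi.1 hw
    refine (((hx 2).mul (hw 3)).sub ((hx 3).mul (hw 2))).congr_deriv ?_
    simp only [angFormA]
    ring
  have hB : ∀ {w : ℝ → W} {w' : W}, HasDerivAt w w' s → HasDerivAt
      (fun s => angFormB (x s) (w s)) (angFormBDeriv (x s) (w s) x' w') s := by
    intro w w' hw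
    have hw := hasDerivAt_pi.1 hw
    refine ((((hx 0).mul (hw 1)).sub ((hx 1).mul (hw 0))).div
      (((hx 0).pow 2).add ((hx 1).pow 2)) h).congr_deriv ?_
    simp [angFormBDeriv]
  exact ((((hA hu).mul (hB hv)).sub ((hA hv).mul (hB hu))).const_mul (1 / 2)).congr_deriv rfl

theorem HasPd.volPrimitive {i : Fin 2} {p : Annulus} {x u v : Annulus → W} {x' u' v' : W}
    (hx : HasPd i x x' p) (hu : HasPd i u u' p) (hv : HasPd i v v' p)
    (h : x p 0 ^ 2 + x p 1 ^ 2 ≠ 0) :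
    HasPd i (fun p => volPrimitive (x p) (u p) (v p))
      (volPrimitiveDeriv (x p) (u p) (v p) x' u' v') p := by
  have := hasDerivAt_volPrimitive hx hu hv (by simpa using h)
  simp only [shift_zero, extendZero_coe] at this
  exact .of_hasDerivAt this fun s hs => by simp [extendZero_of_ne _ hs]

/-- The forms `angFormB` and `volPrimitive` are regular along the anti-de Sitter space. -/
theorem one_le_of_ip_eq {x : W} (h : ip x x = -1) : 1 ≤ x 0 ^ 2 + x 1 ^ 2 := by
  unfold ip at h
  nlinarith [sq_nonneg (x 2), sq_nonneg (x 3)]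

/-- On vectors tangent to the anti-de Sitter space, `dν` is the volume form; here `dν(a, b, c)` is
written as the cyclic sum of the derivatives of `ν` along commuting fields with first jets
`ab`, `ac`, `bc`. -/
theorem cyclic_volPrimitiveDeriv {x a b c ab ac bc : W} (hx : ip x x = -1) (ha : ip x a = 0)
    (hb : ip x b = 0) (hc : ip x c = 0) :
    volPrimitiveDeriv x a b c ac bc + volPrimitiveDeriv x b c a ab ac +
      volPrimitiveDeriv x c a b bc ab = det4 x a b c := by
  have hρ : x 0 ^ 2 + x 1 ^ 2 ≠ 0 := by linarith [one_le_of_ip_eq hx]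
  -- `angFormB` is closed, and the exterior derivative of `angFormA` is `2 dx₂ ∧ dx₃`.
  have hcurl : ∀ u v uv, angFormBDeriv x u v uv = angFormBDeriv x v u uv := by
    intro u v uv
    unfold angFormBDeriv
    field_simp
    ring
  have hcurl' : ∀ u v uv, angFormA v u + angFormA x uv - (angFormA u v + angFormA x uv) =
      2 * (v 2 * u 3 - v 3 * u 2) := by
    intro u v uv
    unfold angFormA
    ring
  have h1 : volPrimitiveDeriv x a b c ac bc + volPrimitiveDeriv x b c a ab ac +
      volPrimitiveDeriv x c a b bc ab = (c 2 * a 3 - c 3 * a 2) * angFormB x b +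
        (a 2 * b 3 - a 3 * b 2) * angFormB x c + (b 2 * c 3 - b 3 * c 2) * angFormB x a := by
    unfold volPrimitiveDeriv
    rw [hcurl b a ab, hcurl c a ac, hcurl c b bc]
    linear_combination (1 / 2) * angFormB x b * hcurl' a c ac +
      (1 / 2) * angFormB x c * hcurl' b a ab + (1 / 2) * angFormB x a * hcurl' c b bc
  -- The claim becomes `dx₂ ∧ dx₃ ∧ angFormB = vol`, an identity modulo the equations of the
  -- tangent space; the coefficients below express it in terms of those equations.
  rw [h1, det4_expand]
  unfold angFormB
  unfold ip at *
  field_simp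
  linear_combination
    hx * ((b 2 * c 3 - b 3 * c 2) * (x 0 * a 1 - x 1 * a 0) +
      (c 2 * a 3 - c 3 * a 2) * (x 0 * b 1 - x 1 * b 0) +
      (a 2 * b 3 - a 3 * b 2) * (x 0 * c 1 - x 1 * c 0)) +
    ha * ((x 0 * b 1 - x 1 * b 0) * (x 2 * c 3 - x 3 * c 2) -
      (x 0 * c 1 - x 1 * c 0) * (x 2 * b 3 - x 3 * b 2)) +
    hb * ((x 0 * c 1 - x 1 * c 0) * (x 2 * a 3 - x 3 * a 2) -
      (x 0 * a 1 - x 1 * a 0) * (x 2 * c 3 - x 3 * c 2)) +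
    hc * ((x 0 * a 1 - x 1 * a 0) * (x 2 * b 3 - x 3 * b 2) -
      (x 0 * b 1 - x 1 * b 0) * (x 2 * a 3 - x 3 * a 2))

/-! ### Stokes' theorem on the cobordism -/

section Stokes

variable {I : Set ℝ}

theorem ip_self_deriv {X : ℝ → W} {X' : W} {s c : ℝ} (h : HasDerivAt X X' s)
    (hc : ∀ᶠ r in 𝓝 s, ip (X r) (X r) = c) : ip (X s) X' = 0 := by
  have hX := hasDerivAt_pi.1 h
  have h1 := (((((hX 0).mul (hX 0)).neg.sub ((hX 1).mul (hX 1))).add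
    ((hX 2).mul (hX 2))).add ((hX 3).mul (hX 3))).unique
    ((hasDerivAt_const s c).congr_of_eventuallyEq hc)
  unfold ip
  linarith

theorem jsmooth_volPrimitive {x u v : ℝ → Annulus → W} (hx : JSmooth I x) (hu : JSmooth I u)
    (hv : JSmooth I v) (h : ∀ t ∈ I, ∀ p, ip (x t p) (x t p) = -1) :
    JSmooth I fun t p => volPrimitive (x t p) (u t p) (v t p) := by
  have hA : ∀ {w : ℝ → Annulus → W}, JSmooth I w →
      JSmooth I fun t p => angFormA (x t p) (w t p) := fun hw =>
    ((hx.apply 2).mul (hw.apply 3)).sub ((hx.apply 3).mul (hw.apply 2))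
  have hB : ∀ {w : ℝ → Annulus → W}, JSmooth I w →
      JSmooth I fun t p => angFormB (x t p) (w t p) := fun hw =>
    (((hx.apply 0).mul (hw.apply 1)).sub ((hx.apply 1).mul (hw.apply 0))).div
      ((hx.apply 0).comp_contDiff (contDiff_id.pow 2) |>.add
        ((hx.apply 1).comp_contDiff (contDiff_id.pow 2)))
      fun t ht p => by
        have := one_le_of_ip_eq (h t ht p)
        change x t p 0 ^ 2 + x t p 1 ^ 2 ≠ 0
        linarith
  exact (((hA hu).mul (hB hv)).sub ((hA hv).mul (hB hu))).const_mul (1 / 2)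

/-- The pull-back of the volume form by a family of maps to the anti-de Sitter space is exact:
its density is a divergence in time and space. -/
theorem volume_density_eq (hI : UniqueDiffOn ℝ I) {x : ℝ → Annulus → W} (hx : JSmooth I x)
    (h : ∀ t ∈ I, ∀ p, ip (x t p) (x t p) = -1) {t : ℝ} (ht : I ∈ 𝓝 t) (p : Annulus) :
    det4 (x t p) (pd 0 (x t) p) (pd 1 (x t) p) (dt I x t p) =
      dt I (fun t p => volPrimitive (x t p) (pd 0 (x t) p) (pd 1 (x t) p)) t p +
      pd 0 (fun p => volPrimitive (x t p) (pd 1 (x t) p) (dt I x t p)) p +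
      pd 1 (fun p => volPrimitive (x t p) (dt I x t p) (pd 0 (x t) p)) p := by
  have htI := mem_of_mem_nhds ht
  have hρ : x t p 0 ^ 2 + x t p 1 ^ 2 ≠ 0 := by linarith [one_le_of_ip_eq (h t htI p)]
  have hxt := hx.slice htI
  have hT := (hx.dt hI).slice htI
  have e0 := hasDerivAt_volPrimitive (hx.hasDerivAt ht p) ((hx.pd hI 0).hasDerivAt ht p)
    ((hx.pd hI 1).hasDerivAt ht p) hρ
  have e0' := (jsmooth_volPrimitive hx (hx.pd hI 0) (hx.pd hI 1) h).hasDerivAt ht p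
  have e1 := HasPd.volPrimitive hxt.hasPd ((hxt.pd 1).hasPd (i := 0) (p := p)) hT.hasPd hρ
  have e2 := HasPd.volPrimitive hxt.hasPd hT.hasPd ((hxt.pd 0).hasPd (i := 1) (p := p)) hρ
  rw [e0'.unique e0, e1.pd_eq, e2.pd_eq, hx.dt_pd hI ht, hx.dt_pd hI ht, hxt.pd_comm 1 0 p]
  have hs : ∀ i, ip (x t p) (pd i (x t) p) = 0 := by
    intro i
    have := ip_self_deriv (c := -1) (hxt.hasPd (i := i) (p := p)) ?_
    · simpa using this
    · filter_upwards [eventually_shift i p] with s hs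
      rw [extendZero_of_ne _ hs, h t htI]
  have hs' : ip (x t p) (dt I x t p) = 0 := by
    refine ip_self_deriv (c := -1) (hx.hasDerivAt ht p) ?_
    filter_upwards [ht] with s hs using h s hs p
  rw [← cyclic_volPrimitiveDeriv (h t htI p) (hs 0) (hs 1) hs' (ab := pd 0 (pd 1 (x t)) p)
    (ac := pd 0 (dt I x t) p) (bc := pd 1 (dt I x t) p)]

/-- By Stokes' theorem, the volume swept by a family of maps to the anti-de Sitter space which is
constant at infinity depends on the two ends of the family only. -/
theorem integral_volume_density {x : ℝ → Annulus → W} (hx : JSmooth (Icc 0 1) x)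
    (h : ∀ t ∈ Icc (0 : ℝ) 1, ∀ p, ip (x t p) (x t p) = -1) {K : Set Annulus} (hK : IsCompact K)
    (h0 : ∀ t ∈ Icc (0 : ℝ) 1, ∀ p ∉ K, x t p = x 0 p) :
    ∫ t in (0 : ℝ)..1, ∫ p, det4 (x t p) (pd 0 (x t) p) (pd 1 (x t) p)
        (deriv (fun s => x s p) t) ∂angularMeasure =
      ∫ p, (volPrimitive (x 1 p) (pd 0 (x 1) p) (pd 1 (x 1) p) -
        volPrimitive (x 0 p) (pd 0 (x 0) p) (pd 1 (x 0) p)) ∂angularMeasure := by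
  have hI : UniqueDiffOn ℝ (Icc (0 : ℝ) 1) := uniqueDiffOn_Icc_zero_one
  have hN := jsmooth_volPrimitive hx (hx.pd hI 0) (hx.pd hI 1) h
  have hpd : ∀ t ∈ Icc (0 : ℝ) 1, ∀ i, ∀ p ∉ K, pd i (x t) p = pd i (x 0) p := by
    intro t ht i p hp
    refine pd_congr ?_
    filter_upwards [hK.isClosed.isOpen_compl.mem_nhds hp] with y hy using h0 t ht y hy
  have hN0 : ∀ t ∈ Icc (0 : ℝ) 1, ∀ p ∉ K, volPrimitive (x t p) (pd 0 (x t) p) (pd 1 (x t) p) =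
      volPrimitive (x 0 p) (pd 0 (x 0) p) (pd 1 (x 0) p) := fun t ht p hp => by
    rw [h0 t ht p hp, hpd t ht 0 p hp, hpd t ht 1 p hp]
  rw [hN.integral_sub_eq hK hN0]
  refine intervalIntegral.integral_congr_ae ?_
  rw [uIoc_of_le zero_le_one]
  -- At the end point `t = 1` the two-sided derivative in the volume density may differ from `dt`.
  have h1 : ∀ᵐ t : ℝ, t ≠ 1 := by simp [ae_iff, measure_singleton]
  filter_upwards [h1] with t ht1 ht
  have htI : t ∈ Icc (0 : ℝ) 1 := ⟨ht.1.le, ht.2⟩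
  have htn : Icc (0 : ℝ) 1 ∈ 𝓝 t := Icc_mem_nhds ht.1 (lt_of_le_of_ne ht.2 ht1)
  have hT0 : ∀ p ∉ K, dt (Icc 0 1) x t p = 0 := fun p hp =>
    dt_eq_zero_of_const (x 0 p) htI fun s hs => h0 s hs p hp
  have hM0 := (jsmooth_volPrimitive hx (hx.pd hI 1) (hx.dt hI) h).slice htI
  have hM1 := (jsmooth_volPrimitive hx (hx.dt hI) (hx.pd hI 0) h).slice htI
  have hz0 : ∀ p ∉ K, volPrimitive (x t p) (pd 1 (x t) p) (dt (Icc 0 1) x t p) = 0 :=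
    fun p hp => by simp [hT0 p hp, volPrimitive, angFormA, angFormB]
  have hz1 : ∀ p ∉ K, volPrimitive (x t p) (dt (Icc 0 1) x t p) (pd 0 (x t) p) = 0 :=
    fun p hp => by simp [hT0 p hp, volPrimitive, angFormA, angFormB]
  have hd0 : ∀ p ∉ K, dt (Icc 0 1) (fun t p => volPrimitive (x t p) (pd 0 (x t) p)
      (pd 1 (x t) p)) t p = 0 := fun p hp =>
    dt_eq_zero_of_const _ htI fun s hs => hN0 s hs p hp
  have hi0 := (hM0.pd 0).integrable hK fun p hp =>
    pd_eq_zero_of_forall_notMem hK.isClosed hz0 hp 0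
  have hi1 := (hM1.pd 1).integrable hK fun p hp =>
    pd_eq_zero_of_forall_notMem hK.isClosed hz1 hp 1
  have hi := ((hN.dt hI).slice htI).integrable hK hd0
  have e : ∀ p, det4 (x t p) (pd 0 (x t) p) (pd 1 (x t) p) (deriv (fun s => x s p) t) =
      det4 (x t p) (pd 0 (x t) p) (pd 1 (x t) p) (dt (Icc 0 1) x t p) := fun p => by
    rw [(hx.hasDerivAt htn p).deriv]
  simp only [e, volume_density_eq hI hx h htn]
  rw [integral_add (by exact hi.add hi0) hi1, integral_add hi hi0,
    hM0.integral_pd_eq_zero (.intro hK hz0), hM1.integral_pd_eq_zero (.intro hK hz1),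
    add_zero, add_zero]

end Stokes

/-! ### Null frames -/

section LinearAlgebra

variable {v w z : W}

theorem ip_comm (v w : W) : ip v w = ip w v := by
  unfold ip
  ring

theorem ip_add_left (v w z : W) : ip (v + w) z = ip v z + ip w z := by
  simp only [ip, Pi.add_apply]
  ring

theorem ip_sub_left (v w z : W) : ip (v - w) z = ip v z - ip w z := by
  simp only [ip, Pi.sub_apply]
  ring

theorem ip_smul_left (c : ℝ) (v z : W) : ip (c • v) z = c * ip v z := by
  simp only [ip, Pi.smul_apply, smul_eq_mul]
  ring

theorem ip_add_right (v w z : W) : ip z (v + w) = ip z v + ip z w := by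
  simp only [ip, Pi.add_apply]
  ring

theorem ip_sub_right (v w z : W) : ip z (v - w) = ip z v - ip z w := by
  simp only [ip, Pi.sub_apply]
  ring

theorem ip_smul_right (c : ℝ) (v z : W) : ip z (c • v) = c * ip z v := by
  simp only [ip, Pi.smul_apply, smul_eq_mul]
  ring

/-- The determinant of linear combinations of four vectors. -/
theorem det4_comb (A : Matrix (Fin 4) (Fin 4) ℝ) (e₀ e₁ e₂ e₃ : W) :
    det4 (A 0 0 • e₀ + A 0 1 • e₁ + A 0 2 • e₂ + A 0 3 • e₃)
      (A 1 0 • e₀ + A 1 1 • e₁ + A 1 2 • e₂ + A 1 3 • e₃)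
      (A 2 0 • e₀ + A 2 1 • e₁ + A 2 2 • e₂ + A 2 3 • e₃)
      (A 3 0 • e₀ + A 3 1 • e₁ + A 3 2 • e₂ + A 3 3 • e₃) =
    det4 (A 0) (A 1) (A 2) (A 3) * det4 e₀ e₁ e₂ e₃ := by
  have hA : Matrix.of ![A 0, A 1, A 2, A 3] = A := by
    ext i j
    fin_cases i <;> rfl
  simp only [det4]
  rw [hA, ← Matrix.det_mul]
  congr 1
  ext i j
  fin_cases i <;> simp [Matrix.mul_apply, Fin.sum_univ_four]

/-- Four vectors `σ`, `η`, `a`, `b` of `W` spanning two orthogonal hyperbolic planes, with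
`⟨η, σ⟩ = 1` and `⟨a, b⟩ = F`. -/
structure IsNullFrame (σ η a b : W) (F : ℝ) : Prop where
  σσ : ip σ σ = 0
  ηη : ip η η = 0
  ησ : ip η σ = 1
  σa : ip σ a = 0
  σb : ip σ b = 0
  ηa : ip η a = 0
  ηb : ip η b = 0
  aa : ip a a = 0
  bb : ip b b = 0
  ab : ip a b = F

namespace IsNullFrame

variable {σ η a b : W} {F : ℝ}

/-- The Gram determinant of a null frame. -/
theorem det4_sq (h : IsNullFrame σ η a b F) : det4 σ η a b ^ 2 = F ^ 2 := by
  have hJ : (Matrix.diagonal ![(-1 : ℝ), -1, 1, 1]).det = 1 := by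
    simp [Matrix.det_diagonal, Fin.prod_univ_four]
  have hG : Matrix.of ![σ, η, a, b] * Matrix.diagonal ![(-1 : ℝ), -1, 1, 1] *
      (Matrix.of ![σ, η, a, b]).transpose =
      Matrix.of ![![0, 1, 0, 0], ![1, 0, 0, 0], ![0, 0, 0, F], ![0, 0, F, 0]] := by
    have key : ∀ i j, (Matrix.of ![σ, η, a, b] * Matrix.diagonal ![(-1 : ℝ), -1, 1, 1] *
        (Matrix.of ![σ, η, a, b]).transpose) i j = ip (![σ, η, a, b] i) (![σ, η, a, b] j) := by
      intro i j
      rw [Matrix.mul_apply, Fin.sum_univ_four]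
      simp only [Matrix.mul_diagonal, Matrix.transpose_apply, Matrix.of_apply, ip]
      simp
      ring
    ext i j
    rw [key]
    fin_cases i <;> fin_cases j <;> simp [h.σσ, h.ηη, h.ησ, h.σa, h.σb, h.ηa, h.ηb, h.aa, h.bb,
      h.ab, ip_comm σ η, ip_comm a σ, ip_comm b σ, ip_comm a η, ip_comm b η, ip_comm b a]
  have h1 := congrArg Matrix.det hG
  rw [Matrix.det_mul, Matrix.det_mul, hJ, Matrix.det_transpose] at h1
  have h2 : (Matrix.of ![![0, 1, 0, 0], ![1, 0, 0, 0], ![0, 0, 0, F], ![0, 0, F, 0]]).det =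
      F ^ 2 := by
    simp [Matrix.det_succ_row_zero, Fin.sum_univ_succ, Fin.succAbove]
    ring
  rw [← h2, ← h1, det4]
  ring

theorem eq_zero (h : IsNullFrame σ η a b F) (hF : F ≠ 0) {w : W} (hσ : ip σ w = 0)
    (hη : ip η w = 0) (ha : ip a w = 0) (hb : ip b w = 0) : w = 0 := by
  have hd : (Matrix.of ![σ, η, a, b]).det ≠ 0 := by
    intro h0
    have := h.det4_sq
    rw [det4, h0] at this
    exact hF (by simpa using this.symm)
  have h1 := Matrix.eq_zero_of_mulVec_eq_zero hd (v := ![-w 0, -w 1, w 2, w 3]) (by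
    have key : ∀ v : W, v 0 * -w 0 + v 1 * -w 1 + v 2 * w 2 + v 3 * w 3 = ip v w := by
      intro v
      unfold ip
      ring
    ext i
    fin_cases i <;> simp [Matrix.mulVec, dotProduct, Fin.sum_univ_four] <;>
      first
        | linarith [key σ] | linarith [key η] | linarith [key a] | linarith [key b])
  have h2 := fun j => congrFun h1 j
  ext j
  fin_cases j
  · simpa using h2 0
  · simpa using h2 1
  · simpa using h2 2
  · simpa using h2 3

/-- The components of a vector in a null frame. -/
theorem eq_comb (h : IsNullFrame σ η a b F) (hF : F ≠ 0) (w : W) :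
    w = ip η w • σ + ip σ w • η + (ip b w / F) • a + (ip a w / F) • b := by
  rw [← sub_eq_zero]
  refine h.eq_zero hF ?_ ?_ ?_ ?_ <;>
  · simp only [ip_sub_right, ip_add_right, ip_smul_right, h.σσ, h.ηη, h.ησ, h.σa, h.σb, h.ηa, h.ηb,
      h.aa, h.bb, h.ab, ip_comm σ η, ip_comm a σ, ip_comm b σ, ip_comm a η, ip_comm b η,
      ip_comm b a]
    field_simp
    ring

theorem linearIndependent (h : IsNullFrame σ η a b F) (hF : F ≠ 0) :
    LinearIndependent ℝ ![σ, a, b] := by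
  rw [Fintype.linearIndependent_iff]
  intro c hc
  rw [Fin.sum_univ_three] at hc
  simp only [Matrix.cons_val] at hc
  have h0 := congrArg (ip η) hc
  have h1 := congrArg (ip b) hc
  have h2 := congrArg (ip a) hc
  have hz : ∀ v : W, ip v 0 = 0 := fun v => by simp [ip]
  simp only [hz, ip_add_right, ip_smul_right, h.ησ, h.ηa, h.ηb, h.aa, h.bb, h.ab, ip_comm a σ,
    ip_comm b σ, h.σa, h.σb, ip_comm b a, mul_zero, add_zero, zero_add, mul_one] at h0 h1 h2
  intro i
  fin_cases i
  · exact h0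
  · exact (mul_eq_zero.1 h1).resolve_right hF
  · exact (mul_eq_zero.1 h2).resolve_right hF

end IsNullFrame

end LinearAlgebra

namespace SplitMetric

variable (g : SplitMetric)

theorem ne_zero (p : Annulus) : g.coeff 0 1 p ≠ 0 := (g.pos p).ne'

/-- The logarithm of the component `g(∂₀, ∂₁)`. -/
def logCoeff (p : Annulus) : ℝ := Real.log (g.coeff 0 1 p)

theorem smooth_logCoeff : IsSmooth g.logCoeff := (g.smooth 0 1).log g.ne_zero

theorem pd_logCoeff (i : Fin 2) :
    pd i g.logCoeff = fun p => pd i (g.coeff 0 1) p / g.coeff 0 1 p := by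
  funext p
  exact ((g.smooth 0 1).hasPd.log (g.ne_zero p)).pd_eq

theorem pd_pd_logCoeff (p : Annulus) : pd 0 (pd 1 g.logCoeff) p =
    (pd 0 (pd 1 (g.coeff 0 1)) p * g.coeff 0 1 p -
      pd 1 (g.coeff 0 1) p * pd 0 (g.coeff 0 1) p) / g.coeff 0 1 p ^ 2 := by
  rw [pd_logCoeff]
  exact (((g.smooth 0 1).pd 1).hasPd.div (g.smooth 0 1).hasPd (g.ne_zero p)).pd_eq

end SplitMetric

/-! ### Structure equations of isotropic surfaces -/

namespace IsotropicSurface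

variable {g : SplitMetric} (S : IsotropicSurface g)

theorem ip_σ_pd (i : Fin 2) (p : Annulus) : ip (S.σ p) (pd i S.σ p) = 0 := by
  have h := (S.smooth.hasPd (i := i) (p := p)).ip S.smooth.hasPd
  simp only [S.null] at h
  have h' := h.pd_eq.symm.trans (hasPd_const (0 : ℝ)).pd_eq
  rw [ip_comm (pd i S.σ p)] at h'
  linarith

theorem isNullFrame (p : Annulus) :
    IsNullFrame (S.σ p) (S.η p) (pd 0 S.σ p) (pd 1 S.σ p) (g.coeff 0 1 p) where
  σσ := S.null p
  ηη := S.dual_null p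
  ησ := S.dual_pair p
  σa := S.ip_σ_pd 0 p
  σb := S.ip_σ_pd 1 p
  ηa := S.dual_orth 0 p
  ηb := S.dual_orth 1 p
  aa := by rw [S.metric, g.isotropic]
  bb := by rw [S.metric, g.isotropic]
  ab := S.metric 0 1 p

theorem det4_eq (p : Annulus) :
    det4 (S.σ p) (S.η p) (pd 0 S.σ p) (pd 1 S.σ p) = g.coeff 0 1 p := by
  have h := (S.isNullFrame p).det4_sq
  rw [sq_eq_sq₀ (S.oriented p).le (g.pos p).le] at h
  exact h

/-- The components `⟨η, ∂ᵢ ∂ⱼ σ⟩`, up to sign those of the second fundamental form at infinity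
`⟨D_X η, D_Y σ⟩`. -/
def sff (i j : Fin 2) (p : Annulus) : ℝ := ip (S.η p) (pd i (pd j S.σ) p)

theorem ip_pd_pd (i j k : Fin 2) (p : Annulus) :
    ip (pd k (pd i S.σ) p) (pd j S.σ p) + ip (pd i S.σ p) (pd k (pd j S.σ) p) =
      pd k (g.coeff i j) p := by
  have h := ((S.smooth.pd i).hasPd (i := k) (p := p)).ip (S.smooth.pd j).hasPd
  rw [← h.pd_eq]
  simp only [S.metric]

theorem coeff_self (g : SplitMetric) (i : Fin 2) : g.coeff i i = fun _ => 0 :=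
  funext (g.isotropic i)

theorem coeff_symm (g : SplitMetric) : g.coeff 1 0 = g.coeff 0 1 := funext (g.symm 1 0)

theorem ip_σ_pd_pd (i j : Fin 2) (p : Annulus) :
    ip (S.σ p) (pd i (pd j S.σ) p) = -g.coeff i j p := by
  have h := (S.smooth.hasPd (i := i) (p := p)).ip (S.smooth.pd j).hasPd
  simp only [S.ip_σ_pd] at h
  have h' := h.pd_eq.symm.trans (hasPd_const (0 : ℝ)).pd_eq
  rw [S.metric] at h'
  linarith

/-- The mixed second derivative of `σ` has no component along `∂₀ σ` and `∂₁ σ`. -/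
theorem ip_pd_mixed (i : Fin 2) (p : Annulus) : ip (pd i S.σ p) (pd 0 (pd 1 S.σ) p) = 0 := by
  fin_cases i
  · have h := S.ip_pd_pd 0 0 1 p
    rw [coeff_self, (hasPd_const (0 : ℝ)).pd_eq, ip_comm, S.smooth.pd_comm 1 0] at h
    simp only [Fin.zero_eta]
    linarith
  · have h := S.ip_pd_pd 1 1 0 p
    rw [coeff_self, (hasPd_const (0 : ℝ)).pd_eq, ip_comm] at h
    simp only [Fin.mk_one]
    linarith

theorem ip_pd_same (i : Fin 2) (p : Annulus) : ip (pd i S.σ p) (pd i (pd i S.σ) p) = 0 := by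
  have h := S.ip_pd_pd i i i p
  rw [coeff_self, (hasPd_const (0 : ℝ)).pd_eq, ip_comm] at h
  linarith

theorem ip_pd_one_pd_zero_zero (p : Annulus) :
    ip (pd 1 S.σ p) (pd 0 (pd 0 S.σ) p) = pd 0 (g.coeff 0 1) p := by
  have h := S.ip_pd_pd 0 1 0 p
  rw [S.ip_pd_mixed, ip_comm] at h
  linarith

theorem ip_pd_zero_pd_one_one (p : Annulus) :
    ip (pd 0 S.σ p) (pd 1 (pd 1 S.σ) p) = pd 1 (g.coeff 0 1) p := by
  have h := S.ip_pd_pd 0 1 1 p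
  rw [ip_comm, S.smooth.pd_comm 1 0, S.ip_pd_mixed] at h
  linarith

theorem pd_zero_zero (p : Annulus) : pd 0 (pd 0 S.σ) p =
    S.sff 0 0 p • S.σ p + (pd 0 (g.coeff 0 1) p / g.coeff 0 1 p) • pd 0 S.σ p := by
  have h := (S.isNullFrame p).eq_comb (g.ne_zero p) (pd 0 (pd 0 S.σ) p)
  rw [S.ip_σ_pd_pd, S.ip_pd_same, S.ip_pd_one_pd_zero_zero, g.isotropic] at h
  simpa [sff] using h

theorem pd_one_one (p : Annulus) : pd 1 (pd 1 S.σ) p =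
    S.sff 1 1 p • S.σ p + (pd 1 (g.coeff 0 1) p / g.coeff 0 1 p) • pd 1 S.σ p := by
  have h := (S.isNullFrame p).eq_comb (g.ne_zero p) (pd 1 (pd 1 S.σ) p)
  rw [S.ip_σ_pd_pd, S.ip_pd_same, S.ip_pd_zero_pd_one_one, g.isotropic] at h
  simpa [sff] using h

theorem pd_zero_one (p : Annulus) : pd 0 (pd 1 S.σ) p =
    S.sff 0 1 p • S.σ p - g.coeff 0 1 p • S.η p := by
  have h := (S.isNullFrame p).eq_comb (g.ne_zero p) (pd 0 (pd 1 S.σ) p)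
  rw [S.ip_σ_pd_pd, S.ip_pd_mixed, S.ip_pd_mixed] at h
  rw [h]
  simp [sff, sub_eq_add_neg]

variable {S}

theorem ip_pd_η (hη : IsSmooth S.η) (i j : Fin 2) (p : Annulus) :
    ip (pd i S.η p) (pd j S.σ p) = -S.sff i j p := by
  have h := (hη.hasPd (i := i) (p := p)).ip (S.smooth.pd j).hasPd
  simp only [S.dual_orth] at h
  have h' := h.pd_eq.symm.trans (hasPd_const (0 : ℝ)).pd_eq
  unfold sff
  linarith

theorem ip_σ_pd_η (hη : IsSmooth S.η) (i : Fin 2) (p : Annulus) :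
    ip (S.σ p) (pd i S.η p) = 0 := by
  have h := (hη.hasPd (i := i) (p := p)).ip S.smooth.hasPd
  simp only [S.dual_pair] at h
  have h' := h.pd_eq.symm.trans (hasPd_const (1 : ℝ)).pd_eq
  rw [S.dual_orth, ip_comm] at h'
  linarith

theorem ip_η_pd_η (hη : IsSmooth S.η) (i : Fin 2) (p : Annulus) :
    ip (S.η p) (pd i S.η p) = 0 := by
  have h := (hη.hasPd (i := i) (p := p)).ip hη.hasPd
  simp only [S.dual_null] at h
  have h' := h.pd_eq.symm.trans (hasPd_const (0 : ℝ)).pd_eq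
  rw [ip_comm (pd i S.η p)] at h'
  linarith

theorem sff_symm (p : Annulus) : S.sff 1 0 p = S.sff 0 1 p := by
  rw [sff, S.smooth.pd_comm 1 0, sff]

/-- Weingarten's formula. -/
theorem pd_η (hη : IsSmooth S.η) (i : Fin 2) (p : Annulus) : pd i S.η p =
    -(S.sff i 1 p / g.coeff 0 1 p) • pd 0 S.σ p - (S.sff i 0 p / g.coeff 0 1 p) • pd 1 S.σ p := by
  have h := (S.isNullFrame p).eq_comb (g.ne_zero p) (pd i S.η p)
  rw [ip_σ_pd_η hη, ip_η_pd_η hη, ip_comm, ip_pd_η hη, ip_comm, ip_pd_η hη] at h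
  rw [h]
  simp [neg_div, sub_eq_add_neg]

theorem smooth_sff (hη : IsSmooth S.η) (i j : Fin 2) : IsSmooth (S.sff i j) :=
  hη.ip ((S.smooth.pd j).pd i)

/-- The Gauss equation: the right hand side is `-K g(∂₀, ∂₁)`. -/
theorem two_mul_sff_mixed (p : Annulus) : 2 * S.sff 0 1 p = pd 0 (pd 1 g.logCoeff) p := by
  have hF := g.ne_zero p
  -- Differentiate `⟨∂₀ ∂₀ σ, ∂₁ σ⟩ = ∂₀ g(∂₀, ∂₁)` along `∂₁` and `⟨∂₀ ∂₁ σ, ∂₁ σ⟩ = 0` along `∂₀`;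
  -- the third derivatives of `σ` agree.
  have h1 := (((S.smooth.pd 0).pd 0).hasPd (i := 1) (p := p)).ip (S.smooth.pd 1).hasPd
  have h2 := (((S.smooth.pd 1).pd 0).hasPd (i := 0) (p := p)).ip (S.smooth.pd 1).hasPd
  have e1 : (fun p => ip (pd 0 (pd 0 S.σ) p) (pd 1 S.σ p)) = pd 0 (g.coeff 0 1) := by
    funext p
    rw [ip_comm, S.ip_pd_one_pd_zero_zero]
  have e2 : (fun p => ip (pd 0 (pd 1 S.σ) p) (pd 1 S.σ p)) = fun _ => 0 := by
    funext p
    rw [ip_comm, S.ip_pd_mixed]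
  rw [e1] at h1
  rw [e2] at h2
  have h1' := h1.pd_eq
  have h2' := h2.pd_eq.symm.trans (hasPd_const (0 : ℝ)).pd_eq
  have e3 : pd 1 (pd 0 (pd 0 S.σ)) p = pd 0 (pd 0 (pd 1 S.σ)) p := by
    rw [(S.smooth.pd 0).pd_comm 1 0, funext (S.smooth.pd_comm 1 0)]
  have hfr := S.isNullFrame p
  rw [e3, (g.smooth 0 1).pd_comm 1 0, S.pd_zero_zero, S.pd_one_one] at h1'
  rw [S.pd_zero_one p] at h2'
  simp only [ip_add_right, ip_sub_right, ip_smul_right, ip_add_left, ip_sub_left, ip_smul_left,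
    hfr.σσ, hfr.ηη, hfr.ησ, hfr.σb, hfr.σa, hfr.ab, ip_comm (S.σ p) (S.η p),
    ip_comm (pd 0 S.σ p) (S.σ p)] at h1' h2'
  rw [g.pd_pd_logCoeff]
  field_simp
  field_simp at h1'
  linear_combination -g.coeff 0 1 p * h2' - h1'

/-- The Codazzi equation. -/
theorem codazzi_zero (hη : IsSmooth S.η) (p : Annulus) : pd 1 (S.sff 0 0) p =
    pd 0 (S.sff 0 1) p - S.sff 0 1 p * pd 0 (g.coeff 0 1) p / g.coeff 0 1 p := by
  have h1 := (hη.hasPd (i := 1) (p := p)).ip ((S.smooth.pd 0).pd 0).hasPd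
  have h2 := (hη.hasPd (i := 0) (p := p)).ip ((S.smooth.pd 1).pd 0).hasPd
  have e3 : pd 1 (pd 0 (pd 0 S.σ)) p = pd 0 (pd 0 (pd 1 S.σ)) p := by
    rw [(S.smooth.pd 0).pd_comm 1 0, funext (S.smooth.pd_comm 1 0)]
  have h1' : pd 1 (S.sff 0 0) p = _ := h1.pd_eq
  have h2' : pd 0 (S.sff 0 1) p = _ := h2.pd_eq
  rw [h1', h2', e3, S.pd_zero_zero p, S.pd_zero_one p]
  simp only [ip_add_right, ip_sub_right, ip_smul_right, ip_pd_η hη, ip_comm _ (S.σ p),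
    ip_comm _ (S.η p), ip_σ_pd_η hη, ip_η_pd_η hη, sff_symm]
  ring

/-- The Codazzi equation. -/
theorem codazzi_one (hη : IsSmooth S.η) (p : Annulus) : pd 0 (S.sff 1 1) p =
    pd 1 (S.sff 0 1) p - S.sff 0 1 p * pd 1 (g.coeff 0 1) p / g.coeff 0 1 p := by
  have h1 := (hη.hasPd (i := 0) (p := p)).ip ((S.smooth.pd 1).pd 1).hasPd
  have h2 := (hη.hasPd (i := 1) (p := p)).ip ((S.smooth.pd 1).pd 0).hasPd
  have e3 := (S.smooth.pd 1).pd_comm 1 0 p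
  have h1' : pd 0 (S.sff 1 1) p = _ := h1.pd_eq
  have h2' : pd 1 (S.sff 0 1) p = _ := h2.pd_eq
  rw [h1', h2', e3, S.pd_one_one p, S.pd_zero_one p]
  simp only [ip_add_right, ip_sub_right, ip_smul_right, ip_pd_η hη, ip_comm _ (S.σ p),
    ip_comm _ (S.η p), ip_σ_pd_η hη, ip_η_pd_η hη]
  ring

/-! ### The Epstein surface -/

theorem pd_base (hη : IsSmooth S.η) (i : Fin 2) (p : Annulus) :
    pd i S.base p = (Real.sqrt 2 / 2) • (pd i S.σ p - pd i S.η p) :=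
  ((S.smooth.hasPd.sub hη.hasPd).const_smul _).pd_eq

theorem pd_normal (hη : IsSmooth S.η) (i : Fin 2) (p : Annulus) :
    pd i S.normal p = (Real.sqrt 2 / 2) • (pd i S.σ p + pd i S.η p) :=
  ((S.smooth.hasPd.add hη.hasPd).const_smul _).pd_eq

theorem sqrt_two_div_two_sq : (Real.sqrt 2 / 2) ^ 2 = 1 / 2 := by
  rw [div_pow, Real.sq_sqrt (by norm_num)]
  norm_num

theorem base_eq_comb (p : Annulus) : S.base p = (Real.sqrt 2 / 2) • S.σ p +
    (-(Real.sqrt 2 / 2)) • S.η p + (0 : ℝ) • pd 0 S.σ p + (0 : ℝ) • pd 1 S.σ p := by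
  rw [base]
  module

theorem pd_zero_base_eq_comb (hη : IsSmooth S.η) (p : Annulus) : pd 0 S.base p =
    (0 : ℝ) • S.σ p + (0 : ℝ) • S.η p +
      (Real.sqrt 2 / 2 * (1 + S.sff 0 1 p / g.coeff 0 1 p)) • pd 0 S.σ p +
      (Real.sqrt 2 / 2 * (S.sff 0 0 p / g.coeff 0 1 p)) • pd 1 S.σ p := by
  rw [pd_base hη, pd_η hη]
  module

theorem pd_one_base_eq_comb (hη : IsSmooth S.η) (p : Annulus) : pd 1 S.base p =
    (0 : ℝ) • S.σ p + (0 : ℝ) • S.η p +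
      (Real.sqrt 2 / 2 * (S.sff 1 1 p / g.coeff 0 1 p)) • pd 0 S.σ p +
      (Real.sqrt 2 / 2 * (1 + S.sff 0 1 p / g.coeff 0 1 p)) • pd 1 S.σ p := by
  rw [pd_base hη, pd_η hη, sff_symm]
  module

/-- The density of `α` on the Epstein surface, in terms of the first and second fundamental forms at
infinity. -/
theorem alphaDensity_eq (hη : IsSmooth S.η) (p : Annulus) : alphaDensity S.base S.normal p =
    (1 / 4) * (g.coeff 0 1 p -
      (S.sff 0 1 p ^ 2 - S.sff 0 0 p * S.sff 1 1 p) / g.coeff 0 1 p) := by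
  have hx := S.base_eq_comb p
  have hx0 := pd_zero_base_eq_comb hη p
  have hx1 := pd_one_base_eq_comb hη p
  have hk := sqrt_two_div_two_sq
  have hF := g.ne_zero p
  have hD := S.det4_eq p
  set k := Real.sqrt 2 / 2 with hkdef
  set F := g.coeff 0 1 p
  set P := S.sff 0 0 p
  set Q := S.sff 0 1 p
  set R := S.sff 1 1 p
  have hn : S.normal p = k • S.σ p + k • S.η p + (0 : ℝ) • pd 0 S.σ p + (0 : ℝ) • pd 1 S.σ p := by
    rw [normal]
    module
  have hn0 : pd 0 S.normal p = (0 : ℝ) • S.σ p + (0 : ℝ) • S.η p + (k * (1 - Q / F)) • pd 0 S.σ p +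
      (-k * (P / F)) • pd 1 S.σ p := by
    rw [pd_normal hη, pd_η hη]
    module
  have hn1 : pd 1 S.normal p = (0 : ℝ) • S.σ p + (0 : ℝ) • S.η p + (-k * (R / F)) • pd 0 S.σ p +
      (k * (1 - Q / F)) • pd 1 S.σ p := by
    rw [pd_normal hη, pd_η hη, sff_symm]
    module
  have d1 := det4_comb (Matrix.of ![![k, -k, 0, 0], ![k, k, 0, 0],
    ![0, 0, k * (1 - Q / F), -k * (P / F)], ![0, 0, k * (R / F), k * (1 + Q / F)]])
    (S.σ p) (S.η p) (pd 0 S.σ p) (pd 1 S.σ p)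
  have d2 := det4_comb (Matrix.of ![![k, -k, 0, 0], ![k, k, 0, 0],
    ![0, 0, k * (1 + Q / F), k * (P / F)], ![0, 0, -k * (R / F), k * (1 - Q / F)]])
    (S.σ p) (S.η p) (pd 0 S.σ p) (pd 1 S.σ p)
  simp only [Matrix.of_apply, Matrix.cons_val, hD] at d1 d2
  have hk4 : k ^ 4 = 1 / 4 := by
    rw [show k ^ 4 = (k ^ 2) ^ 2 by ring, hk]
    norm_num
  rw [alphaDensity, hx, hn, hx0, hx1, hn0, hn1, d1, d2, det4_expand, det4_expand]
  simp
  field_simp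
  linear_combination 4 * (F ^ 2 - Q ^ 2 + P * R) * hk4

/-- The density of the volume form on the two coordinate directions of the Epstein surface and a
third vector, whose component along the normal is `c`. -/
theorem det4_base (hη : IsSmooth S.η) (p : Annulus) (c r s : ℝ) :
    det4 (S.base p) (pd 0 S.base p) (pd 1 S.base p)
      (c • S.normal p + r • pd 0 S.σ p + s • pd 1 S.σ p) =
    c / 2 * (g.coeff 0 1 p + 2 * S.sff 0 1 p +
      (S.sff 0 1 p ^ 2 - S.sff 0 0 p * S.sff 1 1 p) / g.coeff 0 1 p) := by
  have hx := S.base_eq_comb p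
  have hx0 := pd_zero_base_eq_comb hη p
  have hx1 := pd_one_base_eq_comb hη p
  have hk := sqrt_two_div_two_sq
  have hF := g.ne_zero p
  have hD := S.det4_eq p
  set k := Real.sqrt 2 / 2 with hkdef
  set F := g.coeff 0 1 p
  set P := S.sff 0 0 p
  set Q := S.sff 0 1 p
  set R := S.sff 1 1 p
  have hn : c • S.normal p + r • pd 0 S.σ p + s • pd 1 S.σ p =
      (c * k) • S.σ p + (c * k) • S.η p + r • pd 0 S.σ p + s • pd 1 S.σ p := by
    rw [normal]
    module
  have d := det4_comb (Matrix.of ![![k, -k, 0, 0], ![0, 0, k * (1 + Q / F), k * (P / F)],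
    ![0, 0, k * (R / F), k * (1 + Q / F)], ![c * k, c * k, r, s]])
    (S.σ p) (S.η p) (pd 0 S.σ p) (pd 1 S.σ p)
  simp only [Matrix.of_apply, Matrix.cons_val, hD] at d
  have hk4 : k ^ 4 = 1 / 4 := by
    rw [show k ^ 4 = (k ^ 2) ^ 2 by ring, hk]
    norm_num
  rw [hx, hn, hx0, hx1, d, det4_expand]
  simp
  field_simp
  linear_combination 4 * c * (2 * F * Q + F ^ 2 + Q ^ 2 - P * R) * hk4

end IsotropicSurface

/-! ### Conformal changes of isotropic surfaces -/

namespace IsotropicSurface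

section Rescale

variable {g : SplitMetric} (S : IsotropicSurface g) (u : Annulus → ℝ)

/-- The isotropic surface `e^u σ`. -/
def rescaleσ (p : Annulus) : W := Real.exp (u p) • S.σ p

/-- The dual of `e^u σ`. -/
def rescaleη (p : Annulus) : W := Real.exp (-u p) • (S.η p -
  (pd 1 u p / g.coeff 0 1 p) • pd 0 S.σ p - (pd 0 u p / g.coeff 0 1 p) • pd 1 S.σ p -
  (pd 0 u p * pd 1 u p / g.coeff 0 1 p) • S.σ p)

variable {u}

theorem hasPd_rescaleσ (hu : IsSmooth u) (i : Fin 2) (p : Annulus) : HasPd i (S.rescaleσ u)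
    (Real.exp (u p) • pd i S.σ p + (Real.exp (u p) * pd i u p) • S.σ p) p :=
  hu.hasPd.exp.smul S.smooth.hasPd

theorem pd_rescaleσ (hu : IsSmooth u) (i : Fin 2) : pd i (S.rescaleσ u) =
    fun p => Real.exp (u p) • pd i S.σ p + (Real.exp (u p) * pd i u p) • S.σ p :=
  funext fun p => (S.hasPd_rescaleσ hu i p).pd_eq

theorem pd_pd_rescaleσ (hu : IsSmooth u) (i j : Fin 2) (p : Annulus) :
    pd i (pd j (S.rescaleσ u)) p = Real.exp (u p) • (pd i (pd j S.σ) p + pd i u p • pd j S.σ p +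
      pd j u p • pd i S.σ p + (pd i (pd j u) p + pd i u p * pd j u p) • S.σ p) := by
  rw [pd_rescaleσ S hu]
  rw [((hu.hasPd.exp.smul (S.smooth.pd j).hasPd).add
    ((hu.hasPd.exp.mul (hu.pd j).hasPd).smul S.smooth.hasPd)).pd_eq]
  module

theorem isNullFrame_rescale (hu : IsSmooth u) (p : Annulus) :
    IsNullFrame (S.rescaleσ u p) (S.rescaleη u p) (pd 0 (S.rescaleσ u) p)
      (pd 1 (S.rescaleσ u) p) (Real.exp (2 * u p) * g.coeff 0 1 p) := by
  have h := S.isNullFrame p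
  have hF := g.ne_zero p
  have he : Real.exp (-u p) * Real.exp (u p) = 1 := by rw [← Real.exp_add]; simp
  have he2 : Real.exp (2 * u p) = Real.exp (u p) ^ 2 := by rw [← Real.exp_nat_mul]; simp
  rw [pd_rescaleσ S hu, pd_rescaleσ S hu, he2]
  unfold rescaleσ rescaleη
  constructor <;>
  simp only [ip_add_right, ip_add_left, ip_sub_left, ip_sub_right, ip_smul_right, ip_smul_left,
    h.σσ, h.ηη, h.ησ, h.σa, h.σb, h.ηa, h.ηb, h.aa, h.bb, h.ab,
    ip_comm (S.σ p) (S.η p), ip_comm (pd 0 S.σ p) (S.σ p), ip_comm (pd 1 S.σ p) (S.σ p),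
    ip_comm (pd 0 S.σ p) (S.η p), ip_comm (pd 1 S.σ p) (S.η p),
    ip_comm (pd 1 S.σ p) (pd 0 S.σ p)] <;>
  field_simp
  all_goals try ring1
  linear_combination g.coeff 0 1 p * he

theorem det4_rescale (hu : IsSmooth u) (p : Annulus) :
    det4 (S.rescaleσ u p) (S.rescaleη u p) (pd 0 (S.rescaleσ u) p) (pd 1 (S.rescaleσ u) p) =
      Real.exp (2 * u p) * g.coeff 0 1 p := by
  have he : Real.exp (-u p) * Real.exp (u p) = 1 := by rw [← Real.exp_add]; simp
  have he2 : Real.exp (2 * u p) = Real.exp (u p) ^ 2 := by rw [← Real.exp_nat_mul]; simp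
  have d := det4_comb (Matrix.of ![![Real.exp (u p), 0, 0, 0],
    ![Real.exp (-u p) * (-(pd 0 u p * pd 1 u p / g.coeff 0 1 p)), Real.exp (-u p),
      Real.exp (-u p) * (-(pd 1 u p / g.coeff 0 1 p)),
      Real.exp (-u p) * (-(pd 0 u p / g.coeff 0 1 p))],
    ![Real.exp (u p) * pd 0 u p, 0, Real.exp (u p), 0],
    ![Real.exp (u p) * pd 1 u p, 0, 0, Real.exp (u p)]])
    (S.σ p) (S.η p) (pd 0 S.σ p) (pd 1 S.σ p)
  simp only [Matrix.of_apply, Matrix.cons_val, S.det4_eq] at d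
  rw [pd_rescaleσ S hu, pd_rescaleσ S hu, he2]
  unfold rescaleσ rescaleη
  convert d using 1
  · congr 1 <;> module
  · rw [det4_expand]
    simp
    left
    linear_combination (-Real.exp (u p) ^ 2) * he

variable {S}

theorem smooth_rescaleσ (hu : IsSmooth u) : IsSmooth (S.rescaleσ u) :=
  (hu.comp_contDiff Real.contDiff_exp).smul S.smooth

theorem smooth_rescaleη (hη : IsSmooth S.η) (hu : IsSmooth u) : IsSmooth (S.rescaleη u) :=
  (hu.comp_contDiff (Real.contDiff_exp.comp contDiff_neg)).smul
    (((hη.sub (((hu.pd 1).div (g.smooth 0 1) g.ne_zero).smul (S.smooth.pd 0))).sub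
      (((hu.pd 0).div (g.smooth 0 1) g.ne_zero).smul (S.smooth.pd 1))).sub
      ((((hu.pd 0).mul (hu.pd 1)).div (g.smooth 0 1) g.ne_zero).smul S.smooth))

theorem jsmooth_rescaleσ {I : Set ℝ} {U : ℝ → Annulus → ℝ} (hU : JSmooth I U) :
    JSmooth I fun t => S.rescaleσ (U t) :=
  hU.exp.smul S.smooth.family

theorem jsmooth_rescaleη {I : Set ℝ} (hI : UniqueDiffOn ℝ I) (hη : IsSmooth S.η)
    {U : ℝ → Annulus → ℝ} (hU : JSmooth I U) : JSmooth I fun t => S.rescaleη (U t) :=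
  (hU.comp_contDiff (Real.contDiff_exp.comp contDiff_neg)).smul
    (((hη.family.sub (((hU.pd hI 1).div (g.smooth 0 1).family fun _ _ => g.ne_zero).smul
      (S.smooth.pd 0).family)).sub
      (((hU.pd hI 0).div (g.smooth 0 1).family fun _ _ => g.ne_zero).smul
        (S.smooth.pd 1).family)).sub
      ((((hU.pd hI 0).mul (hU.pd hI 1)).div (g.smooth 0 1).family fun _ _ => g.ne_zero).smul
        S.smooth.family))

variable (S) in
/-- The isotropic surface `e^u σ`, with first fundamental form at infinity `h = e^{2u} g`. -/
def rescale (hu : IsSmooth u) {h : SplitMetric}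
    (hh : ∀ p, h.coeff 0 1 p = Real.exp (2 * u p) * g.coeff 0 1 p) : IsotropicSurface h where
  σ := S.rescaleσ u
  η := S.rescaleη u
  smooth := smooth_rescaleσ hu
  null p := (S.isNullFrame_rescale hu p).σσ
  transverse p := (S.isNullFrame_rescale hu p).linearIndependent
    (mul_ne_zero (Real.exp_ne_zero _) (g.ne_zero p))
  metric i j p := by
    have hf := S.isNullFrame_rescale hu p
    fin_cases i <;> fin_cases j
    · exact hf.aa.trans (h.isotropic 0 p).symm
    · exact hf.ab.trans (hh p).symm
    · exact (ip_comm _ _).trans (hf.ab.trans ((hh p).symm.trans (h.symm 0 1 p)))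
    · exact hf.bb.trans (h.isotropic 1 p).symm
  dual_null p := (S.isNullFrame_rescale hu p).ηη
  dual_pair p := (S.isNullFrame_rescale hu p).ησ
  dual_orth i p := by
    have hf := S.isNullFrame_rescale hu p
    fin_cases i
    · exact hf.ηa
    · exact hf.ηb
  oriented p := by
    rw [S.det4_rescale hu]
    exact mul_pos (Real.exp_pos _) (g.pos p)

variable {h : SplitMetric} (hh : ∀ p, h.coeff 0 1 p = Real.exp (2 * u p) * g.coeff 0 1 p)

theorem sff_rescale (hu : IsSmooth u) (i j : Fin 2) (p : Annulus) :
    (S.rescale hu hh).sff i j p =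
      ip (S.η p - (pd 1 u p / g.coeff 0 1 p) • pd 0 S.σ p -
        (pd 0 u p / g.coeff 0 1 p) • pd 1 S.σ p -
        (pd 0 u p * pd 1 u p / g.coeff 0 1 p) • S.σ p)
      (pd i (pd j S.σ) p + pd i u p • pd j S.σ p +
        pd j u p • pd i S.σ p + (pd i (pd j u) p + pd i u p * pd j u p) • S.σ p) := by
  have he : Real.exp (-u p) * Real.exp (u p) = 1 := by rw [← Real.exp_add]; simp
  change ip (S.rescaleη u p) (pd i (pd j (S.rescaleσ u)) p) = _
  rw [pd_pd_rescaleσ S hu, rescaleη, ip_smul_left, ip_smul_right, ← mul_assoc, he, one_mul]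

theorem sff_rescale_zero_zero (hu : IsSmooth u) (p : Annulus) :
    (S.rescale hu hh).sff 0 0 p = S.sff 0 0 p + pd 0 (pd 0 u) p - pd 0 u p ^ 2 -
      pd 0 u p * pd 0 (g.coeff 0 1) p / g.coeff 0 1 p := by
  have h := S.isNullFrame p
  have hF := g.ne_zero p
  rw [sff_rescale hh hu, S.pd_zero_zero]
  simp only [ip_add_right, ip_sub_left, ip_smul_right, ip_smul_left,
    h.σσ, h.ησ, h.σa, h.ηa, h.aa, h.ab, ip_comm (pd 0 S.σ p) (S.σ p), ip_comm (pd 1 S.σ p) (S.σ p),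
    h.σb, ip_comm (pd 1 S.σ p) (pd 0 S.σ p)]
  field_simp
  ring

theorem sff_rescale_one_one (hu : IsSmooth u) (p : Annulus) :
    (S.rescale hu hh).sff 1 1 p = S.sff 1 1 p + pd 1 (pd 1 u) p - pd 1 u p ^ 2 -
      pd 1 u p * pd 1 (g.coeff 0 1) p / g.coeff 0 1 p := by
  have h := S.isNullFrame p
  have hF := g.ne_zero p
  rw [sff_rescale hh hu, S.pd_one_one]
  simp only [ip_add_right, ip_sub_left, ip_smul_right, ip_smul_left,
    h.σσ, h.ησ, h.σb, h.ηb, h.bb, h.ab, ip_comm (pd 0 S.σ p) (S.σ p), ip_comm (pd 1 S.σ p) (S.σ p),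
    h.σa]
  field_simp
  ring

/-- Under a conformal change the mixed component of the second fundamental form varies linearly. -/
theorem sff_rescale_zero_one (hu : IsSmooth u) (p : Annulus) :
    (S.rescale hu hh).sff 0 1 p = S.sff 0 1 p + pd 0 (pd 1 u) p := by
  have h := S.isNullFrame p
  have hF := g.ne_zero p
  rw [sff_rescale hh hu, S.pd_zero_one]
  simp only [ip_add_right, ip_sub_right, ip_sub_left, ip_smul_right, ip_smul_left,
    h.σσ, h.ησ, h.σa, h.σb, h.ηa, h.ηb, h.aa, h.bb, h.ab, h.ηη, ip_comm (pd 0 S.σ p) (S.σ p),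
    ip_comm (pd 1 S.σ p) (S.σ p), ip_comm (pd 1 S.σ p) (pd 0 S.σ p), ip_comm (S.σ p) (S.η p),
    ip_comm (pd 0 S.σ p) (S.η p), ip_comm (pd 1 S.σ p) (S.η p)]
  field_simp
  ring

end Rescale

end IsotropicSurface

/-! ### The `𝒲`-volume of a lens cobordism -/

namespace LensCobordism

variable {g h : SplitMetric} (C : LensCobordism g h)

theorem jsmooth_x : JSmooth (Icc 0 1) C.x := C.smooth_x

theorem jsmooth_n : JSmooth (Icc 0 1) C.n := C.smooth_n

theorem jsmooth_alphaDensity : JSmooth (Icc 0 1) fun t => alphaDensity (C.x t) (C.n t) := by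
  have hI : UniqueDiffOn ℝ (Icc (0 : ℝ) 1) := uniqueDiffOn_Icc_zero_one
  have hx := C.jsmooth_x
  have hn := C.jsmooth_n
  exact ((hx.det4 hn (hn.pd hI 0) (hx.pd hI 1)).add
    (hx.det4 hn (hx.pd hI 0) (hn.pd hI 1))).const_mul (1 / 4)

/-- The `𝒲`-volume of a lens cobordism depends on its two ends only. -/
theorem wVolume_congr {C C' : LensCobordism g h} (hx₀ : C.x 0 = C'.x 0) (hn₀ : C.n 0 = C'.n 0)
    (hx₁ : C.x 1 = C'.x 1) (hn₁ : C.n 1 = C'.n 1) : C.wVolume = C'.wVolume := by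
  have key : ∀ D : LensCobordism g h, ∫ t in (0 : ℝ)..1, ∫ p,
      det4 (D.x t p) (pd 0 (D.x t) p) (pd 1 (D.x t) p) (deriv (fun s => D.x s p) t)
        ∂angularMeasure =
      ∫ p, (volPrimitive (D.x 1 p) (pd 0 (D.x 1) p) (pd 1 (D.x 1) p) -
        volPrimitive (D.x 0 p) (pd 0 (D.x 0) p) (pd 1 (D.x 0) p)) ∂angularMeasure := by
    intro D
    obtain ⟨K, hK, h0⟩ := D.constant_at_infinity
    exact integral_volume_density D.jsmooth_x (fun t ht p => (D.mem_unitTangent t ht p).1) hK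
      fun t ht p hp => (h0 t ht p hp).1
  rw [wVolume, wVolume, key C, key C', hx₀, hn₀, hx₁, hn₁]

/-- The `𝒲`-volume as an integral over time of the variation of volume minus that of `α`, both
densities being compactly supported. -/
theorem wVolume_eq_integral : C.wVolume = ∫ t in (0 : ℝ)..1, ∫ p,
    (det4 (C.x t p) (pd 0 (C.x t) p) (pd 1 (C.x t) p) (deriv (fun s => C.x s p) t) -
      dt (Icc 0 1) (fun t => alphaDensity (C.x t) (C.n t)) t p) ∂angularMeasure := by
  have hI : UniqueDiffOn ℝ (Icc (0 : ℝ) 1) := uniqueDiffOn_Icc_zero_one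
  obtain ⟨K, hK, h0⟩ := C.constant_at_infinity
  have hx := C.jsmooth_x
  have hα := C.jsmooth_alphaDensity
  have hpd : ∀ {f : ℝ → Annulus → W}, (∀ t ∈ Icc (0 : ℝ) 1, ∀ p ∉ K, f t p = f 0 p) →
      ∀ t ∈ Icc (0 : ℝ) 1, ∀ i, ∀ p ∉ K, pd i (f t) p = pd i (f 0) p := by
    intro f hf t ht i p hp
    refine pd_congr ?_
    filter_upwards [hK.isClosed.isOpen_compl.mem_nhds hp] with y hy using hf t ht y hy
  have hx0 : ∀ t ∈ Icc (0 : ℝ) 1, ∀ p ∉ K, C.x t p = C.x 0 p := fun t ht p hp => (h0 t ht p hp).1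
  have hn0 : ∀ t ∈ Icc (0 : ℝ) 1, ∀ p ∉ K, C.n t p = C.n 0 p := fun t ht p hp => (h0 t ht p hp).2
  have hα0 : ∀ t ∈ Icc (0 : ℝ) 1, ∀ p ∉ K,
      alphaDensity (C.x t) (C.n t) p = alphaDensity (C.x 0) (C.n 0) p := by
    intro t ht p hp
    simp only [alphaDensity, hx0 t ht p hp, hn0 t ht p hp, hpd hx0 t ht _ p hp,
      hpd hn0 t ht _ p hp]
  have hω := hx.det4 (hx.pd hI 0) (hx.pd hI 1) (hx.dt hI)
  have hω0 : ∀ t ∈ Icc (0 : ℝ) 1, ∀ p ∉ K,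
      det4 (C.x t p) (pd 0 (C.x t) p) (pd 1 (C.x t) p) (dt (Icc 0 1) C.x t p) = 0 := by
    intro t ht p hp
    rw [dt_eq_zero_of_const (C.x 0 p) ht fun s hs => hx0 s hs p hp, det4_expand]
    simp
  have hαd0 : ∀ t ∈ Icc (0 : ℝ) 1, ∀ p ∉ K,
      dt (Icc 0 1) (fun t => alphaDensity (C.x t) (C.n t)) t p = 0 := fun t ht p hp =>
    dt_eq_zero_of_const _ ht fun s hs => hα0 s hs p hp
  have hae : ∀ᵐ t : ℝ, t ∈ uIoc (0 : ℝ) 1 → ∀ p,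
      deriv (fun s => C.x s p) t = dt (Icc 0 1) C.x t p := by
    have h1 : ∀ᵐ t : ℝ, t ≠ 1 := by simp [ae_iff, measure_singleton]
    filter_upwards [h1] with t ht1 ht p
    rw [uIoc_of_le zero_le_one] at ht
    exact (hx.hasDerivAt (Icc_mem_nhds ht.1 (lt_of_le_of_ne ht.2 ht1)) p).deriv
  have hii : ∀ {f : ℝ → Annulus → ℝ}, JSmooth (Icc 0 1) f →
      (∀ t ∈ Icc (0 : ℝ) 1, ∀ p ∉ K, f t p = 0) →
      IntervalIntegrable (fun t => ∫ p, f t p ∂angularMeasure) volume 0 1 := fun hf hf0 =>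
    ContinuousOn.intervalIntegrable
      (by rw [uIcc_of_le zero_le_one]; exact hf.continuousOn_integral isClosed_Icc hK hf0)
  have e1 : ∫ t in (0 : ℝ)..1, ∫ p, det4 (C.x t p) (pd 0 (C.x t) p) (pd 1 (C.x t) p)
        (deriv (fun s => C.x s p) t) ∂angularMeasure = ∫ t in (0 : ℝ)..1, ∫ p,
      det4 (C.x t p) (pd 0 (C.x t) p) (pd 1 (C.x t) p) (dt (Icc 0 1) C.x t p)
        ∂angularMeasure := by
    refine intervalIntegral.integral_congr_ae ?_
    filter_upwards [hae] with t ht htI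
    simp only [ht htI]
  rw [wVolume, e1, hα.integral_sub_eq hK hα0,
    ← intervalIntegral.integral_sub (hii hω hω0) (hii (hα.dt hI) hαd0)]
  refine intervalIntegral.integral_congr_ae ?_
  filter_upwards [hae] with t ht htI
  have htI' : t ∈ Icc (0 : ℝ) 1 := by
    rw [uIoc_of_le zero_le_one] at htI
    exact ⟨htI.1.le, htI.2⟩
  simp only [ht htI]
  rw [integral_sub ((hω.slice htI').integrable hK (hω0 t htI'))
    (((hα.dt hI).slice htI').integrable hK (hαd0 t htI'))]

end LensCobordism

/-! ### The cobordism of conformal changes -/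

namespace IsotropicSurface

variable {g : SplitMetric} (S : IsotropicSurface g) {u : Annulus → ℝ} (hu : IsSmooth u)

theorem weyl_coeff_apply (t : ℝ) (p : Annulus) :
    (g.weyl u hu t).coeff 0 1 p = Real.exp (2 * (t * u p)) * g.coeff 0 1 p := rfl

/-- The isotropic surface `e^{tu} σ` over the metric `e^{2tu} g`. -/
def weyl (t : ℝ) : IsotropicSurface (g.weyl u hu t) :=
  S.rescale (hu.const_mul t) (weyl_coeff_apply hu t)

theorem weyl_σ_apply (t : ℝ) (p : Annulus) :
    (S.weyl hu t).σ p = Real.exp (t * u p) • S.σ p := rfl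

theorem weyl_η_apply (t : ℝ) (p : Annulus) :
    (S.weyl hu t).η p = Real.exp (-(t * u p)) • (S.η p -
      (t * (pd 1 u p / g.coeff 0 1 p)) • pd 0 S.σ p -
      (t * (pd 0 u p / g.coeff 0 1 p)) • pd 1 S.σ p -
      (t ^ 2 * (pd 0 u p * pd 1 u p / g.coeff 0 1 p)) • S.σ p) := by
  change S.rescaleη (fun p => t * u p) p = _
  rw [rescaleη, hu.pd_const_mul, hu.pd_const_mul]
  congr 1
  module

theorem pd_weyl_σ (t : ℝ) (i : Fin 2) (p : Annulus) : pd i (S.weyl hu t).σ p =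
    Real.exp (t * u p) • pd i S.σ p + (Real.exp (t * u p) * (t * pd i u p)) • S.σ p := by
  change pd i (S.rescaleσ fun p => t * u p) p = _
  rw [pd_rescaleσ S (hu.const_mul t), hu.pd_const_mul]

theorem pd_weyl_coeff (t : ℝ) (i : Fin 2) (p : Annulus) : pd i ((g.weyl u hu t).coeff 0 1) p =
    Real.exp (2 * (t * u p)) * (pd i (g.coeff 0 1) p + 2 * t * pd i u p * g.coeff 0 1 p) := by
  rw [funext (weyl_coeff_apply hu t),
    ((((hu.const_mul t).hasPd (i := i) (p := p)).const_mul 2).exp.mul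
      (g.smooth 0 1).hasPd).pd_eq, hu.pd_const_mul]
  ring

/-- The velocity of the Epstein surface of `e^{2tu} g` is `u n` up to a vector tangent to the
surface. -/
theorem hasDerivAt_weyl_base (t : ℝ) (p : Annulus) :
    HasDerivAt (fun s => (S.weyl hu s).base p)
      (u p • (S.weyl hu t).normal p +
        (Real.sqrt 2 / 2 * (pd 1 u p / (g.weyl u hu t).coeff 0 1 p)) • pd 0 (S.weyl hu t).σ p +
        (Real.sqrt 2 / 2 * (pd 0 u p / (g.weyl u hu t).coeff 0 1 p)) • pd 1 (S.weyl hu t).σ p)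
      t := by
  have hF := g.ne_zero p
  have h1 : HasDerivAt (fun s : ℝ => s * u p) (u p) t := by
    simpa using (hasDerivAt_id t).mul_const (u p)
  have hl : ∀ c : ℝ, HasDerivAt (fun s : ℝ => s * c) c t := fun c => by
    simpa using (hasDerivAt_id t).mul_const c
  have hq : ∀ c : ℝ, HasDerivAt (fun s : ℝ => s ^ 2 * c) (2 * t * c) t := fun c => by
    simpa using (hasDerivAt_pow 2 t).mul_const c
  have h2 := (h1.exp.smul_const (S.σ p)).sub (h1.neg.exp.smul
    ((((hasDerivAt_const t (S.η p)).sub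
      ((hl (pd 1 u p / g.coeff 0 1 p)).smul_const (pd 0 S.σ p))).sub
      ((hl (pd 0 u p / g.coeff 0 1 p)).smul_const (pd 1 S.σ p))).sub
      ((hq (pd 0 u p * pd 1 u p / g.coeff 0 1 p)).smul_const (S.σ p))))
  have h3 := h2.const_smul (Real.sqrt 2 / 2)
  have he : Real.exp (-(t * u p)) = (Real.exp (t * u p))⁻¹ := Real.exp_neg _
  have he2 : Real.exp (2 * (t * u p)) = Real.exp (t * u p) ^ 2 := by
    rw [← Real.exp_nat_mul]; simp
  have hne := Real.exp_ne_zero (t * u p)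
  refine (h3.congr_of_eventuallyEq (Eventually.of_forall fun s => ?_)).congr_deriv ?_
  · simp only [base, weyl_σ_apply, weyl_η_apply]
    rfl
  · simp only [normal, pd_weyl_σ, weyl_σ_apply, weyl_η_apply, weyl_coeff_apply,
      Pi.sub_apply, Pi.neg_apply, he, he2]
    match_scalars <;> field_simp <;> ring

theorem weyl_sff_zero_zero (t : ℝ) (p : Annulus) : (S.weyl hu t).sff 0 0 p =
    S.sff 0 0 p + t * pd 0 (pd 0 u) p - t ^ 2 * pd 0 u p ^ 2 -
      t * (pd 0 u p * pd 0 (g.coeff 0 1) p / g.coeff 0 1 p) := by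
  rw [weyl, sff_rescale_zero_zero, hu.pd_const_mul, (hu.pd 0).pd_const_mul]
  ring

theorem weyl_sff_one_one (t : ℝ) (p : Annulus) : (S.weyl hu t).sff 1 1 p =
    S.sff 1 1 p + t * pd 1 (pd 1 u) p - t ^ 2 * pd 1 u p ^ 2 -
      t * (pd 1 u p * pd 1 (g.coeff 0 1) p / g.coeff 0 1 p) := by
  rw [weyl, sff_rescale_one_one, hu.pd_const_mul, (hu.pd 1).pd_const_mul]
  ring

theorem weyl_sff_zero_one (t : ℝ) (p : Annulus) : (S.weyl hu t).sff 0 1 p =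
    S.sff 0 1 p + t * pd 0 (pd 1 u) p := by
  rw [weyl, sff_rescale_zero_one, hu.pd_const_mul, (hu.pd 1).pd_const_mul]

variable {S} {hu}

theorem smooth_weyl_η (hη : IsSmooth S.η) (t : ℝ) : IsSmooth (S.weyl hu t).η :=
  smooth_rescaleη hη (hu.const_mul t)

theorem hasDerivAt_weyl_alphaDensity (hη : IsSmooth S.η) (t : ℝ) (p : Annulus) :
    HasDerivAt (fun s => alphaDensity (S.weyl hu s).base (S.weyl hu s).normal p)
      ((1 / 4) * (2 * u p * (g.weyl u hu t).coeff 0 1 p -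
        (2 * (S.weyl hu t).sff 0 1 p * pd 0 (pd 1 u) p -
          (pd 0 (pd 0 u) p - pd 0 u p * pd 0 ((g.weyl u hu t).coeff 0 1) p /
            (g.weyl u hu t).coeff 0 1 p) * (S.weyl hu t).sff 1 1 p -
          (S.weyl hu t).sff 0 0 p * (pd 1 (pd 1 u) p -
            pd 1 u p * pd 1 ((g.weyl u hu t).coeff 0 1) p / (g.weyl u hu t).coeff 0 1 p)) /
          (g.weyl u hu t).coeff 0 1 p +
        2 * u p * ((S.weyl hu t).sff 0 1 p ^ 2 -
          (S.weyl hu t).sff 0 0 p * (S.weyl hu t).sff 1 1 p) /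
          (g.weyl u hu t).coeff 0 1 p)) t := by
  have hF := g.ne_zero p
  have hne := Real.exp_ne_zero (2 * (t * u p))
  have hl : ∀ c : ℝ, HasDerivAt (fun s : ℝ => s * c) c t := fun c => by
    simpa using (hasDerivAt_id t).mul_const c
  have hq : ∀ c : ℝ, HasDerivAt (fun s : ℝ => s ^ 2 * c) (2 * t * c) t := fun c => by
    simpa using (hasDerivAt_pow 2 t).mul_const c
  have hFt : HasDerivAt (fun s => (g.weyl u hu s).coeff 0 1 p)
      (2 * u p * (g.weyl u hu t).coeff 0 1 p) t :=
    ((((hl (u p)).const_mul 2).exp).mul_const (g.coeff 0 1 p)).congr_deriv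
      (by rw [weyl_coeff_apply]; ring)
  have hP : HasDerivAt (fun s => (S.weyl hu s).sff 0 0 p) (pd 0 (pd 0 u) p -
      pd 0 u p * pd 0 ((g.weyl u hu t).coeff 0 1) p / (g.weyl u hu t).coeff 0 1 p) t := by
    simp only [weyl_sff_zero_zero]
    refine ((((hl _).const_add _).sub (hq _)).sub (hl _)).congr_deriv ?_
    rw [pd_weyl_coeff, weyl_coeff_apply]
    field_simp
    ring
  have hR : HasDerivAt (fun s => (S.weyl hu s).sff 1 1 p) (pd 1 (pd 1 u) p -
      pd 1 u p * pd 1 ((g.weyl u hu t).coeff 0 1) p / (g.weyl u hu t).coeff 0 1 p) t := by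
    simp only [weyl_sff_one_one]
    refine ((((hl _).const_add _).sub (hq _)).sub (hl _)).congr_deriv ?_
    rw [pd_weyl_coeff, weyl_coeff_apply]
    field_simp
    ring
  have hQ : HasDerivAt (fun s => (S.weyl hu s).sff 0 1 p) (pd 0 (pd 1 u) p) t := by
    simp only [weyl_sff_zero_one]
    exact (hl _).const_add _
  have hFt0 := (g.weyl u hu t).ne_zero p
  refine (((hFt.sub (((hQ.pow 2).sub (hP.mul hR)).div hFt hFt0)).const_mul
    (1 / 4)).congr_of_eventuallyEq (Eventually.of_forall fun s => ?_)).congr_deriv ?_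
  · exact alphaDensity_eq (smooth_weyl_η hη s) p
  · simp only [Pi.sub_apply, Pi.mul_apply, Pi.pow_apply]
    field_simp
    ring

/-- Along a conformal change of velocity `u`, the variation of the `𝒲`-volume has density
`u ⟨η, ∂₀ ∂₁ σ⟩` up to a divergence. -/
theorem weyl_variation (hη : IsSmooth S.η) (t : ℝ) (p : Annulus) :
    det4 ((S.weyl hu t).base p) (pd 0 (S.weyl hu t).base p) (pd 1 (S.weyl hu t).base p)
        (deriv (fun s => (S.weyl hu s).base p) t) -
      deriv (fun s => alphaDensity (S.weyl hu s).base (S.weyl hu s).normal p) t =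
    u p * (S.weyl hu t).sff 0 1 p + (1 / 4) *
      (pd 0 (fun p => ((S.weyl hu t).sff 0 1 p * pd 1 u p - (S.weyl hu t).sff 1 1 p * pd 0 u p) /
          (g.weyl u hu t).coeff 0 1 p) p +
        pd 1 (fun p => ((S.weyl hu t).sff 0 1 p * pd 0 u p - (S.weyl hu t).sff 0 0 p * pd 1 u p) /
          (g.weyl u hu t).coeff 0 1 p) p) := by
  have hηt := smooth_weyl_η (hu := hu) hη t
  rw [(S.hasDerivAt_weyl_base hu t p).deriv, (hasDerivAt_weyl_alphaDensity hη t p).deriv,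
    det4_base hηt]
  have hF := (g.weyl u hu t).ne_zero p
  have s := fun i j => smooth_sff hηt i j
  have d0 := ((((s 0 1).hasPd (i := 0) (p := p)).mul (hu.pd 1).hasPd).sub
    ((s 1 1).hasPd.mul (hu.pd 0).hasPd)).div ((g.weyl u hu t).smooth 0 1).hasPd hF
  have d1 := ((((s 0 1).hasPd (i := 1) (p := p)).mul (hu.pd 0).hasPd).sub
    ((s 0 0).hasPd.mul (hu.pd 1).hasPd)).div ((g.weyl u hu t).smooth 0 1).hasPd hF
  -- The Codazzi equations remove the derivatives of the second fundamental form.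
  rw [d0.pd_eq, d1.pd_eq, codazzi_zero hηt, codazzi_one hηt, hu.pd_comm 1 0]
  field_simp
  ring

end IsotropicSurface

/-! ### A flat isotropic surface -/

section Flat

theorem sin_sub_ne_zero {q : ℝ × ℝ} (hq : q ∈ angleDomain) : Real.sin (q.1 - q.2) ≠ 0 := by
  intro h
  obtain ⟨n, hn⟩ := Real.sin_eq_zero_iff.1 h
  refine hq ?_
  have : q.1 = q.2 + n * Real.pi := by linarith
  rw [this]
  simp

theorem eq_of_periodic {E : Type} {f : ℝ → E} (hf : Function.Periodic f Real.pi) {x y : ℝ}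
    (h : (x : RP1) = (y : RP1)) : f x = f y := by
  have := congrArg hf.lift h
  simpa using this

/-- A map on `ℝ²` which changes sign under translations by `π` in both coordinates, made invariant
through multiplication by the sign of `sin (a - b)`. -/
def signTwist (v : ℝ × ℝ → W) (q : ℝ × ℝ) : W := Real.sign (Real.sin (q.1 - q.2)) • v q

/-- The map on `𝐀` induced by `signTwist v`. -/
def twist (v : ℝ × ℝ → W) (p : Annulus) : W := signTwist v (exists_mk p).choose

/-- `v` changes sign under translations by `π` in both coordinates. -/
def Antiperiodic₂ (v : ℝ × ℝ → W) : Prop :=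
  ∀ a b, v (a + Real.pi, b) = -v (a, b) ∧ v (a, b + Real.pi) = -v (a, b)

variable {v : ℝ × ℝ → W}

theorem twist_mk (hv : Antiperiodic₂ v) {q : ℝ × ℝ} (hq : q ∈ angleDomain) :
    twist v (mk q hq) = Real.sign (Real.sin (q.1 - q.2)) • v q := by
  have h1 : ∀ b, Function.Periodic (fun a => signTwist v (a, b)) Real.pi := fun b a => by
    have : a + Real.pi - b = a - b + Real.pi := by ring
    simp only [signTwist, (hv a b).1, this, Real.sin_add_pi, Real.sign_neg, smul_neg, neg_smul,
      neg_neg]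
  have h2 : ∀ a, Function.Periodic (fun b => signTwist v (a, b)) Real.pi := fun a b => by
    have : a - (b + Real.pi) = a - b - Real.pi := by ring
    simp only [signTwist, (hv a b).2, this, Real.sin_sub_pi, Real.sign_neg, smul_neg, neg_smul,
      neg_neg]
  obtain ⟨hr, hr'⟩ := (exists_mk (mk q hq)).choose_spec
  rw [twist]
  set r := (exists_mk (mk q hq)).choose
  have e : proj r = proj q := congrArg Subtype.val hr'
  rw [proj, proj, Prod.mk.injEq] at e
  exact (eq_of_periodic (h1 r.2) e.1).trans (eq_of_periodic (h2 q.1) e.2)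

theorem eventually_lift_twist (hv : Antiperiodic₂ v) {q : ℝ × ℝ} (hq : q ∈ angleDomain) :
    ∀ᶠ r in 𝓝 q, lift (twist v) r = Real.sign (Real.sin (q.1 - q.2)) • v r := by
  have hs : Continuous fun r : ℝ × ℝ => Real.sin (r.1 - r.2) := by fun_prop
  have h : ∀ᶠ r : ℝ × ℝ in 𝓝 q, Real.sign (Real.sin (r.1 - r.2)) =
      Real.sign (Real.sin (q.1 - q.2)) := by
    rcases lt_or_gt_of_ne (sin_sub_ne_zero hq) with h | h
    · filter_upwards [hs.continuousAt.eventually (gt_mem_nhds h)] with r hr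
      rw [Real.sign_of_neg h, Real.sign_of_neg hr]
    · filter_upwards [hs.continuousAt.eventually (lt_mem_nhds h)] with r hr
      rw [Real.sign_of_pos h, Real.sign_of_pos hr]
  filter_upwards [h, isOpen_angleDomain.mem_nhds hq] with r hr hr'
  rw [lift_of_mem _ hr', twist_mk hv, hr]

theorem isSmooth_twist (hv : Antiperiodic₂ v) (hs : ContDiff ℝ ∞ v) : IsSmooth (twist v) :=
  fun _ hq => ((hs.contDiffAt.const_smul _).congr_of_eventuallyEq
    (eventually_lift_twist hv hq)).contDiffWithinAt

theorem pd_twist_mk (hv : Antiperiodic₂ v) {q : ℝ × ℝ} (hq : q ∈ angleDomain) {i : Fin 2} {v' : W}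
    (h : HasDerivAt (fun s => v (q + step i s)) v' 0) :
    pd i (twist v) (mk q hq) = Real.sign (Real.sin (q.1 - q.2)) • v' := by
  refine HasPd.pd_eq ?_
  have hc : ContinuousAt (fun s => q + step i s) 0 :=
    (continuous_const.add (continuous_step i)).continuousAt
  rw [ContinuousAt, step_zero, add_zero] at hc
  refine (h.const_smul _).congr_of_eventuallyEq ?_
  filter_upwards [hc.eventually (eventually_lift_twist hv hq)] with s hs
  rw [shift_mk]
  exact hs

/-- The flat metric with `g(∂₀, ∂₁) = 2`. -/
def flatMetric : SplitMetric where
  coeff i j _ := if i = j then 0 else 2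
  smooth _ _ := isSmooth_const _
  symm i j _ := by simp only [eq_comm]
  isotropic i _ := by simp
  pos _ := by simp

/-- The vector `(cos (a - b), sin (a - b), cos (a + b), -sin (a + b))`. -/
def flatVec (q : ℝ × ℝ) : W :=
  ![Real.cos (q.1 - q.2), Real.sin (q.1 - q.2), Real.cos (q.1 + q.2), -Real.sin (q.1 + q.2)]

/-- The dual of `flatVec`. -/
def flatDual (q : ℝ × ℝ) : W :=
  ![-Real.cos (q.1 - q.2) / 2, -Real.sin (q.1 - q.2) / 2, Real.cos (q.1 + q.2) / 2,
    -Real.sin (q.1 + q.2) / 2]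

theorem antiperiodic_flatVec : Antiperiodic₂ flatVec := by
  intro a b
  have h1 : a + Real.pi - b = a - b + Real.pi := by ring
  have h2 : a + Real.pi + b = a + b + Real.pi := by ring
  have h3 : a - (b + Real.pi) = a - b - Real.pi := by ring
  have h4 : a + (b + Real.pi) = a + b + Real.pi := by ring
  constructor <;> ext j <;> fin_cases j <;> simp [flatVec, h1, h2, h3, h4, Real.sin_add_pi,
    Real.cos_add_pi, Real.sin_sub_pi, Real.cos_sub_pi]

theorem antiperiodic_flatDual : Antiperiodic₂ flatDual := by
  intro a b
  have h1 : a + Real.pi - b = a - b + Real.pi := by ring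
  have h2 : a + Real.pi + b = a + b + Real.pi := by ring
  have h3 : a - (b + Real.pi) = a - b - Real.pi := by ring
  have h4 : a + (b + Real.pi) = a + b + Real.pi := by ring
  constructor <;> ext j <;> fin_cases j <;> simp [flatDual, h1, h2, h3, h4, Real.sin_add_pi,
    Real.cos_add_pi, Real.sin_sub_pi, Real.cos_sub_pi] <;> ring

theorem contDiff_flatVec : ContDiff ℝ ∞ flatVec := by
  rw [contDiff_pi]
  intro j
  fin_cases j <;> simp [flatVec] <;> fun_prop

theorem contDiff_flatDual : ContDiff ℝ ∞ flatDual := by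
  rw [contDiff_pi]
  intro j
  fin_cases j <;> simp [flatDual] <;> fun_prop

theorem pd_zero_flat {q : ℝ × ℝ} (hq : q ∈ angleDomain) : pd 0 (twist flatVec) (mk q hq) =
    Real.sign (Real.sin (q.1 - q.2)) • ![-Real.sin (q.1 - q.2), Real.cos (q.1 - q.2),
      -Real.sin (q.1 + q.2), -Real.cos (q.1 + q.2)] := by
  refine pd_twist_mk antiperiodic_flatVec hq ?_
  have h1 : HasDerivAt (fun s : ℝ => q.1 + s - q.2) 1 0 :=
    ((hasDerivAt_id (0 : ℝ)).const_add q.1).sub_const q.2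
  have h2 : HasDerivAt (fun s : ℝ => q.1 + s + q.2) 1 0 :=
    ((hasDerivAt_id (0 : ℝ)).const_add q.1).add_const q.2
  rw [hasDerivAt_pi]
  intro j
  fin_cases j
  · simpa [flatVec, step] using h1.cos
  · simpa [flatVec, step] using h1.sin
  · simpa [flatVec, step] using h2.cos
  · simpa [flatVec, step] using h2.sin.fun_neg

theorem pd_one_flat {q : ℝ × ℝ} (hq : q ∈ angleDomain) : pd 1 (twist flatVec) (mk q hq) =
    Real.sign (Real.sin (q.1 - q.2)) • ![Real.sin (q.1 - q.2), -Real.cos (q.1 - q.2),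
      -Real.sin (q.1 + q.2), -Real.cos (q.1 + q.2)] := by
  refine pd_twist_mk antiperiodic_flatVec hq ?_
  have h1 : HasDerivAt (fun s : ℝ => q.1 - (q.2 + s)) (-1) 0 :=
    ((hasDerivAt_id (0 : ℝ)).const_add q.2).const_sub q.1
  have h2 : HasDerivAt (fun s : ℝ => q.1 + (q.2 + s)) 1 0 :=
    ((hasDerivAt_id (0 : ℝ)).const_add q.2).const_add q.1
  rw [hasDerivAt_pi]
  intro j
  fin_cases j
  · simpa [flatVec, step] using h1.cos
  · simpa [flatVec, step] using h1.sin
  · simpa [flatVec, step] using h2.cos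
  · simpa [flatVec, step] using h2.sin.fun_neg

theorem flat_isNullFrame (p : Annulus) : IsNullFrame (twist flatVec p) (twist flatDual p)
    (pd 0 (twist flatVec) p) (pd 1 (twist flatVec) p) 2 ∧
    det4 (twist flatVec p) (twist flatDual p) (pd 0 (twist flatVec) p)
      (pd 1 (twist flatVec) p) = 2 := by
  obtain ⟨q, hq, rfl⟩ := exists_mk p
  rw [pd_zero_flat, pd_one_flat, twist_mk antiperiodic_flatVec, twist_mk antiperiodic_flatDual]
  have hε : Real.sign (Real.sin (q.1 - q.2)) ^ 2 = 1 := by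
    rcases Real.sign_apply_eq_of_ne_zero _ (sin_sub_ne_zero hq) with h | h <;> rw [h] <;> norm_num
  have hd := Real.sin_sq_add_cos_sq (q.1 - q.2)
  have he := Real.sin_sq_add_cos_sq (q.1 + q.2)
  generalize Real.sign (Real.sin (q.1 - q.2)) = ε at *
  simp only [flatVec, flatDual]
  generalize Real.sin (q.1 - q.2) = s at *
  generalize Real.cos (q.1 - q.2) = c at *
  generalize Real.sin (q.1 + q.2) = s' at *
  generalize Real.cos (q.1 + q.2) = c' at *
  constructor
  · constructor <;> simp [ip]
    · linear_combination ε ^ 2 * (he - hd)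
    · linear_combination ε ^ 2 / 4 * (he - hd)
    · linear_combination ε ^ 2 / 2 * (he + hd) + hε
    · ring
    · ring
    · ring
    · ring
    · linear_combination ε ^ 2 * (he - hd)
    · linear_combination ε ^ 2 * (he - hd)
    · linear_combination ε ^ 2 * (he + hd) + 2 * hε
  · rw [det4_expand]
    simp
    have : ε ^ 4 = 1 := by rw [show ε ^ 4 = (ε ^ 2) ^ 2 by ring, hε]; norm_num
    linear_combination 2 * (s ^ 2 + c ^ 2) * (s' ^ 2 + c' ^ 2) * this +
      2 * (s' ^ 2 + c' ^ 2) * hd + 2 * he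

/-- The isotropic surface `± (cos (a - b), sin (a - b), cos (a + b), -sin (a + b))` over the flat
metric. Up to sign the vector depends only on `a` and `b` modulo `π`; the sign of `sin (a - b)`,
which does not vanish on `𝐀`, makes the choice of sign consistent. -/
def flatSurface : IsotropicSurface flatMetric where
  σ := twist flatVec
  η := twist flatDual
  smooth := isSmooth_twist antiperiodic_flatVec contDiff_flatVec
  null p := (flat_isNullFrame p).1.σσ
  transverse p := (flat_isNullFrame p).1.linearIndependent two_ne_zero
  metric i j p := by
    have hf := (flat_isNullFrame p).1
    fin_cases i <;> fin_cases j
    · exact hf.aa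
    · exact hf.ab
    · exact (ip_comm _ _).trans hf.ab
    · exact hf.bb
  dual_null p := (flat_isNullFrame p).1.ηη
  dual_pair p := (flat_isNullFrame p).1.ησ
  dual_orth i p := by
    have hf := (flat_isNullFrame p).1
    fin_cases i
    · exact hf.ηa
    · exact hf.ηb
  oriented p := by
    rw [(flat_isNullFrame p).2]
    norm_num

/-- Every compatible metric is conformal to the flat one, hence is the first fundamental form at
infinity of an isotropic surface with smooth dual. -/
theorem exists_isotropicSurface (g : SplitMetric) :
    ∃ S : IsotropicSurface g, IsSmooth S.η := by
  have hu : IsSmooth fun p => (1 / 2) * Real.log (g.coeff 0 1 p / 2) :=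
    IsSmooth.const_mul (((g.smooth 0 1).div (isSmooth_const 2) fun _ => two_ne_zero).log
      fun p => div_ne_zero (g.ne_zero p) two_ne_zero) _
  refine ⟨flatSurface.rescale hu fun p => ?_, IsotropicSurface.smooth_rescaleη
    (isSmooth_twist antiperiodic_flatDual contDiff_flatDual) hu⟩
  have h2 : flatMetric.coeff 0 1 p = 2 := rfl
  have h : 2 * (1 / 2 * Real.log (g.coeff 0 1 p / 2)) = Real.log (g.coeff 0 1 p / 2) := by ring
  rw [h, Real.exp_log (div_pos (g.pos p) two_pos), h2]
  field_simp

end Flat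

/-! ### The Liouville action of a conformal change -/

namespace IsotropicSurface

variable {g h : SplitMetric} {S : IsotropicSurface g} {u : Annulus → ℝ}

theorem weyl_base_zero (hu : IsSmooth u) :
    (S.weyl hu 0).base = S.base ∧ (S.weyl hu 0).normal = S.normal := by
  constructor <;> funext p <;> simp [base, normal, weyl_σ_apply, weyl_η_apply]

theorem weyl_base_one (hu : IsSmooth u)
    (hh : ∀ p, h.coeff 0 1 p = Real.exp (2 * u p) * g.coeff 0 1 p) :
    (S.weyl hu 1).base = (S.rescale hu hh).base ∧
      (S.weyl hu 1).normal = (S.rescale hu hh).normal := by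
  have hσ : (S.weyl hu 1).σ = (S.rescale hu hh).σ := by
    change S.rescaleσ (fun p => 1 * u p) = S.rescaleσ u
    simp only [one_mul]
  have hη : (S.weyl hu 1).η = (S.rescale hu hh).η := by
    change S.rescaleη (fun p => 1 * u p) = S.rescaleη u
    simp only [one_mul]
  unfold base normal
  rw [hσ, hη]
  exact ⟨rfl, rfl⟩

theorem weyl_eq_of_notMem (hu : IsSmooth u) {p : Annulus} (hp : p ∉ tsupport u) (t : ℝ) :
    (S.weyl hu t).base p = S.base p ∧ (S.weyl hu t).normal p = S.normal p := by
  have h0 := image_eq_zero_of_notMem_tsupport hp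
  have hi : ∀ i, pd i u p = 0 := pd_eq_zero_of_forall_notMem (isClosed_tsupport u)
    (fun _ h => image_eq_zero_of_notMem_tsupport h) hp
  constructor <;> simp [base, normal, weyl_σ_apply, weyl_η_apply, h0, hi]

/-- The lens cobordism formed by the Epstein surfaces of the metrics `e^{2tu} g`, `t ∈ [0, 1]`. -/
def rescaleCobordism (S : IsotropicSurface g) (hη : IsSmooth S.η) (hu : IsSmooth u)
    (hc : HasCompactSupport u)
    (hh : ∀ p, h.coeff 0 1 p = Real.exp (2 * u p) * g.coeff 0 1 p) : LensCobordism g h where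
  surf₀ := S
  surf₁ := S.rescale hu hh
  same_immersion p := ⟨Real.exp (u p), rfl⟩
  x t := (S.weyl hu t).base
  n t := (S.weyl hu t).normal
  smooth_x := by
    have hU : JSmooth (Icc 0 1) fun t p => t * u p := jsmooth_time.mul hu.family
    exact ((jsmooth_rescaleσ hU).sub
      (jsmooth_rescaleη uniqueDiffOn_Icc_zero_one hη hU)).const_smul (Real.sqrt 2 / 2)
  smooth_n := by
    have hU : JSmooth (Icc 0 1) fun t p => t * u p := jsmooth_time.mul hu.family
    exact ((jsmooth_rescaleσ hU).add
      (jsmooth_rescaleη uniqueDiffOn_Icc_zero_one hη hU)).const_smul (Real.sqrt 2 / 2)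
  mem_unitTangent t _ p := by
    have hf := (S.weyl hu t).isNullFrame p
    have hk := sqrt_two_div_two_sq
    simp only [base, normal, ip_smul_left, ip_smul_right, ip_sub_left, ip_sub_right, ip_add_left,
      ip_add_right, hf.σσ, hf.ηη, hf.ησ, ip_comm ((S.weyl hu t).σ p) ((S.weyl hu t).η p)]
    refine ⟨?_, ?_, ?_⟩
    · linear_combination -2 * hk
    · linear_combination 2 * hk
    · ring
  start_eq := weyl_base_zero hu
  end_eq := weyl_base_one hu hh
  constant_at_infinity := ⟨tsupport u, hc, fun t _ p hp => by
    rw [(weyl_eq_of_notMem hu hp t).1, (weyl_eq_of_notMem hu hp t).2,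
      (weyl_eq_of_notMem hu hp 0).1, (weyl_eq_of_notMem hu hp 0).2]
    exact ⟨rfl, rfl⟩⟩

/-- The derivative of the `𝒲`-volume along the metrics `e^{2tu} g`: the divergences integrate to
zero and the Gauss equation expresses the rest by the metric. -/
theorem integral_weyl_variation (hη : IsSmooth S.η) (hu : IsSmooth u) (hc : HasCompactSupport u)
    (t : ℝ) : ∫ p, (det4 ((S.weyl hu t).base p) (pd 0 (S.weyl hu t).base p)
        (pd 1 (S.weyl hu t).base p) (deriv (fun s => (S.weyl hu s).base p) t) -
      deriv (fun s => alphaDensity (S.weyl hu s).base (S.weyl hu s).normal p) t)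
        ∂angularMeasure =
    (∫ p, u p * ((1 / 2) * pd 0 (pd 1 g.logCoeff) p) ∂angularMeasure) +
      t * ∫ p, u p * pd 0 (pd 1 u) p ∂angularMeasure := by
  simp only [weyl_variation hη]
  have s := fun i j => smooth_sff (smooth_weyl_η (hu := hu) hη t) i j
  have hu0 : ∀ p ∉ tsupport u, u p = 0 := fun _ h => image_eq_zero_of_notMem_tsupport h
  have hi : ∀ p ∉ tsupport u, ∀ i, pd i u p = 0 := fun p hp =>
    pd_eq_zero_of_forall_notMem (isClosed_tsupport u) hu0 hp
  set V₀ : Annulus → ℝ := fun p => ((S.weyl hu t).sff 0 1 p * pd 1 u p -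
    (S.weyl hu t).sff 1 1 p * pd 0 u p) / (g.weyl u hu t).coeff 0 1 p
  set V₁ : Annulus → ℝ := fun p => ((S.weyl hu t).sff 0 1 p * pd 0 u p -
    (S.weyl hu t).sff 0 0 p * pd 1 u p) / (g.weyl u hu t).coeff 0 1 p
  have h₀ : IsSmooth V₀ := (((s 0 1).mul (hu.pd 1)).sub ((s 1 1).mul (hu.pd 0))).div
    ((g.weyl u hu t).smooth 0 1) (g.weyl u hu t).ne_zero
  have h₁ : IsSmooth V₁ := (((s 0 1).mul (hu.pd 0)).sub ((s 0 0).mul (hu.pd 1))).div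
    ((g.weyl u hu t).smooth 0 1) (g.weyl u hu t).ne_zero
  have c₀ : HasCompactSupport V₀ := .intro hc.isCompact fun p hp => by simp [V₀, hi p hp]
  have c₁ : HasCompactSupport V₁ := .intro hc.isCompact fun p hp => by simp [V₁, hi p hp]
  have i₀ : Integrable (pd 0 V₀) angularMeasure :=
    (h₀.pd 0).continuous.integrable_of_hasCompactSupport (hasCompactSupport_pd c₀ 0)
  have i₁ : Integrable (pd 1 V₁) angularMeasure :=
    (h₁.pd 1).continuous.integrable_of_hasCompactSupport (hasCompactSupport_pd c₁ 1)
  have hQ : Integrable (fun p => u p * (S.weyl hu t).sff 0 1 p) angularMeasure :=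
    (hu.mul (s 0 1)).integrable hc fun p hp => by simp [hu0 p hp]
  have hA : Integrable (fun p => u p * ((1 / 2) * pd 0 (pd 1 g.logCoeff) p)) angularMeasure :=
    (hu.mul (((g.smooth_logCoeff.pd 1).pd 0).const_mul _)).integrable hc
      fun p hp => by simp [hu0 p hp]
  have hB : Integrable (fun p => u p * pd 0 (pd 1 u) p) angularMeasure :=
    (hu.mul ((hu.pd 1).pd 0)).integrable hc fun p hp => by simp [hu0 p hp]
  rw [integral_add hQ (by exact (i₀.add i₁).const_mul _), integral_const_mul, integral_add i₀ i₁,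
    h₀.integral_pd_eq_zero c₀, h₁.integral_pd_eq_zero c₁, add_zero, mul_zero, add_zero,
    ← integral_const_mul, ← integral_add hA (hB.const_mul t)]
  refine integral_congr_ae (Eventually.of_forall fun p => ?_)
  simp only [weyl_sff_zero_one]
  linear_combination u p / 2 * S.two_mul_sff_mixed p

theorem wVolume_rescaleCobordism (hη : IsSmooth S.η) (hu : IsSmooth u) (hc : HasCompactSupport u)
    (hh : ∀ p, h.coeff 0 1 p = Real.exp (2 * u p) * g.coeff 0 1 p) :
    (S.rescaleCobordism hη hu hc hh).wVolume =
      (∫ p, u p * ((1 / 2) * pd 0 (pd 1 g.logCoeff) p) ∂angularMeasure) +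
        (1 / 2) * ∫ p, u p * pd 0 (pd 1 u) p ∂angularMeasure := by
  have hI : UniqueDiffOn ℝ (Icc (0 : ℝ) 1) := uniqueDiffOn_Icc_zero_one
  have hα := (S.rescaleCobordism hη hu hc hh).jsmooth_alphaDensity
  have e : (S.rescaleCobordism hη hu hc hh).wVolume = ∫ t in (0 : ℝ)..1,
      ((∫ p, u p * ((1 / 2) * pd 0 (pd 1 g.logCoeff) p) ∂angularMeasure) +
        t * ∫ p, u p * pd 0 (pd 1 u) p ∂angularMeasure) := by
    rw [LensCobordism.wVolume_eq_integral]
    refine intervalIntegral.integral_congr_ae ?_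
    have h1 : ∀ᵐ t : ℝ, t ≠ 1 := by simp [ae_iff, measure_singleton]
    filter_upwards [h1] with t ht1 ht
    rw [uIoc_of_le zero_le_one] at ht
    rw [← integral_weyl_variation hη hu hc t]
    refine integral_congr_ae (Eventually.of_forall fun p => ?_)
    simp only
    rw [← (hα.hasDerivAt (Icc_mem_nhds ht.1 (lt_of_le_of_ne ht.2 ht1)) p).deriv]
    rfl
  have hB : IntervalIntegrable (fun t : ℝ => t * ∫ p, u p * pd 0 (pd 1 u) p ∂angularMeasure)
      volume 0 1 := (continuous_id.mul continuous_const).intervalIntegrable _ _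
  rw [e, intervalIntegral.integral_add (by simp) hB, intervalIntegral.integral_mul_const,
    integral_id]
  simp

end IsotropicSurface

/-! ### Uniqueness of the ends of a cobordism -/

section Connected

theorem exists_mem_Ioo_coe_eq (a : ℝ) {y : RP1} (h : (a : RP1) ≠ y) :
    ∃ b ∈ Ioo a (a + Real.pi), (b : RP1) = y := by
  obtain ⟨b, hb, rfl⟩ := (AddCircle.coe_image_Ico_eq Real.pi a ▸ mem_univ y :
    y ∈ ((↑) : ℝ → RP1) '' Ico a (a + Real.pi))
  refine ⟨b, ⟨lt_of_le_of_ne hb.1 ?_, hb.2⟩, rfl⟩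
  rintro rfl
  exact h rfl

theorem mem_angleDomain_of_lt {q : ℝ × ℝ} (h : q.1 < q.2 ∧ q.2 < q.1 + Real.pi) :
    q ∈ angleDomain := by
  intro h'
  have := (AddCircle.coe_eq_coe_iff_of_mem_Ico (p := Real.pi) (a := q.1)
    ⟨le_rfl, by linarith [Real.pi_pos]⟩ ⟨h.1.le, h.2⟩).1 h'
  exact h.1.ne this

/-- `𝐀` is the image of the convex strip `a < b < a + π`. -/
instance : PreconnectedSpace Annulus := by
  have hD : IsPreconnected {q : ℝ × ℝ | q.1 < q.2 ∧ q.2 < q.1 + Real.pi} := by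
    refine Convex.isPreconnected fun q hq r hr a b ha hb hab => ?_
    simp only [mem_ofPred_eq, Prod.fst_add, Prod.smul_fst, Prod.snd_add, Prod.smul_snd,
      smul_eq_mul] at *
    rcases ha.eq_or_lt with rfl | ha
    · obtain rfl : b = 1 := by linarith
      constructor <;> linarith
    · constructor <;> nlinarith
  have hP : PreconnectedSpace {q : ℝ × ℝ | q.1 < q.2 ∧ q.2 < q.1 + Real.pi} :=
    isPreconnected_iff_preconnectedSpace.1 hD
  have hc : Continuous fun q : {q : ℝ × ℝ | q.1 < q.2 ∧ q.2 < q.1 + Real.pi} =>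
      mk q.1 (mem_angleDomain_of_lt q.2) :=
    (isOpenQuotientMap_proj.continuous.comp continuous_subtype_val).subtype_mk _
  refine ⟨?_⟩
  convert isPreconnected_range hc
  refine (range_eq_univ.2 fun p => ?_).symm
  obtain ⟨⟨a, b⟩, hq, rfl⟩ := exists_mk p
  obtain ⟨b', hb', e⟩ := exists_mem_Ioo_coe_eq a hq
  exact ⟨⟨(a, b'), hb'⟩, Subtype.ext (Prod.ext rfl e)⟩

/-- `𝐀` is not compact: its points with `a = 0` accumulate at the diagonal. -/
theorem exists_notMem_of_isCompact {K : Set Annulus} (hK : IsCompact K) : ∃ p, p ∉ K := by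
  by_contra! h
  have hK' : IsClosed (((↑) : Annulus → RP1 × RP1) '' K) :=
    (hK.image continuous_subtype_val).isClosed
  have hcl := hK'.preimage (isOpenQuotientMap_proj.continuous.comp
    (continuous_const.prodMk continuous_id) : Continuous fun s : ℝ => proj (0, s))
  have hmem : ∀ᶠ s : ℝ in 𝓝[>] 0, s ∈ (fun s : ℝ => proj (0, s)) ⁻¹'
      (((↑) : Annulus → RP1 × RP1) '' K) := by
    filter_upwards [Ioo_mem_nhdsGT Real.pi_pos] with s hs
    exact ⟨mk (0, s) (mem_angleDomain_of_lt ⟨hs.1, by simpa using hs.2⟩), h _, rfl⟩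
  have h0 : (0 : ℝ) ∈ (fun s : ℝ => proj (0, s)) ⁻¹' (((↑) : Annulus → RP1 × RP1) '' K) :=
    hcl.mem_of_tendsto (b := 𝓝[>] (0 : ℝ)) (tendsto_id.mono_left nhdsWithin_le_nhds) hmem
  obtain ⟨p, -, hp⟩ := h0
  exact p.2 (by rw [hp]; rfl)

end Connected

theorem IsNullFrame.dual_unique {σ η η' a b : W} {F : ℝ} (h : IsNullFrame σ η a b F)
    (h' : IsNullFrame σ η' a b F) (hF : F ≠ 0) : η' = η := by
  have e := h.eq_comb hF η'
  rw [ip_comm σ, h'.ησ, ip_comm a, h'.ηa, ip_comm b, h'.ηb] at e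
  have e' := congrArg (ip η') e
  simp only [ip_add_right, ip_smul_right, h'.ηη, h'.ησ, h'.ηa, h'.ηb, ip_comm η' η] at e'
  have h0 : ip η η' = 0 := by linarith
  rw [e, h0]
  simp

namespace LensCobordism

variable {g h : SplitMetric} (C : LensCobordism g h)

/-- Smoothness of the dual surface is part of the smoothness of the Epstein surface at `t = 0`. -/
theorem smooth_dual₀ : IsSmooth C.surf₀.η := by
  have hx := C.jsmooth_x.slice (t := 0) (by simp)
  have hn := C.jsmooth_n.slice (t := 0) (by simp)
  have e : C.surf₀.η = fun p => (Real.sqrt 2 / 2) • (C.n 0 p - C.x 0 p) := by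
    funext p
    rw [C.start_eq.1, C.start_eq.2, IsotropicSurface.base, IsotropicSurface.normal, ← smul_sub,
      smul_smul, ← sq, IsotropicSurface.sqrt_two_div_two_sq]
    module
  rw [e]
  exact (hn.sub hx).const_smul _

theorem σ₁_eq_of_notMem {p : Annulus} (hp : C.x 1 p = C.x 0 p ∧ C.n 1 p = C.n 0 p) :
    C.surf₁.σ p = C.surf₀.σ p := by
  have key : ∀ {k : SplitMetric} (S : IsotropicSurface k),
      S.σ p = (Real.sqrt 2 / 2) • (S.base p + S.normal p) := by
    intro k S
    rw [IsotropicSurface.base, IsotropicSurface.normal, ← smul_add,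
      smul_smul, ← sq, IsotropicSurface.sqrt_two_div_two_sq]
    module
  rw [key C.surf₁, key C.surf₀, ← C.start_eq.1, ← C.start_eq.2, ← C.end_eq.1, ← C.end_eq.2, hp.1,
    hp.2]

/-- The two isotropic surfaces of a lens cobordism from `g` to `e^{2u} g` differ by the factor
`e^u`: the factor is `± e^u`, it is `1` at infinity, and `𝐀` is connected and not compact. -/
theorem σ₁_eq {u : Annulus → ℝ}
    (hh : ∀ p, h.coeff 0 1 p = Real.exp (2 * u p) * g.coeff 0 1 p) :
    C.surf₁.σ = C.surf₀.rescaleσ u := by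
  have hη := C.smooth_dual₀
  set c : Annulus → ℝ := fun p => ip (C.surf₀.η p) (C.surf₁.σ p) with hcdef
  have hc : IsSmooth c := hη.ip C.surf₁.smooth
  have hσ : C.surf₁.σ = fun p => c p • C.surf₀.σ p := by
    funext p
    obtain ⟨r, hr⟩ := C.same_immersion p
    rw [hcdef]
    simp only [hr, ip_smul_right, C.surf₀.dual_pair, mul_one]
  have hsq : ∀ p, c p ^ 2 = Real.exp (u p) ^ 2 := by
    intro p
    have hd : ∀ i, pd i C.surf₁.σ p = c p • pd i C.surf₀.σ p + pd i c p • C.surf₀.σ p := fun i => by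
      rw [hσ]
      exact (hc.hasPd.smul C.surf₀.smooth.hasPd).pd_eq
    have hf := C.surf₀.isNullFrame p
    have hm := C.surf₁.metric 0 1 p
    simp only [hd, ip_add_left, ip_add_right, ip_smul_left, ip_smul_right, hf.ab, hf.σσ, hf.σb,
      ip_comm (pd 0 C.surf₀.σ p) (C.surf₀.σ p), hf.σa, hh] at hm
    have he2 : Real.exp (2 * u p) = Real.exp (u p) ^ 2 := by rw [← Real.exp_nat_mul]; simp
    rw [he2] at hm
    exact mul_right_cancel₀ (g.ne_zero p) (by linarith)
  obtain ⟨K, hK, h0⟩ := C.constant_at_infinity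
  obtain ⟨p₀, hp₀⟩ := exists_notMem_of_isCompact hK
  have hc₀ : c p₀ = 1 := by
    rw [hcdef]
    simp only [C.σ₁_eq_of_notMem (h0 1 (by simp) p₀ hp₀), C.surf₀.dual_pair]
  have hpos : ∀ p, 0 < c p := by
    intro p
    by_contra! hp
    obtain ⟨r, hr⟩ := mem_range_of_exists_le_of_exists_ge hc.continuous ⟨p, hp⟩
      ⟨p₀, hc₀ ▸ zero_le_one⟩
    have := hsq r
    rw [hr] at this
    exact (pow_ne_zero 2 (Real.exp_ne_zero (u r))) (by simpa using this.symm)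
  rw [hσ]
  funext p
  rw [IsotropicSurface.rescaleσ, (sq_eq_sq₀ (hpos p).le (Real.exp_pos _).le).1 (hsq p)]

theorem wVolume_eq {u : Annulus → ℝ} (hu : IsSmooth u) (hc : HasCompactSupport u)
    (hh : ∀ p, h.coeff 0 1 p = Real.exp (2 * u p) * g.coeff 0 1 p) :
    C.wVolume = (∫ p, u p * ((1 / 2) * pd 0 (pd 1 g.logCoeff) p) ∂angularMeasure) +
        (1 / 2) * ∫ p, u p * pd 0 (pd 1 u) p ∂angularMeasure := by
  rw [← IsotropicSurface.wVolume_rescaleCobordism C.smooth_dual₀ hu hc hh]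
  have hσ : C.surf₁.σ = (C.surf₀.rescale hu hh).σ := C.σ₁_eq hh
  have hη : C.surf₁.η = (C.surf₀.rescale hu hh).η := by
    funext p
    have hf := C.surf₁.isNullFrame p
    rw [hσ] at hf
    exact ((C.surf₀.rescale hu hh).isNullFrame p).dual_unique hf (h.ne_zero p)
  have hb : C.surf₁.base = (C.surf₀.rescale hu hh).base := by
    unfold IsotropicSurface.base
    rw [hσ, hη]
  have hn : C.surf₁.normal = (C.surf₀.rescale hu hh).normal := by
    unfold IsotropicSurface.normal
    rw [hσ, hη]
  set C' := C.surf₀.rescaleCobordism C.smooth_dual₀ hu hc hh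
  exact wVolume_congr (C.start_eq.1.trans C'.start_eq.1.symm)
    (C.start_eq.2.trans C'.start_eq.2.symm) (C.end_eq.1.trans (hb.trans C'.end_eq.1.symm))
    (C.end_eq.2.trans (hn.trans C'.end_eq.2.symm))

end LensCobordism

/-- The Liouville action in terms of the conformal factor. Lens cobordisms exist here, so that the
value is not the conventional one. -/
theorem liouvilleAction_eq {g h : SplitMetric} {u : Annulus → ℝ} (hu : IsSmooth u)
    (hc : HasCompactSupport u)
    (hh : ∀ p, h.coeff 0 1 p = Real.exp (2 * u p) * g.coeff 0 1 p) :
    liouvilleAction g h =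
      (∫ p, u p * ((1 / 2) * pd 0 (pd 1 g.logCoeff) p) ∂angularMeasure) +
        (1 / 2) * ∫ p, u p * pd 0 (pd 1 u) p ∂angularMeasure := by
  obtain ⟨S, hS⟩ := exists_isotropicSurface g
  have H : Nonempty (LensCobordism g h) := ⟨S.rescaleCobordism hS hu hc hh⟩
  rw [liouvilleAction, dif_pos H]
  exact (Classical.choice H).wVolume_eq hu hc hh

/-! ### Curvature -/

namespace SplitMetric

variable (g : SplitMetric)

theorem inv_apply (p : Annulus) : (Matrix.of fun k l => g.coeff k l p)⁻¹ =
    Matrix.of ![![0, 1 / g.coeff 0 1 p], ![1 / g.coeff 0 1 p, 0]] := by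
  have hF := g.ne_zero p
  refine Matrix.inv_eq_right_inv ?_
  have h := g.symm 1 0 p
  ext i j
  fin_cases i <;> fin_cases j <;>
    simp [Matrix.mul_apply, Fin.sum_univ_two, g.isotropic, h, hF]

/-- The only nonzero Christoffel symbols are `Γ⁰₀₀ = ∂₀ log F` and `Γ¹₁₁ = ∂₁ log F`, where
`F = g(∂₀, ∂₁)`. -/
theorem christoffel_eq (k i j : Fin 2) : g.christoffel k i j =
    if i = j ∧ k = i then pd i g.logCoeff else fun _ => 0 := by
  have h0 : ∀ i, g.coeff i i = fun _ => 0 := IsotropicSurface.coeff_self g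
  have h1 := IsotropicSurface.coeff_symm g
  have hz : ∀ i p, pd i (fun _ : Annulus => (0 : ℝ)) p = 0 := fun _ _ => (hasPd_const 0).pd_eq
  have hi := g.inv_apply
  funext p
  have hF := g.ne_zero p
  simp only [christoffel, inv, Fin.sum_univ_two, hi, g.pd_logCoeff]
  fin_cases k <;> fin_cases i <;> fin_cases j <;> simp [h0, h1, hz] <;> field_simp <;>
    try ring

theorem curvature_eq (p : Annulus) :
    g.curvature p = -pd 0 (pd 1 g.logCoeff) p / g.coeff 0 1 p := by
  have hz : ∀ i p, pd i (fun _ : Annulus => (0 : ℝ)) p = 0 := fun _ _ => (hasPd_const 0).pd_eq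
  have hF := g.ne_zero p
  simp only [curvature, riemann, Fin.sum_univ_two, christoffel_eq]
  simp [g.isotropic, hz, g.symm 1 0 p]
  field_simp

theorem smooth_curvature : IsSmooth g.curvature := by
  rw [show g.curvature = fun p => (-1 : ℝ) * pd 0 (pd 1 g.logCoeff) p / g.coeff 0 1 p from
    funext fun p => by rw [g.curvature_eq, neg_one_mul]]
  exact (((g.smooth_logCoeff.pd 1).pd 0).const_mul (-1)).div (g.smooth 0 1) g.ne_zero

theorem pd_pd_logCoeff_eq_curvature (p : Annulus) :
    pd 0 (pd 1 g.logCoeff) p = -(g.curvature p * g.coeff 0 1 p) := by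
  rw [g.curvature_eq, div_mul_cancel₀ _ (g.ne_zero p), neg_neg]

end SplitMetric

/-! ### Cut-off functions -/

theorem periodic_sin_sq : Function.Periodic (fun θ => Real.sin θ ^ 2) Real.pi := fun θ => by
  simp [Real.sin_add_pi]

/-- The function `sin² (a - b)` on the torus; it vanishes on the diagonal only. -/
def sinSq (y : RP1 × RP1) : ℝ := periodic_sin_sq.lift (y.1 - y.2)

theorem sinSq_proj (q : ℝ × ℝ) : sinSq (proj q) = Real.sin (q.1 - q.2) ^ 2 := by
  simp only [sinSq, proj, ← QuotientAddGroup.mk_sub]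
  exact periodic_sin_sq.lift_coe _

theorem continuous_sinSq : Continuous sinSq := by
  rw [isOpenQuotientMap_proj.isQuotientMap.continuous_iff]
  have : sinSq ∘ proj = fun q => Real.sin (q.1 - q.2) ^ 2 := funext sinSq_proj
  rw [this]
  fun_prop

theorem sinSq_pos (p : Annulus) : 0 < sinSq p.1 := by
  obtain ⟨q, hq, rfl⟩ := exists_mk p
  have : sinSq (mk q hq).1 = Real.sin (q.1 - q.2) ^ 2 := sinSq_proj q
  rw [this]
  exact pow_pos (lt_of_le_of_ne (abs_nonneg _) (abs_pos.2 (sin_sub_ne_zero hq)).ne) 2 |>.trans_eq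
    (sq_abs _)

/-- A smooth cut-off function, positive where `sin² (a - b) > δ` and zero elsewhere; for `δ > 0` it
has compact support. -/
def cutoff (δ : ℝ) (p : Annulus) : ℝ := Real.smoothTransition (sinSq p.1 - δ)

theorem cutoff_nonneg (δ : ℝ) (p : Annulus) : 0 ≤ cutoff δ p := Real.smoothTransition.nonneg _

theorem smooth_cutoff (δ : ℝ) : IsSmooth (cutoff δ) := by
  have h : ContDiff ℝ ∞ fun q : ℝ × ℝ =>
      Real.smoothTransition (Real.sin (q.1 - q.2) ^ 2 - δ) :=
    Real.smoothTransition.contDiff.comp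
      ((((contDiff_fst.sub contDiff_snd).sin).pow 2).sub contDiff_const)
  refine h.contDiffOn.congr fun q hq => ?_
  rw [lift_of_mem _ hq, cutoff, mk, sinSq_proj]

theorem hasCompactSupport_cutoff {δ : ℝ} (hδ : 0 < δ) : HasCompactSupport (cutoff δ) := by
  have hK : IsCompact {p : Annulus | δ ≤ sinSq p.1} := by
    rw [Topology.IsEmbedding.subtypeVal.isCompact_iff]
    have : ((↑) : Annulus → RP1 × RP1) '' {p : Annulus | δ ≤ sinSq p.1} = {y | δ ≤ sinSq y} := by
      ext y
      constructor
      · rintro ⟨p, hp, rfl⟩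
        exact hp
      · intro hy
        refine ⟨⟨y, fun h => ?_⟩, hy, rfl⟩
        obtain ⟨q, rfl⟩ := isOpenQuotientMap_proj.surjective y
        have h0 : sinSq (proj q) = sinSq (proj (0, 0)) := by
          simp only [sinSq, h, sub_self]
          simp [proj]
        rw [sinSq_proj (0, 0)] at h0
        simp at h0
        have : δ ≤ sinSq (proj q) := hy
        linarith
    rw [this]
    exact (isClosed_le continuous_const continuous_sinSq).isCompact
  refine .intro hK fun p hp => Real.smoothTransition.zero_of_nonpos ?_
  have : ¬ δ ≤ sinSq p.1 := hp
  linarith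

/-- The fundamental lemma of the calculus of variations, with the constraint that the test functions
have mean zero. -/
theorem SplitMetric.hasConstantCurvature_of_forall_integral {g : SplitMetric}
    (H : ∀ u : Annulus → ℝ, IsSmooth u → HasCompactSupport u →
      ∫ p, u p * g.coeff 0 1 p ∂angularMeasure = 0 →
      ∫ p, u p * pd 0 (pd 1 g.logCoeff) p ∂angularMeasure = 0) : g.HasConstantCurvature := by
  have hF := g.smooth 0 1
  have hK := g.smooth_curvature
  have int : ∀ {φ f : Annulus → ℝ}, IsSmooth φ → HasCompactSupport φ → IsSmooth f →
      Integrable (fun p => φ p * f p) angularMeasure := fun {φ f} h hc hf =>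
    (h.mul hf).integrable hc fun p hp => by simp [image_eq_zero_of_notMem_tsupport hp]
  -- `ψ` is a fixed test function with positive integral, used to restore the constraint, and `c` is
  -- the mean of the curvature with weight `ψ`.
  obtain ⟨p₀, -⟩ := exists_notMem_of_isCompact isCompact_empty
  have hδ₀ : 0 < sinSq p₀.1 / 2 := half_pos (sinSq_pos p₀)
  set ψ := cutoff (sinSq p₀.1 / 2)
  have hψ : IsSmooth ψ := smooth_cutoff _
  have hψc : HasCompactSupport ψ := hasCompactSupport_cutoff hδ₀
  have hψF : 0 < ∫ p, ψ p * g.coeff 0 1 p ∂angularMeasure := by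
    refine (hψ.mul hF).continuous.integral_pos_of_hasCompactSupport_nonneg_nonzero (x := p₀)
      hψc.mul_right (fun p => mul_nonneg (cutoff_nonneg _ p) (g.pos p).le) ?_
    exact mul_ne_zero (Real.smoothTransition.pos_of_pos (by linarith [sinSq_pos p₀])).ne'
      (g.ne_zero p₀)
  set I := ∫ p, ψ p * g.coeff 0 1 p ∂angularMeasure with hI
  set c := (∫ p, ψ p * (g.curvature p * g.coeff 0 1 p) ∂angularMeasure) / I with hc
  refine ⟨c, fun p => ?_⟩
  -- If `K(p) ≠ c`, test with `φ - m ψ`, where `φ = χ (K - c)`, `χ` is a cut-off function positive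
  -- at `p` and `m` makes the mean zero: this gives `∫ χ (K - c)² da_g = 0`.
  by_contra hp
  set χ := cutoff (sinSq p.1 / 2)
  have hχ : IsSmooth χ := smooth_cutoff _
  have hχc : HasCompactSupport χ := hasCompactSupport_cutoff (half_pos (sinSq_pos p))
  have hKc : IsSmooth fun p => g.curvature p - c := hK.sub (isSmooth_const c)
  set φ : Annulus → ℝ := fun p => χ p * (g.curvature p - c)
  have hφ : IsSmooth φ := hχ.mul hKc
  have hφc : HasCompactSupport φ := hχc.mul_right
  set m := (∫ p, φ p * g.coeff 0 1 p ∂angularMeasure) / I with hm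
  have e : ∀ {f : Annulus → ℝ}, IsSmooth f → ∫ p, (φ p - m * ψ p) * f p ∂angularMeasure =
      ∫ p, φ p * f p ∂angularMeasure - m * ∫ p, ψ p * f p ∂angularMeasure := by
    intro f hf
    rw [← integral_const_mul, ← integral_sub (int hφ hφc hf) ((int hψ hψc hf).const_mul m)]
    refine integral_congr_ae (Eventually.of_forall fun p => ?_)
    simp only
    ring
  have hu := H (fun p => φ p - m * ψ p) (hφ.sub (hψ.const_mul m)) (hφc.sub hψc.mul_left) (by
    rw [e hF, ← hI, hm, div_mul_cancel₀ _ hψF.ne', sub_self])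
  simp only [g.pd_pd_logCoeff_eq_curvature, mul_neg, integral_neg, neg_eq_zero] at hu
  rw [e (hK.mul hF)] at hu
  have hcI : ∫ p, ψ p * (g.curvature p * g.coeff 0 1 p) ∂angularMeasure = c * I := by
    rw [hc, div_mul_cancel₀ _ hψF.ne']
  have hmI : ∫ p, φ p * g.coeff 0 1 p ∂angularMeasure = m * I := by
    rw [hm, div_mul_cancel₀ _ hψF.ne']
  have hzero : ∫ p, χ p * ((g.curvature p - c) ^ 2 * g.coeff 0 1 p) ∂angularMeasure = 0 := by
    have : ∫ p, φ p * (g.curvature p * g.coeff 0 1 p) ∂angularMeasure -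
        c * ∫ p, φ p * g.coeff 0 1 p ∂angularMeasure = 0 := by
      rw [hmI]
      rw [hcI] at hu
      linarith
    rw [← this, ← integral_const_mul, ← integral_sub (int hφ hφc (hK.mul hF))
      ((int hφ hφc hF).const_mul c)]
    refine integral_congr_ae (Eventually.of_forall fun p => ?_)
    simp only [φ]
    ring
  have hsm : IsSmooth fun p => (g.curvature p - c) ^ 2 * g.coeff 0 1 p :=
    (hKc.comp_contDiff (contDiff_id.pow 2)).mul hF
  refine ((hχ.mul hsm).continuous.integral_pos_of_hasCompactSupport_nonneg_nonzero (x := p)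
      hχc.mul_right (fun q => mul_nonneg (cutoff_nonneg _ q)
        (mul_nonneg (sq_nonneg _) (g.pos q).le)) ?_).ne' hzero
  exact mul_ne_zero (Real.smoothTransition.pos_of_pos (by linarith [sinSq_pos p])).ne'
    (mul_ne_zero (pow_ne_zero 2 (sub_ne_zero.2 hp)) (g.ne_zero p))

/-! ### First variations -/

section Variation

variable {g : SplitMetric}

/-- The first variation of `𝒮(g, ·)` at `g` in the direction of `2 u g`; the integral is
`-∫ u K da_g`. -/
theorem hasDerivAt_liouvilleAction_weyl {u : Annulus → ℝ} (hu : IsSmooth u)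
    (hc : HasCompactSupport u) :
    HasDerivAt (fun t : ℝ => liouvilleAction g (g.weyl u hu t))
      ((1 / 2) * ∫ p, u p * pd 0 (pd 1 g.logCoeff) p ∂angularMeasure) 0 := by
  set A := ∫ p, u p * pd 0 (pd 1 g.logCoeff) p ∂angularMeasure
  set B := ∫ p, u p * pd 0 (pd 1 u) p ∂angularMeasure
  have e : ∀ t : ℝ, liouvilleAction g (g.weyl u hu t) = t * ((1 / 2) * A) + t ^ 2 * (B / 2) := by
    intro t
    rw [liouvilleAction_eq (hu.const_mul t) hc.mul_left
      (IsotropicSurface.weyl_coeff_apply hu t), hu.pd_const_mul, (hu.pd 1).pd_const_mul]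
    have h1 : ∀ p, t * u p * ((1 / 2) * pd 0 (pd 1 g.logCoeff) p) =
        t * (1 / 2) * (u p * pd 0 (pd 1 g.logCoeff) p) := fun p => by ring
    have h2 : ∀ p, t * u p * (t * pd 0 (pd 1 u) p) = t ^ 2 * (u p * pd 0 (pd 1 u) p) :=
      fun p => by ring
    simp only [h1, h2, integral_const_mul]
    ring
  simp only [e]
  have h1 := ((hasDerivAt_id (0 : ℝ)).mul_const ((1 / 2) * A)).add
    ((hasDerivAt_pow 2 (0 : ℝ)).mul_const (B / 2))
  refine h1.congr_deriv ?_
  simp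

variable {γ : ℝ → SplitMetric} {K : Set Annulus}

/-- The derivative of the area of `K`, where `K` contains the support of the deformation. -/
theorem hasDerivAt_area (hγ : JSmooth univ fun t => (γ t).coeff 0 1)
    (hK : IsCompact K) (hsupp : ∀ t, ∀ p ∉ K, (γ t).coeff 0 1 p = g.coeff 0 1 p) :
    HasDerivAt (fun t => (γ t).areaIntegralOn K fun _ => 1)
      (∫ p, dt univ (fun t => (γ t).coeff 0 1) 0 p ∂angularMeasure) 0 := by
  have hd := hγ.sub (g.smooth 0 1).family
  have hz : ∀ t ∈ univ, ∀ p ∉ K, (γ t).coeff 0 1 p - g.coeff 0 1 p = 0 := fun t _ p hp => by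
    rw [hsupp t p hp, sub_self]
  have h := hd.hasDerivAt_integral uniqueDiffOn_univ hK hz (t := 0) univ_mem
  have e : dt univ (fun t p => (γ t).coeff 0 1 p - g.coeff 0 1 p) 0 =
      dt univ (fun t => (γ t).coeff 0 1) 0 := by
    funext p
    simp [dt]
  rw [e] at h
  refine (h.add_const (∫ p in K, g.coeff 0 1 p ∂angularMeasure)).congr_of_eventuallyEq
    (Eventually.of_forall fun t => ?_)
  have int : ∀ k : SplitMetric, IntegrableOn (k.coeff 0 1) K angularMeasure := fun k =>
    (k.smooth 0 1).continuous.continuousOn.integrableOn_compact hK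
  simp only [SplitMetric.areaIntegralOn, SplitMetric.areaDensity, one_mul]
  rw [← setIntegral_eq_integral_of_forall_compl_eq_zero (hz t (mem_univ t)),
    integral_sub (int _) (int _), sub_add_cancel]

/-- The first variation of `𝒮(·, g)` at `g`. Every deformation is conformal,
`g = e^{2u} γ_t` with `u = (1/2) (log F - log F_t)`, which reduces the claim to
`liouvilleAction_eq`. -/
theorem hasDerivAt_liouvilleAction (hγ : JSmooth univ fun t => (γ t).coeff 0 1) (h0 : γ 0 = g)
    (hK : IsCompact K) (hsupp : ∀ t, ∀ p ∉ K, (γ t).coeff 0 1 p = g.coeff 0 1 p) :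
    HasDerivAt (fun t => liouvilleAction (γ t) g)
      ((1 / 4) * ∫ p, g.curvature p * dt univ (fun t => (γ t).coeff 0 1) 0 p ∂angularMeasure)
      0 := by
  have hI : UniqueDiffOn ℝ (univ : Set ℝ) := uniqueDiffOn_univ
  have hL : JSmooth univ fun t => (γ t).logCoeff := hγ.log fun t _ p => (γ t).ne_zero p
  have hu : JSmooth univ fun t p => (1 / 2) * (g.logCoeff p - (γ t).logCoeff p) :=
    (g.smooth_logCoeff.family.sub hL).const_mul _
  set u : ℝ → Annulus → ℝ := fun t p => (1 / 2) * (g.logCoeff p - (γ t).logCoeff p) with hudef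
  have hu0 : ∀ t, ∀ p ∉ K, u t p = 0 := fun t p hp => by
    simp [hudef, SplitMetric.logCoeff, hsupp t p hp]
  have huz : u 0 = fun _ => 0 := by
    funext p
    simp [hudef, h0]
  have hV : JSmooth univ fun t p =>
      (1 / 2) * pd 0 (pd 1 (γ t).logCoeff) p + (1 / 2) * pd 0 (pd 1 (u t)) p :=
    (((hL.pd hI 1).pd hI 0).const_mul _).add (((hu.pd hI 1).pd hI 0).const_mul _)
  set V : ℝ → Annulus → ℝ := fun t p =>
    (1 / 2) * pd 0 (pd 1 (γ t).logCoeff) p + (1 / 2) * pd 0 (pd 1 (u t)) p with hVdef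
  have hf : JSmooth univ fun t p => u t p * V t p := hu.mul hV
  have hf0 : ∀ t ∈ univ, ∀ p ∉ K, u t p * V t p = 0 := fun t _ p hp => by
    rw [hu0 t p hp, zero_mul]
  have e : ∀ t, liouvilleAction (γ t) g = ∫ p, u t p * V t p ∂angularMeasure := by
    intro t
    have hut := hu.slice (mem_univ t)
    have hc : HasCompactSupport (u t) := .intro hK (hu0 t)
    have int : ∀ {f : Annulus → ℝ}, IsSmooth f →
        Integrable (fun p => u t p * f p) angularMeasure := fun hf =>
      (hut.mul hf).integrable hK fun p hp => by simp [hu0 t p hp]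
    rw [liouvilleAction_eq hut hc fun p => ?_]
    · rw [← integral_const_mul, ← integral_add
        (int (((γ t).smooth_logCoeff.pd 1).pd 0 |>.const_mul _))
        ((int ((hut.pd 1).pd 0)).const_mul _)]
      refine integral_congr_ae (Eventually.of_forall fun p => ?_)
      simp only [hVdef]
      ring
    · have : 2 * u t p = g.logCoeff p - (γ t).logCoeff p := by
        simp only [hudef]
        ring
      rw [this, Real.exp_sub, SplitMetric.logCoeff, SplitMetric.logCoeff, Real.exp_log (g.pos p),
        Real.exp_log ((γ t).pos p), div_mul_cancel₀ _ ((γ t).ne_zero p)]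
  simp only [e]
  refine (hf.hasDerivAt_integral hI hK hf0 (t := 0) univ_mem).congr_deriv ?_
  rw [← integral_const_mul]
  refine integral_congr_ae (Eventually.of_forall fun p => ?_)
  have hF' := hγ.hasDerivAt (t := 0) univ_mem p
  have hL' := hF'.log ((γ 0).ne_zero p)
  have hu' : HasDerivAt (fun t => u t p) _ 0 := (hL'.const_sub (g.logCoeff p)).const_mul (1 / 2)
  have hV' := hV.hasDerivAt (t := 0) univ_mem p
  have hf' := (hf.hasDerivAt (t := 0) univ_mem p).unique (hu'.mul hV')
  have hz : ∀ i, pd i (fun _ : Annulus => (0 : ℝ)) = fun _ => 0 :=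
    fun _ => funext fun _ => (hasPd_const 0).pd_eq
  have hV0 : V 0 p = (1 / 2) * pd 0 (pd 1 g.logCoeff) p := by
    simp [hVdef, huz, hz, h0]
  have hF := g.ne_zero p
  simp only [hf', hV0, huz, h0, g.pd_pd_logCoeff_eq_curvature]
  field_simp
  ring

theorem jsmooth_weyl_coeff {u : Annulus → ℝ} (hu : IsSmooth u) (i j : Fin 2) :
    JSmooth univ fun t => (g.weyl u hu t).coeff i j :=
  ((jsmooth_time.mul hu.family).const_mul 2).exp.mul (g.smooth i j).family

theorem weyl_zero {u : Annulus → ℝ} (hu : IsSmooth u) : g.weyl u hu 0 = g := by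
  obtain ⟨F, -, -, -, -⟩ := g
  simp [SplitMetric.weyl, SplitMetric.conformal]

theorem weyl_coeff_of_notMem {u : Annulus → ℝ} (hu : IsSmooth u) (t : ℝ) (i j : Fin 2)
    {p : Annulus} (hp : p ∉ tsupport u) : (g.weyl u hu t).coeff i j p = g.coeff i j p := by
  simp [SplitMetric.weyl, SplitMetric.conformal, image_eq_zero_of_notMem_tsupport hp]

theorem dt_weyl_coeff {u : Annulus → ℝ} (hu : IsSmooth u) (p : Annulus) :
    dt univ (fun t => (g.weyl u hu t).coeff 0 1) 0 p = 2 * (u p * g.coeff 0 1 p) := by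
  have h := (((((hasDerivAt_id (0 : ℝ)).mul_const (u p)).const_mul 2).exp).mul_const
    (g.coeff 0 1 p))
  refine (((jsmooth_weyl_coeff hu 0 1).hasDerivAt univ_mem p).unique h).trans ?_
  simp only [id, zero_mul, mul_zero, Real.exp_zero]
  ring

/-- The conformal deformation `e^{2tu} g` is area preserving when `u` has mean zero. -/
theorem isAreaPreservingDeformation_weyl {u : Annulus → ℝ} (hu : IsSmooth u)
    (hc : HasCompactSupport u) (hm : ∫ p, u p * g.coeff 0 1 p ∂angularMeasure = 0) :
    IsAreaPreservingDeformation g (g.weyl u hu) where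
  start := weyl_zero hu
  smooth := jsmooth_weyl_coeff hu
  area := by
    refine ⟨tsupport u, hc, fun t i j p hp => weyl_coeff_of_notMem hu t i j hp,
      (hasDerivAt_area (g := g) (jsmooth_weyl_coeff hu 0 1) hc
        fun t p hp => weyl_coeff_of_notMem hu t 0 1 hp).congr_deriv ?_⟩
    simp only [dt_weyl_coeff, integral_const_mul, hm, mul_zero]

end Variation

/-! ### Critical metrics -/

section Criticality

variable {g : SplitMetric}

theorem SplitMetric.areaIntegralOn_univ (u : Annulus → ℝ) :
    g.areaIntegralOn univ u = ∫ p, u p * g.coeff 0 1 p ∂angularMeasure := by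
  rw [areaIntegralOn, Measure.restrict_univ]
  rfl

theorem hasConstantCurvature_iff_weyl :
    (∀ (u : Annulus → ℝ) (hu : IsSmooth u), HasCompactSupport u → g.areaIntegralOn univ u = 0 →
      HasDerivAt (fun t : ℝ => liouvilleAction g (g.weyl u hu t)) 0 0) ↔
    g.HasConstantCurvature := by
  simp only [SplitMetric.areaIntegralOn_univ]
  constructor
  · intro H
    refine SplitMetric.hasConstantCurvature_of_forall_integral fun u hu hc hm => ?_
    have := (hasDerivAt_liouvilleAction_weyl hu hc).unique (H u hu hc hm)
    linarith
  · rintro ⟨c, hcurv⟩ u hu hc hm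
    refine (hasDerivAt_liouvilleAction_weyl hu hc).congr_deriv ?_
    simp only [g.pd_pd_logCoeff_eq_curvature, hcurv, mul_neg, mul_left_comm _ c, integral_neg,
      integral_const_mul, hm, mul_zero, neg_zero]

theorem hasConstantCurvature_iff_areaPreserving :
    (∀ γ : ℝ → SplitMetric, IsAreaPreservingDeformation g γ →
      HasDerivAt (fun t : ℝ => liouvilleAction (γ t) g) 0 0) ↔ g.HasConstantCurvature := by
  constructor
  · intro H
    refine SplitMetric.hasConstantCurvature_of_forall_integral fun u hu hc hm => ?_
    have h := (hasDerivAt_liouvilleAction (jsmooth_weyl_coeff hu 0 1) (weyl_zero hu) hc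
      fun t p hp => weyl_coeff_of_notMem hu t 0 1 hp).unique
        (H _ (isAreaPreservingDeformation_weyl hu hc hm))
    simp only [dt_weyl_coeff, mul_left_comm _ (2 : ℝ), integral_const_mul] at h
    simp only [g.pd_pd_logCoeff_eq_curvature, mul_neg, integral_neg,
      mul_left_comm _ (g.curvature _)]
    linarith
  · rintro ⟨c, hcurv⟩ γ hγ
    obtain ⟨K, hK, hsupp, harea⟩ := hγ.area
    have hsupp' := fun t => hsupp t 0 1
    have h0 := (hasDerivAt_area (hγ.smooth 0 1) hK hsupp').unique harea
    refine (hasDerivAt_liouvilleAction (hγ.smooth 0 1) hγ.start hK hsupp').congr_deriv ?_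
    simp only [hcurv, integral_const_mul, h0, mul_zero]

end Criticality

end SplitLiouville

end

theorem mainTheorem5 (g : SplitLiouville.SplitMetric) :
    ((∀ (u : SplitLiouville.Annulus → ℝ) (hu : SplitLiouville.IsSmooth u),
        HasCompactSupport u → g.areaIntegralOn Set.univ u = 0 →
        HasDerivAt (fun t : ℝ => SplitLiouville.liouvilleAction g (g.weyl u hu t)) 0 0) ↔
      g.HasConstantCurvature) ∧
    ((∀ γ : ℝ → SplitLiouville.SplitMetric,
        SplitLiouville.IsAreaPreservingDeformation g γ →
        HasDerivAt (fun t : ℝ => SplitLiouville.liouvilleAction (γ t) g) 0 0) ↔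
      g.HasConstantCurvature) :=
  ⟨SplitLiouville.hasConstantCurvature_iff_weyl,
    SplitLiouville.hasConstantCurvature_iff_areaPreserving⟩
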